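/- Let $p\in(1,2]$. There are constants $c_X,c_T,c_M,c_K,C>0$ and $a,b\ge 0$, depending only on $p$, such that the following holds for all $d_x\ge 0$, $d_y\ge 1$, $\ell,\mu,\varepsilon>0$ and $\sigma\ge 0$. **Problem.** Let $f:\mathbb R^{d_x}\times\mathbb R^{d_y}\to\mathbb R$ be differentiable with $\ell$-Lipschitz gradient (jointly, Euclidean norm), let $f(x,\cdot)$ be $\mu$-strongly concave for every $x$, and let $\Phi(x)=\max_{y}f(x,y)$ be bounded below. Put $\kappa=\ell/\mu$ and $y^*(x)=\operatorname{argmax}_y f(x,y)$. The oracle returns $\nabla F(x,y;\xi)$, jointly measurable in $(x,y,\xi)$, where $\xi$ is a fresh sample of a fixed law and, for all $(x,y)$, $$\mathbb E[\nabla F(x,y;\xi)]=\nabla f(x,y),\qquad \mathbb E\|\nabla F(x,y;\xi)-\nabla f(x,y)\|^p\le\sigma^p .$$ **Method (N²SGDA).** Let $\operatorname{clip}(v,\tau)=\min\{1,\tau/\|v\|\}\,v$. Start at $x_0$, $\hat y_{0,0}$. For $t=0,\dots,T-1$: for $k=0,\dots,K-1$ set $\hat y_{t,k+1}=\hat y_{t,k}+\eta_{y}\operatorname{clip}(\nabla_yF(x_t,\hat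 y_{t,k};\xi_{t,k}),\tau_{k})$; put $y_t=\hat y_{t+1,0}=\hat y_{t,K}$, $g_t=\frac1M\sum_{i=1}^M\nabla_xF(x_t,y_t;\xi'_{t,i})$ and $x_{t+1}=x_t-\eta_x g_t/\|g_t\|$ (with $x_{t+1}=x_t$ if $g_t=0$). All samples are independent. Return $\hat x$, drawn uniformly from $\{x_1,\dots,x_T\}$, independently of the samples. **Parameters.** Let $\Delta_\Phi=\Phi(x_0)-\inf\Phi$, let $R_0\ge\|\hat y_{0,0}-y^*(x_0)\|$ be arbitrary, $R_y=R_0+4\varepsilon/\ell$, $L=\ln(\ell R_y/\varepsilon)$, and $$\eta_x=\frac{c_X\,\varepsilon}{\kappa\ell},\quad T=\max\Big\{1,\Big\lceil\frac{c_T\,\Delta_\Phi\kappa\ell}{\varepsilon^2}\Big\rceil\Big\},\quad M=\max\Big\{1,\Big\lceil c_M\Big(\frac{\sigma}{\varepsilon}\Big)^{\frac p{p-1}}\Big\rceil\Big\},$$ $$K=\Big\lceil c_K L^{a}\Big(\kappa+\Big(\frac{\ell^2\sigma^2}{\mu^2\varepsilon^2}\Big)^{\frac p{2(p-1)}}\Big)\Big\rceil,\quad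 \eta_{y}=\min\Big\{\frac1{400\ell},\frac{\ln B}{\mu K}\Big\},\quad \tau_{k}=\frac{e^{-\eta_y\mu(1+k/2)}R_y}{120\,\eta_y},$$ where $B$ is the solution of $B=\max\Big\{2,\dfrac{\mu^2K^{2(p-1)/p}R_y^2}{5400^{2/p}\sigma^2(\ln B)^2}\Big\}$ (for $\sigma=0$, $B=+\infty$, so that $\eta_y=1/(400\ell)$). **Conclusion.** $\Phi$ is differentiable and $\mathbb E\|\nabla\Phi(\hat x)\|\le\varepsilon$. Moreover, if $\varepsilon^2\le\Delta_\Phi\kappa\ell$, the number of calls to the stochastic first-order oracle in the $T$ iterations is at most $$C\,L^{b}\left(\frac{\Delta_\Phi\,\kappa^{\frac{2p-1}{p-1}}\,\ell\,\sigma^{\frac p{p-1}}}{\varepsilon^{\frac{3p-2}{p-1}}}+\frac{\Delta_\Phi\,\kappa^2\,\ell}{\varepsilon^2}\right).$$ -/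

import Mathlib

open MeasureTheory ProbabilityTheory
open scoped Gradient
universe u v


namespace Minimax

/-- `ℝᵈ` with the Euclidean norm. -/
abbrev Vec (d : ℕ) : Type := EuclideanSpace ℝ (Fin d)

/-- `ℝ^{dx} × ℝ^{dy}` with the Euclidean norm `‖(x, y)‖² = ‖x‖² + ‖y‖²`. -/
abbrev Joint (dx dy : ℕ) : Type := WithLp 2 (Vec dx × Vec dy)

/-- The point `(x, y)` of the product space. -/
def pair {dx dy : ℕ} (x : Vec dx) (y : Vec dy) : Joint dx dy := WithLp.toLp 2 (x, y)

noncomputable section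

/-- The primal function `Φ(x) = max_y f(x, y)`. -/
def primal {dx dy : ℕ} (f : Joint dx dy → ℝ) (x : Vec dx) : ℝ := ⨆ y : Vec dy, f (pair x y)

/-- `f` is jointly `ℓ`-smooth, `f(x, ·)` is `μ`-strongly concave for every `x`, and `Φ` is
bounded below. -/
structure IsSmoothStronglyConcave {dx dy : ℕ} (ℓ μ : ℝ) (f : Joint dx dy → ℝ) : Prop where
  differentiable : Differentiable ℝ f
  smooth : ∀ z w : Joint dx dy, ‖∇ f z - ∇ f w‖ ≤ ℓ * ‖z - w‖
  strongConcave : ∀ x : Vec dx, StrongConcaveOn Set.univ μ (fun y : Vec dy => f (pair x y))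
  bddBelow : BddBelow (Set.range (primal f))

/-- `G(x, y; ξ)`, with `ξ ∼ P`, is an unbiased gradient oracle for `f` whose `p`-th central moment
is at most `σ ^ p` at every point. -/
structure IsPBCMOracle {dx dy : ℕ} {Ξ : Type*} [MeasurableSpace Ξ] (p σ : ℝ)
    (f : Joint dx dy → ℝ) (P : Measure Ξ) (G : Joint dx dy → Ξ → Joint dx dy) : Prop where
  measurable : Measurable (fun q : Joint dx dy × Ξ => G q.1 q.2)
  integrable : ∀ z, Integrable (G z) P
  unbiased : ∀ z, ∫ ξ, G z ξ ∂P = ∇ f z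
  moment : ∀ z, ∫⁻ ξ, ENNReal.ofReal (‖G z ξ - ∇ f z‖ ^ p) ∂P ≤ ENNReal.ofReal (σ ^ p)

/-- `clip(v, τ) = min(1, τ / ‖v‖) v`. -/
def clip {d : ℕ} (v : Vec d) (τ : ℝ) : Vec d := min 1 (τ / ‖v‖) • v

/-- Input of the nested-loop normalized stochastic gradient descent ascent method. -/
structure Params (dx dy : ℕ) where
  x₀ : Vec dx
  y₀ : Vec dy
  etaX : ℝ
  etaY : ℕ → ℝ
  tau : ℕ → ℕ → ℝ
  T : ℕ
  K : ℕ
  M : ℕ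

/-- State of the method: the two current iterates and the number of calls made so far to the
stochastic first-order oracle. -/
structure State (dx dy : ℕ) where
  x : Vec dx
  y : Vec dy
  calls : ℕ

/-- One inner step: a single oracle call with sample `ξ`, then a clipped ascent step in `y`. -/
def innerStep {dx dy : ℕ} {Ξ : Type*} (G : Joint dx dy → Ξ → Joint dx dy) (η τ : ℝ) (ξ : Ξ)
    (s : State dx dy) : State dx dy where
  x := s.x
  y := s.y + η • clip (G (pair s.x s.y) ξ).snd τ
  calls := s.calls + 1

/-- The first `k` inner steps, with clipping levels `τ 0, τ 1, …` and samples `ξ 0, ξ 1, …`. -/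
def innerLoop {dx dy : ℕ} {Ξ : Type*} (G : Joint dx dy → Ξ → Joint dx dy) (η : ℝ) (τ : ℕ → ℝ)
    (ξ : ℕ → Ξ) (s : State dx dy) : ℕ → State dx dy
  | 0 => s
  | k + 1 => innerStep G η (τ k) (ξ k) (innerLoop G η τ ξ s k)

/-- Minibatch estimate `(1 / M) ∑_{i < M} ∇ₓ F(x, y; ξ i)`. -/
def minibatch {dx dy : ℕ} {Ξ : Type*} (G : Joint dx dy → Ξ → Joint dx dy) (M : ℕ) (ξ : ℕ → Ξ)
    (s : State dx dy) : Vec dx :=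
  (M : ℝ)⁻¹ • ∑ i ∈ Finset.range M, (G (pair s.x s.y) (ξ i)).fst

/-- The normalized step in `x`; it makes `M` oracle calls. If the minibatch gradient vanishes, then
`x` does not move. -/
def normalizedStep {dx dy : ℕ} {Ξ : Type*} (G : Joint dx dy → Ξ → Joint dx dy) (η : ℝ) (M : ℕ)
    (ξ : ℕ → Ξ) (s : State dx dy) : State dx dy where
  x := s.x - η • (‖minibatch G M ξ s‖⁻¹ • minibatch G M ξ s)
  y := s.y
  calls := s.calls + M

/-- State after `t` outer iterations; `ξy t k` is the sample of inner step `k` of iteration `t`, and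
`ξx t i` is the `i`-th minibatch sample of iteration `t`. -/
def run {dx dy : ℕ} {Ξ : Type*} (G : Joint dx dy → Ξ → Joint dx dy) (prm : Params dx dy)
    (ξy ξx : ℕ → ℕ → Ξ) : ℕ → State dx dy
  | 0 => ⟨prm.x₀, prm.y₀, 0⟩
  | t + 1 => normalizedStep G prm.etaX prm.M (ξx t)
      (innerLoop G (prm.etaY t) (prm.tau t) (ξy t) (run G prm ξy ξx t) prm.K)

/-- Randomness of one run: `ξ (Sum.inl (t, k))` (inner loop) and `ξ (Sum.inr (t, i))` (minibatch)
are i.i.d. samples of `P`, and `J` is uniform on `{1, …, T}` and independent of all samples. -/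
structure IsSampling {Ω Ξ : Type*} [MeasurableSpace Ω] [MeasurableSpace Ξ] (Pr : Measure Ω)
    (P : Measure Ξ) (T : ℕ) (ξ : (ℕ × ℕ) ⊕ (ℕ × ℕ) → Ω → Ξ) (J : Ω → ℕ) : Prop where
  law : ∀ i, MeasurePreserving (ξ i) Pr P
  indep : iIndepFun ξ Pr
  measurable_index : Measurable J
  uniform_index : ∀ t ∈ Finset.Icc 1 T, Pr (J ⁻¹' {t}) = (T : ENNReal)⁻¹
  indep_index : IndepFun J (fun ω i => ξ i ω) Pr

/-- State after `t` outer iterations, as a random variable. -/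
def randomRun {dx dy : ℕ} {Ω Ξ : Type*} (G : Joint dx dy → Ξ → Joint dx dy) (prm : Params dx dy)
    (ξ : (ℕ × ℕ) ⊕ (ℕ × ℕ) → Ω → Ξ) (t : ℕ) (ω : Ω) : State dx dy :=
  run G prm (fun t k => ξ (Sum.inl (t, k)) ω) (fun t i => ξ (Sum.inr (t, i)) ω) t

/-- The returned point `x̂ = x_J`. -/
def output {dx dy : ℕ} {Ω Ξ : Type*} (G : Joint dx dy → Ξ → Joint dx dy) (prm : Params dx dy)
    (ξ : (ℕ × ℕ) ⊕ (ℕ × ℕ) → Ω → Ξ) (J : Ω → ℕ) (ω : Ω) : Vec dx :=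
  (randomRun G prm ξ (J ω) ω).x

/-- `Δ_Φ = Φ(x₀) - inf Φ`. -/
def primalGap {dx dy : ℕ} (f : Joint dx dy → ℝ) (x₀ : Vec dx) : ℝ :=
  primal f x₀ - ⨅ x : Vec dx, primal f x

/-- The fixed-point equation
`B = max {2, μ² K^{2(p-1)/p} R² / (5400^{2/p} σ² (ln B)²)}`, which has exactly one solution. -/
def IsLogFactor (p μ σ R : ℝ) (K : ℕ) (B : ℝ) : Prop :=
  B = max 2 (μ ^ 2 * (K : ℝ) ^ (2 * (p - 1) / p) * R ^ 2 /
    ((5400 : ℝ) ^ (2 / p) * σ ^ 2 * Real.log B ^ 2))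

/-- Inner stepsize `min {1 / (400 ℓ), ln B / (μ K)}`; without noise `B` is infinite, and the
minimum is `1 / (400 ℓ)`. -/
def innerStepsize (ℓ μ σ : ℝ) (K : ℕ) (B : ℝ) : ℝ :=
  if σ = 0 then 1 / (400 * ℓ) else min (1 / (400 * ℓ)) (Real.log B / (μ * K))

/-- Clipping level `exp(-η μ (1 + k / 2)) R / (120 η)`. -/
def clipLevel (μ R η : ℝ) (k : ℕ) : ℝ :=
  Real.exp (-(η * μ * (1 + k / 2))) * R / (120 * η)

/-- `max {1, ⌈C Δ κ ℓ / ε²⌉}`. -/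
def outerLength (C ε ℓ κ Δ : ℝ) : ℕ := max 1 ⌈C * (Δ * κ * ℓ / ε ^ 2)⌉₊

/-- `max {1, ⌈C (σ / ε)^{p/(p-1)}⌉}`. -/
def batchSize (C p ε σ : ℝ) : ℕ := max 1 ⌈C * (σ / ε) ^ (p / (p - 1))⌉₊

/-- `⌈C (ln (ℓ R / ε))^a (κ + (ℓ² σ² / (μ² ε²))^{p/(2(p-1))})⌉`. -/
def innerLength (C a p ε ℓ μ σ κ R : ℝ) : ℕ :=
  ⌈C * Real.log (ℓ * R / ε) ^ a *
    (κ + (ℓ ^ 2 * σ ^ 2 / (μ ^ 2 * ε ^ 2)) ^ (p / (2 * (p - 1))))⌉₊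

end

end Minimax

namespace Minimax

open scoped RealInnerProductSpace

/-! ### Functions with Lipschitz gradient. -/

section Smooth

variable {E : Type*} [NormedAddCommGroup E] [InnerProductSpace ℝ E] [CompleteSpace E]

/-! By Danskin's theorem `∇Φ(x) = ∇ₓf(x, y*(x))`, and this map is `2κℓ`-Lipschitz. A normalized step
of length `η` therefore lowers `Φ` by `η‖∇Φ‖`, up to `2η‖g - ∇Φ‖` and a term of order `κℓη²`
(`primal_normalized_step_le`). After telescoping, it remains to show that the minibatch error and
`ℓ‖y_t - y*(x_t)‖`, averaged over the outer iterations, have expectation at most a small multiple of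
`ε`. The minibatch error is handled by an inequality of von Bahr–Esseen type
(`lintegral_batchSum_rpow_le`).

The tracking error is the hard part. Inner iterates are compared with radii `r_k` that shrink like
`exp(-ημk/2)`, and the clipping levels limit each step to length `r_k / 120`. Up to a variance `q
r_k² / 2`, with `q` a bound for the clipped noise, a step acts like a deterministic one
(`exists_effective_radius`): if the gradient is small, the distance contracts by a factor `1 -
0.99ημ`, up to a small bias; if it is large, the distance drops by at least `1.56ημ r_k`. Far from
the maximizer, both beat the shrinking of a threshold proportional to `r_k`.

Two potentials work in tandem. The bounded one, `escape`, detects that the distance has left `5r/4`;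
its mean grows by at most `q ≤ (3/K)(r_K/r_k)` per step. The unbounded one, `excess`, receives noise
of size `q r_k²` only where `escape` equals `1`, because steps are short. For a loop that starts
inside, the mean of `escape` is of order `r_K/r_k`, so the total input to `excess` is of order
`r_K²` instead of `r_K R` (`excessMean_inner_le`).

No high-probability event and no union bound over outer iterations is used, and runs that escape are
not discarded. The `excess` left at the end of a loop pays for both potentials at the start of the
next, where the radius is again `R`, and still leaves the margin `decrease` (`excess_add_le`).
Telescoping bounds the sum of the expected margins by order `T r_K²`; since the distance is at most
`(2/r_K)` times the margin plus `7r_K/2`, the average tracking error is of order `r_K`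
(`sum_lintegral_gap_le`).

The fixed-point equation for `B` reconciles the two demands on the stepsize: `r_K ≤ ε/(1000ℓ)`, and
noise small enough at every clipping level (`logFactor_spec`, `inner_parameters`). -/

theorem hasDerivAt_line {F : E → ℝ} (hF : Differentiable ℝ F) (y v : E) (t : ℝ) :
    HasDerivAt (fun t : ℝ => F (y + t • v)) ⟪∇ F (y + t • v), v⟫ t := by
  have h1 : HasDerivAt (fun t : ℝ => y + t • v) v t := by
    simpa using ((hasDerivAt_id t).smul_const v).const_add y
  have h2 := ((hF (y + t • v)).hasGradientAt.hasFDerivAt).comp_hasDerivAt t h1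
  rw [InnerProductSpace.toDual_apply_apply] at h2
  exact h2

/-- The two-sided quadratic bound for a function with Lipschitz gradient. -/
theorem abs_sub_linear_le {F : E → ℝ} {ℓ : ℝ} (hF : Differentiable ℝ F)
    (hL : ∀ z w : E, ‖∇ F z - ∇ F w‖ ≤ ℓ * ‖z - w‖) (y z : E) :
    |F z - F y - ⟪∇ F y, z - y⟫| ≤ ℓ / 2 * ‖z - y‖ ^ 2 := by
  set v := z - y with hv
  have hd : ∀ t : ℝ, HasDerivAt (fun t : ℝ => F (y + t • v) - F y - t * ⟪∇ F y, v⟫)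
      (⟪∇ F (y + t • v), v⟫ - ⟪∇ F y, v⟫) t := by
    intro t
    have := ((hasDerivAt_line hF y v t).sub_const (F y)).sub
      ((hasDerivAt_id t).mul_const ⟪∇ F y, v⟫)
    rw [one_mul] at this
    exact this
  have hB : ∀ t : ℝ, HasDerivAt (fun t : ℝ => ℓ / 2 * t ^ 2 * ‖v‖ ^ 2) (ℓ * t * ‖v‖ ^ 2) t := by
    intro t
    have := (((hasDerivAt_pow 2 t).const_mul (ℓ / 2)).mul_const (‖v‖ ^ 2))
    refine this.congr_deriv ?_
    push_cast
    ring
  -- Comparison of derivatives on `[0, 1]` takes the place of an integral remainder.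
  have key := image_norm_le_of_norm_deriv_right_le_deriv_boundary (a := 0) (b := 1)
    (f := fun t : ℝ => F (y + t • v) - F y - t * ⟪∇ F y, v⟫)
    (f' := fun t => ⟪∇ F (y + t • v), v⟫ - ⟪∇ F y, v⟫)
    (fun t _ => (hd t).continuousAt.continuousWithinAt)
    (fun t _ => (hd t).hasDerivWithinAt) (B := fun t : ℝ => ℓ / 2 * t ^ 2 * ‖v‖ ^ 2)
    (B' := fun t => ℓ * t * ‖v‖ ^ 2) (by simp) hB ?_ (x := 1) (by simp)
  · simpa [hv] using key
  · intro t ht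
    rw [← inner_sub_left, Real.norm_eq_abs]
    calc |⟪∇ F (y + t • v) - ∇ F y, v⟫| ≤ ‖∇ F (y + t • v) - ∇ F y‖ * ‖v‖ :=
          abs_real_inner_le_norm _ _
      _ ≤ (ℓ * ‖y + t • v - y‖) * ‖v‖ := by gcongr; exact hL _ _
      _ = ℓ * t * ‖v‖ ^ 2 := by
          rw [add_sub_cancel_left, norm_smul, Real.norm_eq_abs, abs_of_nonneg ht.1]; ring

end Smooth

/-- Stated for an abstract space, since unification of the topologies of `WithLp` is slow. -/
theorem continuous_of_differentiable {E : Type*} [NormedAddCommGroup E] [InnerProductSpace ℝ E]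
    {F : E → ℝ} (hF : Differentiable ℝ F) : Continuous F := hF.continuous

/-! ### The product space, the maximizer of `f(x, ·)` and Danskin's theorem. -/

section Problem

variable {dx dy : ℕ}

theorem pair_fst (x : Vec dx) (y : Vec dy) : (pair x y).fst = x := rfl
theorem pair_snd (x : Vec dx) (y : Vec dy) : (pair x y).snd = y := rfl

theorem norm_sq_joint (z : Joint dx dy) : ‖z‖ ^ 2 = ‖z.fst‖ ^ 2 + ‖z.snd‖ ^ 2 :=
  WithLp.prod_norm_sq_eq_of_L2 z

theorem norm_fst_le (z : Joint dx dy) : ‖z.fst‖ ≤ ‖z‖ := by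
  have := norm_sq_joint z
  exact abs_le_of_sq_le_sq' (by nlinarith [sq_nonneg ‖z.snd‖]) (norm_nonneg _) |>.2

theorem norm_snd_le (z : Joint dx dy) : ‖z.snd‖ ≤ ‖z‖ := by
  have := norm_sq_joint z
  exact abs_le_of_sq_le_sq' (by nlinarith [sq_nonneg ‖z.fst‖]) (norm_nonneg _) |>.2

theorem pair_sub_pair (x x' : Vec dx) (y y' : Vec dy) :
    pair x y - pair x' y' = pair (x - x') (y - y') := rfl

theorem norm_pair_left (x : Vec dx) : ‖(pair x 0 : Joint dx dy)‖ = ‖x‖ := by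
  have := norm_sq_joint (pair x 0 : Joint dx dy)
  simp only [pair_fst, pair_snd, norm_zero] at this
  exact (sq_eq_sq₀ (norm_nonneg _) (norm_nonneg _)).1 (by linarith)

theorem norm_pair_right (y : Vec dy) : ‖(pair 0 y : Joint dx dy)‖ = ‖y‖ := by
  have := norm_sq_joint (pair 0 y : Joint dx dy)
  simp only [pair_fst, pair_snd, norm_zero] at this
  exact (sq_eq_sq₀ (norm_nonneg _) (norm_nonneg _)).1 (by linarith)

theorem norm_pair_le (x : Vec dx) (y : Vec dy) : ‖pair x y‖ ≤ ‖x‖ + ‖y‖ := by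
  have := norm_sq_joint (pair x y)
  simp only [pair_fst, pair_snd] at this
  refine abs_le_of_sq_le_sq' ?_ (by positivity) |>.2
  nlinarith [norm_nonneg x, norm_nonneg y, mul_nonneg (norm_nonneg x) (norm_nonneg y)]

theorem inner_pair (z : Joint dx dy) (x : Vec dx) (y : Vec dy) :
    ⟪z, pair x y⟫ = ⟪z.fst, x⟫ + ⟪z.snd, y⟫ := WithLp.prod_inner_apply _ _

theorem fst_sub (z w : Joint dx dy) : (z - w).fst = z.fst - w.fst := rfl
theorem snd_sub (z w : Joint dx dy) : (z - w).snd = z.snd - w.snd := rfl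

theorem continuous_pair : Continuous fun q : Vec dx × Vec dy => pair q.1 q.2 :=
  WithLp.prod_continuous_toLp 2 _ _

variable {ℓ μ : ℝ} {f : Joint dx dy → ℝ}

namespace IsSmoothStronglyConcave

theorem norm_fst_gradient_sub_le (hf : IsSmoothStronglyConcave ℓ μ f) (hℓ : 0 < ℓ) (x x' : Vec dx)
    (y y' : Vec dy) :
    ‖(∇ f (pair x y)).fst - (∇ f (pair x' y')).fst‖ ≤ ℓ * (‖x - x'‖ + ‖y - y'‖) := by
  rw [← fst_sub]
  refine (norm_fst_le _).trans ((hf.smooth _ _).trans ?_)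
  rw [pair_sub_pair]
  gcongr
  exact norm_pair_le _ _

theorem norm_fst_gradient_sub_le_right (hf : IsSmoothStronglyConcave ℓ μ f) (x : Vec dx)
    (y y' : Vec dy) :
    ‖(∇ f (pair x y)).fst - (∇ f (pair x y')).fst‖ ≤ ℓ * ‖y - y'‖ := by
  rw [← fst_sub]
  refine (norm_fst_le _).trans ((hf.smooth _ _).trans_eq ?_)
  rw [pair_sub_pair, sub_self, norm_pair_right]

theorem norm_snd_gradient_sub_le_right (hf : IsSmoothStronglyConcave ℓ μ f) (x : Vec dx)
    (y y' : Vec dy) :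
    ‖(∇ f (pair x y)).snd - (∇ f (pair x y')).snd‖ ≤ ℓ * ‖y - y'‖ := by
  rw [← snd_sub]
  refine (norm_snd_le _).trans ((hf.smooth _ _).trans_eq ?_)
  rw [pair_sub_pair, sub_self, norm_pair_right]

theorem norm_snd_gradient_sub_le_left (hf : IsSmoothStronglyConcave ℓ μ f) (x x' : Vec dx)
    (y : Vec dy) :
    ‖(∇ f (pair x y)).snd - (∇ f (pair x' y)).snd‖ ≤ ℓ * ‖x - x'‖ := by
  rw [← snd_sub]
  refine (norm_snd_le _).trans ((hf.smooth _ _).trans_eq ?_)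
  rw [pair_sub_pair, sub_self, norm_pair_left]

theorem abs_sub_linear_right_le (hf : IsSmoothStronglyConcave ℓ μ f) (x : Vec dx) (y z : Vec dy) :
    |f (pair x z) - f (pair x y) - ⟪(∇ f (pair x y)).snd, z - y⟫| ≤ ℓ / 2 * ‖z - y‖ ^ 2 := by
  have := abs_sub_linear_le hf.differentiable hf.smooth (pair x y) (pair x z)
  rwa [pair_sub_pair, sub_self, norm_pair_right, inner_pair, inner_zero_right, zero_add] at this

theorem abs_sub_linear_left_le (hf : IsSmoothStronglyConcave ℓ μ f) (x x' : Vec dx) (y : Vec dy) :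
    |f (pair x' y) - f (pair x y) - ⟪(∇ f (pair x y)).fst, x' - x⟫| ≤ ℓ / 2 * ‖x' - x‖ ^ 2 := by
  have := abs_sub_linear_le hf.differentiable hf.smooth (pair x y) (pair x' y)
  rwa [pair_sub_pair, sub_self, norm_pair_left, inner_pair, inner_zero_right, add_zero] at this

/-- Strong concavity on the segment from `y` to `z`, divided by the segment parameter, which then
tends to zero from the right. -/
theorem le_linear_sub_right (hf : IsSmoothStronglyConcave ℓ μ f) (x : Vec dx) (y z : Vec dy) :
    f (pair x z) ≤ f (pair x y) + ⟪(∇ f (pair x y)).snd, z - y⟫ - μ / 2 * ‖z - y‖ ^ 2 := by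
  have hd := hasDerivAt_line hf.differentiable (pair x y) (pair 0 (z - y)) 0
  simp only [zero_smul, add_zero, inner_pair, inner_zero_right, zero_add] at hd
  have hpt : ∀ t : ℝ, pair x y + t • pair 0 (z - y) = pair x (t • z + (1 - t) • y) := by
    intro t
    have : pair x y + t • pair 0 (z - y) = pair (x + t • (0 : Vec dx)) (y + t • (z - y)) := rfl
    rw [this]
    congr 1
    · simp
    · module
  have hslope : Filter.Tendsto
      (fun t : ℝ => t⁻¹ * (f (pair x (t • z + (1 - t) • y)) - f (pair x y)))
      (nhdsWithin 0 (Set.Ioi 0)) (nhds ⟪(∇ f (pair x y)).snd, z - y⟫) := by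
    have h := (hasDerivAt_iff_tendsto_slope_zero.1 hd).mono_left
      (nhdsWithin_mono 0 (s := Set.Ioi 0) (t := {0}ᶜ) (fun t ht => (Set.mem_Ioi.1 ht).ne'))
    simpa [hpt, zero_add] using h
  have hlim : Filter.Tendsto (fun t : ℝ => f (pair x z) - f (pair x y)
      + (1 - t) * (μ / 2 * ‖z - y‖ ^ 2)) (nhdsWithin 0 (Set.Ioi 0))
      (nhds (f (pair x z) - f (pair x y) + (1 - 0) * (μ / 2 * ‖z - y‖ ^ 2))) := by
    refine Filter.Tendsto.mono_left (Continuous.tendsto ?_ 0) nhdsWithin_le_nhds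
    exact continuous_const.add ((continuous_const.sub continuous_id).mul continuous_const)
  have hle := le_of_tendsto_of_tendsto hlim hslope (by
    filter_upwards [Ioo_mem_nhdsGT (zero_lt_one' ℝ)] with t ht
    have := (hf.strongConcave x).2 (Set.mem_univ z) (Set.mem_univ y) ht.1.le
      (sub_nonneg.2 ht.2.le) (by ring)
    simp only [smul_eq_mul] at this
    rw [inv_mul_eq_div, le_div_iff₀ ht.1]
    nlinarith)
  linarith

/-- The quadratic upper bound at `0` keeps `f(x, ·)` below `f(x, 0)` outside the ball of radius
`2‖g‖/μ`, so a maximizer over this compact ball is global. -/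
theorem exists_isMaxOn (hf : IsSmoothStronglyConcave ℓ μ f) (hμ : 0 < μ) (x : Vec dx) :
    ∃ y, IsMaxOn (fun y => f (pair x y)) Set.univ y := by
  have hc : Continuous fun y : Vec dy => f (pair x y) :=
    (continuous_of_differentiable hf.differentiable).comp
      (continuous_pair.comp (continuous_const.prodMk continuous_id))
  set g := (∇ f (pair x (0 : Vec dy))).snd
  obtain ⟨y, hy, hmax⟩ := (isCompact_closedBall (0 : Vec dy) (2 * ‖g‖ / μ)).exists_isMaxOn
    ⟨0, by simp; positivity⟩ hc.continuousOn
  refine ⟨y, fun z _ => ?_⟩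
  by_cases hz : z ∈ Metric.closedBall (0 : Vec dy) (2 * ‖g‖ / μ)
  · exact hmax hz
  · have h0 : f (pair x 0) ≤ f (pair x y) := hmax (by simp; positivity)
    have h1 := hf.le_linear_sub_right x 0 z
    rw [sub_zero] at h1
    have h2 := real_inner_le_norm g z
    simp only [Metric.mem_closedBall, dist_zero_right, not_le, div_lt_iff₀ hμ] at hz
    have h3 : ‖g‖ * ‖z‖ ≤ μ / 2 * ‖z‖ ^ 2 := by
      nlinarith [norm_nonneg z]
    simp only [Set.mem_ofPred_eq]
    linarith

end IsSmoothStronglyConcave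

open Classical in
/-- A maximizer of `f(x, ·)`. -/
noncomputable def argmax (f : Joint dx dy → ℝ) (x : Vec dx) : Vec dy :=
  if h : ∃ y, IsMaxOn (fun y => f (pair x y)) Set.univ y then h.choose else 0

namespace IsSmoothStronglyConcave

theorem isMaxOn_argmax (hf : IsSmoothStronglyConcave ℓ μ f) (hμ : 0 < μ) (x : Vec dx) :
    IsMaxOn (fun y => f (pair x y)) Set.univ (argmax f x) := by
  rw [argmax, dif_pos (hf.exists_isMaxOn hμ x)]
  exact (hf.exists_isMaxOn hμ x).choose_spec

theorem le_argmax (hf : IsSmoothStronglyConcave ℓ μ f) (hμ : 0 < μ) (x : Vec dx) (y : Vec dy) :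
    f (pair x y) ≤ f (pair x (argmax f x)) := hf.isMaxOn_argmax hμ x (Set.mem_univ y)

theorem primal_eq (hf : IsSmoothStronglyConcave ℓ μ f) (hμ : 0 < μ) (x : Vec dx) :
    primal f x = f (pair x (argmax f x)) :=
  le_antisymm (ciSup_le fun y => hf.le_argmax hμ x y)
    (le_ciSup (f := fun y => f (pair x y)) ⟨_, Set.forall_mem_range.2 fun y => hf.le_argmax hμ x y⟩
      (argmax f x))

/-- A gradient step of length `1 / ℓ` increases `f(x, ·)` by `‖∇_y f‖² / (2 ℓ)`. -/
theorem sq_norm_gradient_le (hf : IsSmoothStronglyConcave ℓ μ f) (hℓ : 0 < ℓ) (hμ : 0 < μ)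
    (x : Vec dx) (y : Vec dy) :
    ‖(∇ f (pair x y)).snd‖ ^ 2 / (2 * ℓ) ≤ f (pair x (argmax f x)) - f (pair x y) := by
  set g := (∇ f (pair x y)).snd
  have h1 := (abs_le.1 (hf.abs_sub_linear_right_le x y (y + ℓ⁻¹ • g))).1
  rw [add_sub_cancel_left, inner_smul_right, norm_smul, Real.norm_eq_abs,
    abs_of_pos (inv_pos.2 hℓ), real_inner_self_eq_norm_sq] at h1
  have h2 := hf.le_argmax hμ x (y + ℓ⁻¹ • g)
  have h3 : ℓ⁻¹ * ‖g‖ ^ 2 - ℓ / 2 * (ℓ⁻¹ * ‖g‖) ^ 2 = ‖g‖ ^ 2 / (2 * ℓ) := by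
    field_simp; ring
  linarith

theorem gradient_argmax (hf : IsSmoothStronglyConcave ℓ μ f) (hℓ : 0 < ℓ) (hμ : 0 < μ)
    (x : Vec dx) : (∇ f (pair x (argmax f x))).snd = 0 := by
  have h := hf.sq_norm_gradient_le hℓ hμ x (argmax f x)
  rw [sub_self, div_le_iff₀ (by positivity), zero_mul] at h
  simpa using h

theorem sq_dist_argmax_le (hf : IsSmoothStronglyConcave ℓ μ f) (hℓ : 0 < ℓ) (hμ : 0 < μ)
    (x : Vec dx) (y : Vec dy) :
    μ / 2 * ‖y - argmax f x‖ ^ 2 ≤ f (pair x (argmax f x)) - f (pair x y) := by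
  have h := hf.le_linear_sub_right x (argmax f x) y
  rw [hf.gradient_argmax hℓ hμ, inner_zero_left] at h
  linarith

/-- Both terms on the left are needed later: the gradient term absorbs the second-order term of an
ascent step, and AM-GM between the two gives the rate `1/√κ` of clipped steps. -/
theorem inner_gradient_ge_sq_norm_gradient (hf : IsSmoothStronglyConcave ℓ μ f) (hℓ : 0 < ℓ)
    (hμ : 0 < μ) (x : Vec dx) (y : Vec dy) :
    ‖(∇ f (pair x y)).snd‖ ^ 2 / (2 * ℓ) + μ / 2 * ‖y - argmax f x‖ ^ 2 ≤
      -⟪(∇ f (pair x y)).snd, y - argmax f x⟫ := by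
  have h := hf.le_linear_sub_right x y (argmax f x)
  rw [← neg_sub y, inner_neg_right, norm_neg] at h
  linarith [hf.sq_norm_gradient_le hℓ hμ x y]

theorem inner_gradient_ge_sq_dist (hf : IsSmoothStronglyConcave ℓ μ f) (hℓ : 0 < ℓ)
    (hμ : 0 < μ) (x : Vec dx) (y : Vec dy) :
    μ * ‖y - argmax f x‖ ^ 2 ≤ -⟪(∇ f (pair x y)).snd, y - argmax f x⟫ := by
  have h := hf.le_linear_sub_right x y (argmax f x)
  rw [← neg_sub y, inner_neg_right, norm_neg] at h
  linarith [hf.sq_dist_argmax_le hℓ hμ x y]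

theorem norm_sub_argmax_le (hf : IsSmoothStronglyConcave ℓ μ f) (hℓ : 0 < ℓ)
    (hμ : 0 < μ) (x : Vec dx) (y : Vec dy) :
    μ * ‖y - argmax f x‖ ≤ ‖(∇ f (pair x y)).snd‖ := by
  have h := hf.inner_gradient_ge_sq_dist hℓ hμ x y
  have h2 := (abs_le.1 (abs_real_inner_le_norm (∇ f (pair x y)).snd (y - argmax f x))).1
  rcases (norm_nonneg (y - argmax f x)).eq_or_lt with h0 | h0
  · rw [← h0]; simp
  · exact le_of_mul_le_mul_right (by nlinarith) h0

theorem eq_argmax (hf : IsSmoothStronglyConcave ℓ μ f) (hℓ : 0 < ℓ) (hμ : 0 < μ) {x : Vec dx}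
    {y : Vec dy} (hy : IsMaxOn (fun y => f (pair x y)) Set.univ y) : y = argmax f x := by
  have h := hf.sq_dist_argmax_le hℓ hμ x y
  have h2 : f (pair x (argmax f x)) ≤ f (pair x y) := hy (Set.mem_univ _)
  have : ‖y - argmax f x‖ ^ 2 ≤ 0 := by
    by_contra hc
    nlinarith
  rw [← sub_eq_zero, ← norm_eq_zero]
  nlinarith [norm_nonneg (y - argmax f x)]

theorem mul_norm_argmax_sub_le (hf : IsSmoothStronglyConcave ℓ μ f) (hℓ : 0 < ℓ) (hμ : 0 < μ)
    (x x' : Vec dx) : μ * ‖argmax f x - argmax f x'‖ ≤ ℓ * ‖x - x'‖ := by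
  refine (hf.norm_sub_argmax_le hℓ hμ x' (argmax f x)).trans ?_
  have := hf.norm_snd_gradient_sub_le_left x x' (argmax f x)
  rwa [hf.gradient_argmax hℓ hμ, zero_sub, norm_neg] at this

theorem norm_argmax_sub_le (hf : IsSmoothStronglyConcave ℓ μ f) (hℓ : 0 < ℓ) (hμ : 0 < μ)
    (x x' : Vec dx) : ‖argmax f x - argmax f x'‖ ≤ ℓ / μ * ‖x - x'‖ := by
  rw [div_mul_eq_mul_div, le_div_iff₀ hμ, mul_comm]
  exact hf.mul_norm_argmax_sub_le hℓ hμ x x'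

theorem continuous_argmax (hf : IsSmoothStronglyConcave ℓ μ f) (hℓ : 0 < ℓ) (hμ : 0 < μ) :
    Continuous (argmax f) := by
  refine (LipschitzWith.of_dist_le_mul (K := (ℓ / μ).toNNReal) fun x x' => ?_).continuous
  rw [dist_eq_norm, dist_eq_norm, Real.coe_toNNReal _ (by positivity)]
  exact hf.norm_argmax_sub_le hℓ hμ x x'

/-- The strong monotonicity and the Lipschitz bound of the `y`-gradient are compared along a nonzero
displacement from the maximizer; such a displacement exists because `dy ≥ 1`. -/
theorem le_smoothness [NeZero dy] (hf : IsSmoothStronglyConcave ℓ μ f) (hℓ : 0 < ℓ) (hμ : 0 < μ) :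
    μ ≤ ℓ := by
  obtain ⟨e, he⟩ : ∃ e : Vec dy, e ≠ 0 := ⟨EuclideanSpace.single 0 1, by simp⟩
  have h1 := hf.norm_sub_argmax_le hℓ hμ 0 (argmax f 0 + e)
  have h2 := hf.norm_snd_gradient_sub_le_right 0 (argmax f 0 + e) (argmax f 0)
  rw [hf.gradient_argmax hℓ hμ, sub_zero] at h2
  rw [add_sub_cancel_left] at h1 h2
  exact le_of_mul_le_mul_right (h1.trans h2) (norm_pos_iff.2 he)

/-- Freezing `y` at the maximizer for `x` gives a smooth minorant of `Φ` that touches it at `x`. -/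
theorem primal_lower (hf : IsSmoothStronglyConcave ℓ μ f) (hμ : 0 < μ)
    (x x' : Vec dx) :
    primal f x + ⟪(∇ f (pair x (argmax f x))).fst, x' - x⟫ - ℓ / 2 * ‖x' - x‖ ^ 2
      ≤ primal f x' := by
  rw [hf.primal_eq hμ, hf.primal_eq hμ]
  have h1 := (abs_le.1 (hf.abs_sub_linear_left_le x x' (argmax f x))).1
  linarith [hf.le_argmax hμ x' (argmax f x)]

theorem norm_fst_gradient_argmax_sub_le (hf : IsSmoothStronglyConcave ℓ μ f) (hℓ : 0 < ℓ)
    (hμ : 0 < μ) (x x' : Vec dx) :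
    ‖(∇ f (pair x (argmax f x))).fst - (∇ f (pair x' (argmax f x'))).fst‖
      ≤ ℓ * (1 + ℓ / μ) * ‖x - x'‖ := by
  refine (hf.norm_fst_gradient_sub_le hℓ _ _ _ _).trans ?_
  nlinarith [hf.norm_argmax_sub_le hℓ hμ x x']

/-- This is the lower bound with the points exchanged. Replacing the gradient at `x'` by the one at
`x` costs `ℓ(1 + κ)`, and adding `ℓ/2` gives the constant. -/
theorem primal_upper (hf : IsSmoothStronglyConcave ℓ μ f) (hℓ : 0 < ℓ) (hμ : 0 < μ)
    (x x' : Vec dx) :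
    primal f x' ≤ primal f x + ⟪(∇ f (pair x (argmax f x))).fst, x' - x⟫
      + ℓ * (3 / 2 + ℓ / μ) * ‖x' - x‖ ^ 2 := by
  have h1 := hf.primal_lower hμ x' x
  rw [← neg_sub x' x, inner_neg_right, norm_neg] at h1
  have h2 := hf.norm_fst_gradient_argmax_sub_le hℓ hμ x' x
  have h3 := real_inner_le_norm ((∇ f (pair x' (argmax f x'))).fst
    - (∇ f (pair x (argmax f x))).fst) (x' - x)
  rw [inner_sub_left] at h3
  nlinarith [norm_nonneg (x' - x), mul_le_mul_of_nonneg_right h2 (norm_nonneg (x' - x))]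

/-- Danskin's theorem: `Φ` is differentiable with `∇ Φ(x) = ∇ₓ f(x, y*(x))`. -/
theorem hasGradientAt_primal (hf : IsSmoothStronglyConcave ℓ μ f) (hℓ : 0 < ℓ) (hμ : 0 < μ)
    (x : Vec dx) : HasGradientAt (primal f) (∇ f (pair x (argmax f x))).fst x := by
  set g := (∇ f (pair x (argmax f x))).fst
  rw [hasGradientAt_iff_hasFDerivAt, hasFDerivAt_iff_isLittleO]
  have hO : (fun x' => primal f x' - primal f x - (InnerProductSpace.toDual ℝ (Vec dx)) g (x' - x))
      =O[nhds x] fun x' => ‖x' - x‖ ^ 2 := by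
    refine Asymptotics.IsBigO.of_bound (ℓ * (3 / 2 + ℓ / μ)) (Filter.Eventually.of_forall ?_)
    intro x'
    rw [InnerProductSpace.toDual_apply_apply, Real.norm_eq_abs, Real.norm_eq_abs,
      abs_of_nonneg (by positivity : (0 : ℝ) ≤ ‖x' - x‖ ^ 2), abs_le]
    have h1 := hf.primal_lower hμ x x'
    have h2 := hf.primal_upper hℓ hμ x x'
    have h3 : ℓ / 2 * ‖x' - x‖ ^ 2 ≤ ℓ * (3 / 2 + ℓ / μ) * ‖x' - x‖ ^ 2 := by
      gcongr
      have : 0 < ℓ / μ := by positivity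
      nlinarith
    constructor <;> linarith
  refine hO.trans_isLittleO ?_
  have := Asymptotics.isLittleO_pow_sub_sub (x₀ := x) (m := 2) (by norm_num)
  simpa using this

theorem differentiable_primal (hf : IsSmoothStronglyConcave ℓ μ f) (hℓ : 0 < ℓ) (hμ : 0 < μ) :
    Differentiable ℝ (primal f) := fun x => (hf.hasGradientAt_primal hℓ hμ x).differentiableAt

theorem gradient_primal (hf : IsSmoothStronglyConcave ℓ μ f) (hℓ : 0 < ℓ) (hμ : 0 < μ)
    (x : Vec dx) : ∇ (primal f) x = (∇ f (pair x (argmax f x))).fst :=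
  (hf.hasGradientAt_primal hℓ hμ x).gradient

theorem norm_gradient_primal_sub_le (hf : IsSmoothStronglyConcave ℓ μ f) (hℓ : 0 < ℓ)
    (hμ : 0 < μ) (hle : μ ≤ ℓ) (x x' : Vec dx) :
    ‖∇ (primal f) x - ∇ (primal f) x'‖ ≤ 2 * (ℓ / μ) * ℓ * ‖x - x'‖ := by
  rw [hf.gradient_primal hℓ hμ, hf.gradient_primal hℓ hμ]
  refine (hf.norm_fst_gradient_argmax_sub_le hℓ hμ x x').trans ?_
  refine mul_le_mul_of_nonneg_right ?_ (norm_nonneg _)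
  have : 1 ≤ ℓ / μ := by rwa [one_le_div hμ]
  nlinarith

theorem continuous_gradient_primal (hf : IsSmoothStronglyConcave ℓ μ f) (hℓ : 0 < ℓ)
    (hμ : 0 < μ) : Continuous (∇ (primal f)) := by
  refine (LipschitzWith.of_dist_le_mul (K := (ℓ * (1 + ℓ / μ)).toNNReal) fun x x' => ?_).continuous
  rw [dist_eq_norm, dist_eq_norm, Real.coe_toNNReal _ (by positivity),
    hf.gradient_primal hℓ hμ, hf.gradient_primal hℓ hμ]
  exact hf.norm_fst_gradient_argmax_sub_le hℓ hμ x x'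

/-- Descent of `Φ` along a step of length at most `η` in the direction `-g / ‖g‖`. -/
theorem primal_normalized_step_le (hf : IsSmoothStronglyConcave ℓ μ f) (hℓ : 0 < ℓ) (hμ : 0 < μ)
    (hle : μ ≤ ℓ) {η : ℝ} (hη : 0 ≤ η) (x g : Vec dx) :
    primal f (x - η • (‖g‖⁻¹ • g)) + η * ‖∇ (primal f) x‖ ≤
      primal f x + 2 * η * ‖g - ∇ (primal f) x‖ + 5 / 2 * (ℓ / μ) * ℓ * η ^ 2 := by
  have h := hf.primal_upper hℓ hμ x (x - η • (‖g‖⁻¹ • g))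
  rw [← hf.gradient_primal hℓ hμ] at h
  set G := ∇ (primal f) x
  have hu : ‖‖g‖⁻¹ • g‖ ≤ 1 := by
    rw [norm_smul, norm_inv, norm_norm]
    exact inv_mul_le_one
  have hin : ‖G‖ - 2 * ‖g - G‖ ≤ ⟪G, ‖g‖⁻¹ • g⟫ := by
    have h1 : ⟪G, ‖g‖⁻¹ • g⟫ = ‖g‖ - ⟪g - G, ‖g‖⁻¹ • g⟫ := by
      rw [inner_sub_left, inner_smul_right, inner_smul_right, real_inner_self_eq_norm_sq]
      rcases eq_or_ne g 0 with rfl | hg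
      · simp
      · have : ‖g‖ ≠ 0 := norm_ne_zero_iff.2 hg
        field_simp
        ring
    have h2 : ⟪g - G, ‖g‖⁻¹ • g⟫ ≤ ‖g - G‖ :=
      (real_inner_le_norm _ _).trans (mul_le_of_le_one_right (norm_nonneg _) hu)
    have h3 := norm_sub_norm_le G g
    rw [norm_sub_rev] at h3
    linarith
  rw [sub_sub_cancel_left, inner_neg_right, inner_smul_right, norm_neg, norm_smul,
    Real.norm_eq_abs, abs_of_nonneg hη] at h
  have h4 : η * ‖‖g‖⁻¹ • g‖ ≤ η := mul_le_of_le_one_right hη hu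
  have h5 : (η * ‖‖g‖⁻¹ • g‖) ^ 2 ≤ η ^ 2 := by gcongr
  have h6 : 1 ≤ ℓ / μ := by rwa [one_le_div hμ]
  have h7 : ℓ * (3 / 2 + ℓ / μ) * (η * ‖‖g‖⁻¹ • g‖) ^ 2 ≤ 5 / 2 * (ℓ / μ) * ℓ * η ^ 2 := by
    refine mul_le_mul ?_ h5 (sq_nonneg _) (by positivity)
    nlinarith
  nlinarith [mul_le_mul_of_nonneg_left hin hη]

end IsSmoothStronglyConcave

end Problem

/-! ### Clipping as the projection onto a ball. -/

section Clip

variable {d : ℕ}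

theorem clip_of_norm_le {v : Vec d} {τ : ℝ} (h : ‖v‖ ≤ τ) : clip v τ = v := by
  rcases eq_or_ne v 0 with rfl | hv
  · simp [clip]
  · have : 1 ≤ τ / ‖v‖ := (one_le_div (norm_pos_iff.2 hv)).2 h
    rw [clip, min_eq_left this, one_smul]

theorem norm_clip_le {v : Vec d} {τ : ℝ} (hτ : 0 ≤ τ) : ‖clip v τ‖ ≤ τ := by
  rcases le_or_gt ‖v‖ τ with h | h
  · rwa [clip_of_norm_le h]
  · have hv : 0 < ‖v‖ := hτ.trans_lt h
    have h1 : 0 ≤ min 1 (τ / ‖v‖) := le_min zero_le_one (by positivity)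
    rw [clip, norm_smul, Real.norm_eq_abs, abs_of_nonneg h1]
    calc min 1 (τ / ‖v‖) * ‖v‖ ≤ τ / ‖v‖ * ‖v‖ := by gcongr; exact min_le_right _ _
      _ = τ := div_mul_cancel₀ _ hv.ne'

theorem norm_sub_clip {v : Vec d} {τ : ℝ} (hτ : 0 ≤ τ) : ‖v - clip v τ‖ = max 0 (‖v‖ - τ) := by
  rcases le_or_gt ‖v‖ τ with h | h
  · rw [clip_of_norm_le h, sub_self, norm_zero, max_eq_left (by linarith)]
  · have hv : 0 < ‖v‖ := hτ.trans_lt h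
    have h1 : τ / ‖v‖ ≤ 1 := (div_le_one hv).2 h.le
    rw [max_eq_right (by linarith), clip, min_eq_right h1]
    have : v - (τ / ‖v‖) • v = (1 - τ / ‖v‖) • v := by module
    rw [this, norm_smul, Real.norm_eq_abs, abs_of_nonneg (by linarith), sub_mul,
      div_mul_cancel₀ _ hv.ne', one_mul]

/-- The variational inequality of the projection onto a ball. -/
theorem inner_sub_clip_nonpos {v w : Vec d} {τ : ℝ} (hτ : 0 ≤ τ) (hw : ‖w‖ ≤ τ) :
    ⟪v - clip v τ, w - clip v τ⟫ ≤ 0 := by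
  rcases le_or_gt ‖v‖ τ with h | h
  · rw [clip_of_norm_le h, sub_self, inner_zero_left]
  · have hv : 0 < ‖v‖ := hτ.trans_lt h
    have h1 : τ / ‖v‖ ≤ 1 := (div_le_one hv).2 h.le
    rw [clip, min_eq_right h1]
    have : v - (τ / ‖v‖) • v = (1 - τ / ‖v‖) • v := by module
    rw [this, inner_smul_left, inner_sub_right, inner_smul_right, real_inner_self_eq_norm_sq]
    have h2 : ⟪v, w⟫ ≤ ‖v‖ * τ := (real_inner_le_norm v w).trans (by gcongr)
    have h3 : τ / ‖v‖ * ‖v‖ ^ 2 = ‖v‖ * τ := by field_simp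
    rw [h3]
    exact mul_nonpos_of_nonneg_of_nonpos (by simpa using h1) (by linarith)

/-- Adding the variational inequalities of the two projections shows that a projection is
nonexpansive. -/
theorem norm_clip_sub_clip_le {v w : Vec d} {τ : ℝ} (hτ : 0 ≤ τ) :
    ‖clip v τ - clip w τ‖ ≤ ‖v - w‖ := by
  have h1 := inner_sub_clip_nonpos (v := v) hτ (norm_clip_le (v := w) hτ)
  have h2 := inner_sub_clip_nonpos (v := w) hτ (norm_clip_le (v := v) hτ)
  have h3 : ‖clip v τ - clip w τ‖ ^ 2 ≤ ⟪v - w, clip v τ - clip w τ⟫ := by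
    rw [← real_inner_self_eq_norm_sq]
    simp only [inner_sub_left, inner_sub_right] at h1 h2 ⊢
    have := real_inner_comm (clip v τ) (clip w τ)
    linarith
  have h4 := real_inner_le_norm (v - w) (clip v τ - clip w τ)
  rcases (norm_nonneg (clip v τ - clip w τ)).eq_or_lt with h0 | h0
  · rw [← h0]; exact norm_nonneg _
  · exact le_of_mul_le_mul_right (by nlinarith) h0

theorem measurable_clip (τ : ℝ) : Measurable fun v : Vec d => clip v τ := by
  unfold clip
  exact (measurable_const.min (measurable_const.div measurable_norm)).smul measurable_id

/-- Second-order upper bound for the squared distance to a ball. -/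
theorem sq_hinge_add_le (w v : Vec d) {a : ℝ} (ha : 0 ≤ a) :
    max 0 (‖w + v‖ - a) ^ 2 ≤ max 0 (‖w‖ - a) ^ 2 + 2 * ⟪w - clip w a, v⟫ + ‖v‖ ^ 2 := by
  -- The distance of `w + v` to the ball is at most its distance to `clip w a`, the projection of
  -- `w`.
  have h1 : max 0 (‖w + v‖ - a) ≤ ‖w - clip w a + v‖ := by
    refine max_le (norm_nonneg _) ?_
    have h := norm_sub_norm_le (w + v) (clip w a)
    have h2 : w + v - clip w a = w - clip w a + v := by abel
    rw [h2] at h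
    linarith [norm_clip_le (v := w) ha]
  calc max 0 (‖w + v‖ - a) ^ 2 ≤ ‖w - clip w a + v‖ ^ 2 := by gcongr
    _ = _ := by rw [norm_add_sq_real, norm_sub_clip ha]

end Clip

/-! ### Bias and variance of clipped gradients under a `p`-th moment. -/

section Noise

variable {d : ℕ} {Ξ : Type*} [MeasurableSpace Ξ] {P : Measure Ξ}

variable {p q τ : ℝ} {g : Ξ → Vec d} {h : Vec d}

/-- With `U` the noise in units of `τ`, the difference is at most `min(U, 2) τ`, and `min(U², 4) ≤
4U^p` because `p ≤ 2`. Clipping thus turns a `p`-th moment into a second moment. -/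
theorem integral_sq_norm_clip_sub_le (hp : 1 < p) (hp2 : p ≤ 2) (hτ : 0 < τ)
    (hi : Integrable (fun z => (‖g z - h‖ / τ) ^ p) P)
    (hq : ∫ z, (‖g z - h‖ / τ) ^ p ∂P ≤ q) :
    ∫ z, ‖clip (g z) τ - clip h τ‖ ^ 2 ∂P ≤ 4 * q * τ ^ 2 := by
  have hpt : ∀ z, ‖clip (g z) τ - clip h τ‖ ^ 2 ≤ 4 * τ ^ 2 * (‖g z - h‖ / τ) ^ p := by
    intro z
    have h1 : ‖clip (g z) τ - clip h τ‖ ≤ ‖g z - h‖ := norm_clip_sub_clip_le hτ.le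
    have h2 : ‖clip (g z) τ - clip h τ‖ ≤ 2 * τ := by
      refine (norm_sub_le _ _).trans ?_
      linarith [norm_clip_le (v := g z) hτ.le, norm_clip_le (v := h) hτ.le]
    set U := ‖g z - h‖ / τ with hU
    have hU' : ‖g z - h‖ = U * τ := by rw [hU, div_mul_cancel₀ _ hτ.ne']
    have hU0 : 0 ≤ U := by positivity
    rcases le_total 1 U with hc | hc
    · have : 1 ≤ U ^ p := Real.one_le_rpow hc (by linarith)
      calc _ ≤ (2 * τ) ^ 2 := by gcongr
        _ = 4 * τ ^ 2 * 1 := by ring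
        _ ≤ _ := by gcongr
    · have : U ^ 2 ≤ U ^ p := by
        rw [← Real.rpow_natCast]
        exact Real.rpow_le_rpow_of_exponent_ge' hU0 hc (by linarith) (by exact_mod_cast hp2)
      calc _ ≤ (U * τ) ^ 2 := by rw [← hU']; gcongr
        _ = τ ^ 2 * U ^ 2 := by ring
        _ ≤ (4 * τ ^ 2) * U ^ p := by
          refine mul_le_mul ?_ this (sq_nonneg _) (by positivity)
          nlinarith [sq_nonneg τ]
  calc ∫ z, ‖clip (g z) τ - clip h τ‖ ^ 2 ∂P
      ≤ ∫ z, 4 * τ ^ 2 * (‖g z - h‖ / τ) ^ p ∂P := by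
        refine integral_mono_of_nonneg (Filter.Eventually.of_forall fun z => sq_nonneg _)
          (hi.const_mul _) (Filter.Eventually.of_forall hpt)
    _ = 4 * τ ^ 2 * ∫ z, (‖g z - h‖ / τ) ^ p ∂P := integral_const_mul _ _
    _ ≤ 4 * τ ^ 2 * q := by gcongr
    _ = _ := by ring

variable [IsProbabilityMeasure P]

/-- In the integrated second-order bound the mean of `N` enters only through the linear term, which
is then absorbed by completing a square. Since `a` is free, the same shifted radius serves both
potentials. -/
theorem integral_sq_hinge_add_le (w : Vec d) {a : ℝ} (ha : 0 ≤ a) {N : Ξ → Vec d}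
    (hN : Measurable N) {C : ℝ} (hC : ∀ z, ‖N z‖ ≤ C) :
    Integrable (fun z => max 0 (‖w + N z‖ - a) ^ 2) P ∧
    ∫ z, max 0 (‖w + N z‖ - a) ^ 2 ∂P ≤
      max 0 (‖w‖ + ‖∫ z, N z ∂P‖ - a) ^ 2 + ∫ z, ‖N z‖ ^ 2 ∂P := by
  have hiN : Integrable N P :=
    Integrable.of_bound hN.aestronglyMeasurable C (Filter.Eventually.of_forall hC)
  have hiN2 : Integrable (fun z => ‖N z‖ ^ 2) P := by
    refine Integrable.of_bound (by fun_prop) (C ^ 2) (Filter.Eventually.of_forall fun z => ?_)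
    rw [Real.norm_eq_abs, abs_of_nonneg (sq_nonneg _)]
    exact pow_le_pow_left₀ (norm_nonneg _) (hC z) 2
  have hiL : Integrable (fun z => max 0 (‖w + N z‖ - a) ^ 2) P := by
    refine Integrable.of_bound (by fun_prop) ((‖w‖ + C) ^ 2)
      (Filter.Eventually.of_forall fun z => ?_)
    rw [Real.norm_eq_abs, abs_of_nonneg (sq_nonneg _)]
    have h1 := norm_add_le w (N z)
    have h2 := hC z
    refine pow_le_pow_left₀ (le_max_left _ _) (max_le ?_ ?_) 2
    · linarith [norm_nonneg w, norm_nonneg (N z)]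
    · linarith
  refine ⟨hiL, ?_⟩
  have hin : Integrable (fun z => ⟪w - clip w a, N z⟫) P := hiN.const_inner _
  calc ∫ z, max 0 (‖w + N z‖ - a) ^ 2 ∂P
      ≤ ∫ z, (max 0 (‖w‖ - a) ^ 2 + 2 * ⟪w - clip w a, N z⟫ + ‖N z‖ ^ 2) ∂P :=
        integral_mono hiL (((integrable_const _).add (hin.const_mul 2)).add hiN2)
          fun z => sq_hinge_add_le w (N z) ha
    _ = max 0 (‖w‖ - a) ^ 2 + 2 * ⟪w - clip w a, ∫ z, N z ∂P⟫ + ∫ z, ‖N z‖ ^ 2 ∂P := by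
        have h12 : Integrable (fun z => max 0 (‖w‖ - a) ^ 2 + 2 * ⟪w - clip w a, N z⟫) P :=
          (integrable_const _).add (hin.const_mul 2)
        rw [integral_add h12 hiN2, integral_add (integrable_const _) (hin.const_mul 2),
          integral_const_mul, integral_inner hiN]
        simp
    _ ≤ max 0 (‖w‖ + ‖∫ z, N z ∂P‖ - a) ^ 2 + ∫ z, ‖N z‖ ^ 2 ∂P := by
        have h1 := real_inner_le_norm (w - clip w a) (∫ z, N z ∂P)
        rw [norm_sub_clip ha] at h1
        have hb := norm_nonneg (∫ z, N z ∂P)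
        set b := ‖∫ z, N z ∂P‖
        rcases le_total (‖w‖ - a) 0 with h | h
        · rw [max_eq_left h] at h1 ⊢
          nlinarith [sq_nonneg (max 0 (‖w‖ + b - a))]
        · rw [max_eq_right h] at h1 ⊢
          rw [max_eq_right (by linarith)]
          nlinarith

/-- The bias of a clipped gradient, whatever the size of the mean. -/
theorem norm_integral_clip_sub_le (hp : 1 < p) (hp2 : p ≤ 2) (hτ : 0 < τ)
    (hi : Integrable (fun z => (‖g z - h‖ / τ) ^ p) P)
    (hq : ∫ z, (‖g z - h‖ / τ) ^ p ∂P ≤ q) {l : ℝ} (hl : 0 < l) (hl1 : l ≤ 1) :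
    ‖∫ z, (clip (g z) τ - clip h τ) ∂P‖ ≤ (l + q / l) * τ := by
  have hpt : ∀ z, ‖clip (g z) τ - clip h τ‖ ≤ τ * (l + (‖g z - h‖ / τ) ^ p / l) := by
    intro z
    have h1 : ‖clip (g z) τ - clip h τ‖ ≤ ‖g z - h‖ := norm_clip_sub_clip_le hτ.le
    set U := ‖g z - h‖ / τ with hU
    have hU' : ‖g z - h‖ = τ * U := by rw [hU, mul_div_cancel₀ _ hτ.ne']
    have hU0 : 0 ≤ U := by positivity
    rw [hU'] at h1
    refine h1.trans (mul_le_mul_of_nonneg_left ?_ hτ.le)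
    have hpow : 0 ≤ U ^ p := by positivity
    -- For `l ≤ U ≤ 1` one has `l U ≤ U² ≤ U^p`; for `U ≥ 1` the bound `l ≤ 1` suffices.
    rcases le_total U l with hc | hc
    · have : 0 ≤ U ^ p / l := by positivity
      linarith
    · have hle : l * U ≤ U ^ p := by
        rcases le_total 1 U with h1U | h1U
        · have := Real.self_le_rpow_of_one_le h1U hp.le
          nlinarith
        · have : U ^ 2 ≤ U ^ p := by
            rw [← Real.rpow_natCast]
            exact Real.rpow_le_rpow_of_exponent_ge' hU0 h1U (by linarith) (by exact_mod_cast hp2)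
          nlinarith
      have : U ≤ U ^ p / l := by rw [le_div_iff₀ hl]; linarith
      linarith
  calc ‖∫ z, (clip (g z) τ - clip h τ) ∂P‖ ≤ ∫ z, ‖clip (g z) τ - clip h τ‖ ∂P :=
        norm_integral_le_integral_norm _
    _ ≤ ∫ z, τ * (l + (‖g z - h‖ / τ) ^ p / l) ∂P :=
        integral_mono_of_nonneg (Filter.Eventually.of_forall fun z => norm_nonneg _)
          (((integrable_const _).add (hi.div_const _)).const_mul _)
          (Filter.Eventually.of_forall hpt)
    _ = τ * (l + (∫ z, (‖g z - h‖ / τ) ^ p ∂P) / l) := by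
        rw [integral_const_mul, integral_add (integrable_const _) (hi.div_const _),
          integral_div]
        simp
    _ ≤ τ * (l + q / l) := by gcongr
    _ = _ := by ring

/-- The bias of a clipped gradient whose mean is at most half of the clipping level. -/
theorem norm_integral_clip_sub_le_of_norm_le (hp : 1 < p) (hp2 : p ≤ 2) (hτ : 0 < τ)
    (hgi : Integrable g P) (hgh : ∫ z, g z ∂P = h)
    (hi : Integrable (fun z => (‖g z - h‖ / τ) ^ p) P)
    (hq : ∫ z, (‖g z - h‖ / τ) ^ p ∂P ≤ q) (hh : ‖h‖ ≤ τ / 2) (hg : Measurable g) :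
    ‖∫ z, (clip (g z) τ - clip h τ) ∂P‖ ≤ 2 * q * τ := by
  have hci : Integrable (fun z => clip (g z) τ) P :=
    Integrable.of_bound ((measurable_clip τ).comp hg).aestronglyMeasurable τ
      (Filter.Eventually.of_forall fun z => norm_clip_le hτ.le)
  -- Since `h` itself is not clipped, the bias comes only from the tail `‖g‖ > τ`, which forces `U >
  -- 1/2`. The bias is therefore linear in `q`, while the general bound, optimized in `l`, is of
  -- order `√q`.
  have heq : ∫ z, (clip (g z) τ - clip h τ) ∂P = ∫ z, (clip (g z) τ - g z) ∂P := by
    rw [integral_sub hci (integrable_const _), integral_sub hci hgi, hgh,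
      clip_of_norm_le (by linarith)]
    simp
  have hpt : ∀ z, ‖clip (g z) τ - g z‖ ≤ 2 * τ * (‖g z - h‖ / τ) ^ p := by
    intro z
    rw [norm_sub_rev, norm_sub_clip hτ.le]
    set U := ‖g z - h‖ / τ with hU
    have hU' : ‖g z - h‖ = τ * U := by rw [hU, mul_div_cancel₀ _ hτ.ne']
    have hU0 : 0 ≤ U := by positivity
    refine max_le (by positivity) ?_
    have h1 : ‖g z‖ - τ ≤ τ * (U - 1 / 2) := by
      have := norm_sub_norm_le (g z) h
      linarith
    refine h1.trans ?_
    rw [mul_comm 2 τ, mul_assoc]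
    refine mul_le_mul_of_nonneg_left ?_ hτ.le
    rcases le_total 1 U with h1U | h1U
    · have := Real.self_le_rpow_of_one_le h1U hp.le
      linarith
    · have : U ^ 2 ≤ U ^ p := by
        rw [← Real.rpow_natCast]
        exact Real.rpow_le_rpow_of_exponent_ge' hU0 h1U (by linarith) (by exact_mod_cast hp2)
      nlinarith [sq_nonneg (U - 1 / 2)]
  rw [heq]
  calc ‖∫ z, (clip (g z) τ - g z) ∂P‖ ≤ ∫ z, ‖clip (g z) τ - g z‖ ∂P :=
        norm_integral_le_integral_norm _
    _ ≤ ∫ z, 2 * τ * (‖g z - h‖ / τ) ^ p ∂P :=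
        integral_mono_of_nonneg (Filter.Eventually.of_forall fun z => norm_nonneg _)
          (hi.const_mul _) (Filter.Eventually.of_forall hpt)
    _ = 2 * τ * ∫ z, (‖g z - h‖ / τ) ^ p ∂P := integral_const_mul _ _
    _ ≤ 2 * τ * q := by gcongr
    _ = _ := by ring

end Noise

/-! ### Noiseless clipped steps. -/

section Contraction

variable {d : ℕ} {e h : Vec d} {ℓ μ η τ : ℝ}

/-- A noiseless clipped step contracts the distance to the maximizer. -/
theorem sq_norm_add_clip_le (hμ : 0 < μ) (hη : 0 < η) (hηℓ : η * ℓ ≤ 1 / 400)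
    (hℓ : 0 < ℓ) (hτ : 0 < τ)
    (hs2 : ‖h‖ ^ 2 / (2 * ℓ) + μ / 2 * ‖e‖ ^ 2 ≤ -⟪h, e⟫) :
    ‖e + η • clip h τ‖ ^ 2 ≤
      ‖e‖ ^ 2 - 399 / 200 * η * (min 1 (τ / ‖h‖) * -⟪h, e⟫) := by
  set m := min 1 (τ / ‖h‖) with hm
  have hm0 : 0 ≤ m := le_min zero_le_one (by positivity)
  have hm1 : m ≤ 1 := min_le_left _ _
  set s := -⟪h, e⟫ with hs
  have hin : ⟪e, h⟫ = -s := by rw [hs, real_inner_comm]; ring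
  have hh : ‖h‖ ^ 2 ≤ 2 * ℓ * s := by
    have : ‖h‖ ^ 2 / (2 * ℓ) ≤ s := by nlinarith [sq_nonneg ‖e‖]
    rw [div_le_iff₀ (by positivity)] at this
    linarith
  have hs0 : 0 ≤ s := by
    by_contra hc
    have := mul_pos hℓ (neg_pos.2 (not_le.1 hc))
    nlinarith [sq_nonneg ‖h‖]
  have hexp : ‖e + η • clip h τ‖ ^ 2 = ‖e‖ ^ 2 - 2 * η * (m * s) + η ^ 2 * m ^ 2 * ‖h‖ ^ 2 := by
    rw [norm_add_sq_real, clip, ← hm, inner_smul_right, inner_smul_right, hin, norm_smul, norm_smul,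
      Real.norm_eq_abs, Real.norm_eq_abs, abs_of_pos hη, abs_of_nonneg hm0]
    ring
  rw [hexp]
  -- The second-order term costs `1/200` of `η m s`, whence `399/200 = 2 - 1/200`.
  have h1 : η ^ 2 * m ^ 2 * ‖h‖ ^ 2 ≤ η ^ 2 * m ^ 2 * (2 * ℓ * s) := by gcongr
  have h2 : η ^ 2 * m ^ 2 * (2 * ℓ * s) = 2 * (η * ℓ) * m * (η * (m * s)) := by ring
  have h3 : 2 * (η * ℓ) * m ≤ 1 / 200 := by nlinarith [mul_pos hη hℓ]
  have h4 : 0 ≤ η * (m * s) := by positivity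
  nlinarith

/-- The clip is inactive, so the squared distance contracts by `1 - 399/200 ημ`; the square root of
this factor is below `1 - 99/100 ημ`. -/
theorem norm_add_clip_le_of_norm_le (hμ : 0 < μ) (hη : 0 < η) (hηℓ : η * ℓ ≤ 1 / 400)
    (hμℓ : μ ≤ ℓ) (hτ : 0 < τ) (hs1 : μ * ‖e‖ ^ 2 ≤ -⟪h, e⟫)
    (hs2 : ‖h‖ ^ 2 / (2 * ℓ) + μ / 2 * ‖e‖ ^ 2 ≤ -⟪h, e⟫) (hh : ‖h‖ ≤ τ) :
    ‖e + η • clip h τ‖ ≤ ‖e‖ * (1 - 99 / 100 * (η * μ)) := by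
  have h1 := sq_norm_add_clip_le hμ hη hηℓ (hμ.trans_le hμℓ) hτ hs2
  rcases eq_or_ne h 0 with rfl | hne
  · have : ‖e‖ = 0 := by
      rw [inner_zero_left] at hs1
      by_contra hc
      have : 0 < μ * ‖e‖ ^ 2 := by positivity
      linarith
    rw [norm_eq_zero.1 this]
    simp [clip]
  have hm : min 1 (τ / ‖h‖) = 1 := min_eq_left ((one_le_div (norm_pos_iff.2 hne)).2 hh)
  rw [hm, one_mul] at h1
  have hημ : η * μ ≤ 1 / 400 := by nlinarith
  have hημ0 : 0 < η * μ := by positivity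
  refine abs_le_of_sq_le_sq' ?_ (by have := norm_nonneg e; nlinarith) |>.2
  have h2 : 399 / 200 * η * (μ * ‖e‖ ^ 2) ≤ 399 / 200 * η * -⟪h, e⟫ := by gcongr
  nlinarith [sq_nonneg ‖e‖, mul_nonneg hημ0.le (sq_nonneg ‖e‖),
    mul_nonneg (mul_nonneg hημ0.le hημ0.le) (sq_nonneg ‖e‖)]

/-- AM-GM in `hs2` gives `-⟪h, e⟫ ≥ ‖h‖‖e‖/√κ`. A clipped step thus lowers the distance by an amount
proportional to `ητ/√κ`, however large the distance is. -/
theorem norm_add_clip_le_of_le_norm {k : ℝ} (hμ : 0 < μ) (hη : 0 < η) (hηℓ : η * ℓ ≤ 1 / 400)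
    (hμℓ : μ ≤ ℓ) (hτ : 0 < τ) (hk : 0 < k) (hkℓ : k ^ 2 = ℓ / μ)
    (hs2 : ‖h‖ ^ 2 / (2 * ℓ) + μ / 2 * ‖e‖ ^ 2 ≤ -⟪h, e⟫) (hh : τ / 2 ≤ ‖h‖) :
    ‖e + η • clip h τ‖ ≤ ‖e‖ - 49 / 100 * (η * τ) / k := by
  have hℓ := hμ.trans_le hμℓ
  have hh0 : 0 < ‖h‖ := by linarith
  have h1 := sq_norm_add_clip_le hμ hη hηℓ hℓ hτ hs2
  have hℓk : ℓ = k ^ 2 * μ := by rw [hkℓ]; field_simp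
  have hge : ‖h‖ * ‖e‖ / k ≤ -⟪h, e⟫ := by
    refine le_trans ?_ hs2
    rw [hℓk, ← sub_nonneg]
    have : ‖h‖ ^ 2 / (2 * (k ^ 2 * μ)) + μ / 2 * ‖e‖ ^ 2 - ‖h‖ * ‖e‖ / k
        = (‖h‖ - k * μ * ‖e‖) ^ 2 / (2 * (k ^ 2 * μ)) := by
      field_simp
      ring
    rw [this]
    positivity
  have he : 0 < ‖e‖ := by
    by_contra hc
    have h0 : e = 0 := norm_eq_zero.1 (le_antisymm (not_lt.1 hc) (norm_nonneg _))
    rw [h0, inner_zero_right, norm_zero] at hs2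
    have : 0 < ‖h‖ ^ 2 / (2 * ℓ) := by positivity
    linarith
  have hms : τ / 2 * (‖e‖ / k) ≤ min 1 (τ / ‖h‖) * -⟪h, e⟫ := by
    have hm0 : 0 ≤ min 1 (τ / ‖h‖) := le_min zero_le_one (by positivity)
    calc τ / 2 * (‖e‖ / k) ≤ (min 1 (τ / ‖h‖) * ‖h‖) * (‖e‖ / k) := by
          gcongr
          rw [min_mul_of_nonneg _ _ hh0.le, div_mul_cancel₀ _ hh0.ne']
          exact le_min (by linarith) (by linarith)
      _ = min 1 (τ / ‖h‖) * (‖h‖ * ‖e‖ / k) := by ring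
      _ ≤ _ := by gcongr
  have h2 : 399 / 200 * η * (τ / 2 * (‖e‖ / k)) ≤
      399 / 200 * η * (min 1 (τ / ‖h‖) * -⟪h, e⟫) := by gcongr
  have h3 : ‖e + η • clip h τ‖ ^ 2 ≤ ‖e‖ ^ 2 - 2 * (49 / 100 * (η * τ) / k) * ‖e‖ := by
    have : 2 * (49 / 100 * (η * τ) / k) * ‖e‖ = 98 / 100 * η * τ * (‖e‖ / k) := by ring
    rw [this]
    have : 0 ≤ η * τ * (‖e‖ / k) := by positivity
    nlinarith
  have h4 : ‖e‖ * ‖e + η • clip h τ‖ ≤ ‖e‖ * (‖e‖ - 49 / 100 * (η * τ) / k) := by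
    nlinarith [sq_nonneg (‖e‖ - ‖e + η • clip h τ‖)]
  exact le_of_mul_le_mul_left h4 he

end Contraction

/-- The truncated potential `min {(D / r - 5/4)₊², 1}`. -/
noncomputable def escape (r D : ℝ) : ℝ := min (max 0 (D / r - 5 / 4) ^ 2) 1

/-- The potential `(D - 5 r / 2)₊²`. -/
noncomputable def excess (r D : ℝ) : ℝ := max 0 (D - 5 / 2 * r) ^ 2

theorem escape_nonneg (r D : ℝ) : 0 ≤ escape r D := le_min (sq_nonneg _) zero_le_one

theorem escape_le_one (r D : ℝ) : escape r D ≤ 1 := min_le_right _ _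

theorem excess_nonneg (r D : ℝ) : 0 ≤ excess r D := sq_nonneg _

theorem continuous_escape (r : ℝ) : Continuous (escape r) := by
  unfold escape; fun_prop

theorem continuous_excess (r : ℝ) : Continuous (excess r) := by
  unfold excess; fun_prop

theorem escape_eq_one {r D : ℝ} (hr : 0 < r) (h : 9 / 4 * r ≤ D) : escape r D = 1 := by
  have h1 : 9 / 4 ≤ D / r := by rwa [le_div_iff₀ hr]
  refine min_eq_right ?_
  rw [max_eq_right (by linarith)]
  nlinarith

theorem escape_eq_zero {r D : ℝ} (hr : 0 < r) (h : D ≤ 5 / 4 * r) : escape r D = 0 := by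
  have h1 : D / r ≤ 5 / 4 := by rwa [div_le_iff₀ hr]
  rw [escape, max_eq_left (by linarith)]
  simp

theorem excess_eq_zero {r D : ℝ} (h : D ≤ 5 / 2 * r) : excess r D = 0 := by
  rw [excess, max_eq_left (by linarith)]
  simp

/-! ### Drift of the two potentials in one noisy clipped step. -/

section OneStep

variable {d : ℕ} {Ξ : Type*} [MeasurableSpace Ξ] {P : Measure Ξ} [IsProbabilityMeasure P]
  {p q τ ℓ μ η r : ℝ} {g : Ξ → Vec d} {e h : Vec d}

-- The witness `β` is the distance after the noiseless step plus the bias. The drop `156/100` has to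
-- exceed `5/4`, since the `excess` threshold `5r/2` falls by up to `5/4 ημ r` when the radius
-- shrinks by the factor `exp(-ημ/2)`.
set_option maxHeartbeats 1000000 in
theorem exists_effective_radius (hp : 1 < p) (hp2 : p ≤ 2) (hμ : 0 < μ) (hμℓ : μ ≤ ℓ) (hη : 0 < η)
    (hηℓ : η * ℓ ≤ 1 / 400) (hr : 0 < r) (hτ : η * τ = Real.exp (-(η * μ)) * r / 120)
    (hg : Measurable g) (hgi : Integrable g P) (hgh : ∫ z, g z ∂P = h)
    (hi : Integrable (fun z => (‖g z - h‖ / τ) ^ p) P)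
    (hq : ∫ z, (‖g z - h‖ / τ) ^ p ∂P ≤ q) (hq0 : 0 ≤ q) (hqθ : q ≤ 3 * (η * μ))
    (hqκ : ℓ / μ * q ≤ 1 / 40000)
    (hs1 : μ * ‖e‖ ^ 2 ≤ -⟪h, e⟫)
    (hs2 : ‖h‖ ^ 2 / (2 * ℓ) + μ / 2 * ‖e‖ ^ 2 ≤ -⟪h, e⟫) :
    ∃ β : ℝ, (β ≤ ‖e‖ * (1 - 99 / 100 * (η * μ)) + 1 / 10 * (η * μ * r) ∨
        β ≤ ‖e‖ - 156 / 100 * (η * μ * r)) ∧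
      ∀ a, 0 ≤ a → Integrable (fun z => max 0 (‖e + η • clip (g z) τ‖ - a) ^ 2) P ∧
        ∫ z, max 0 (‖e + η • clip (g z) τ‖ - a) ^ 2 ∂P ≤ max 0 (β - a) ^ 2 + q * r ^ 2 / 2 := by
  have hℓ := hμ.trans_le hμℓ
  set θ := η * μ with hθ
  have hθ0 : 0 < θ := by positivity
  have hθκ : θ * (ℓ / μ) ≤ 1 / 400 := by
    have : θ * (ℓ / μ) = η * ℓ := by rw [hθ]; field_simp
    rwa [this]
  have hκ1 : 1 ≤ ℓ / μ := (one_le_div hμ).2 hμℓ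
  have hθ1 : θ ≤ 1 / 400 := by nlinarith
  have hexp1 : Real.exp (-θ) ≤ 1 := Real.exp_le_one_iff.2 (by linarith)
  have hexp2 : 399 / 400 ≤ Real.exp (-θ) := by
    have := Real.add_one_le_exp (-θ)
    linarith
  have hρ1 : η * τ ≤ r / 120 := by rw [hτ]; nlinarith
  have hρ2 : 399 / 400 * r / 120 ≤ η * τ := by rw [hτ]; nlinarith
  have hτ0 : 0 < τ := by
    have : 0 < η * τ := lt_of_lt_of_le (by positivity) hρ2
    exact pos_of_mul_pos_right this hη.le
  refine ⟨‖e + η • clip h τ‖ + ‖∫ z, η • (clip (g z) τ - clip h τ) ∂P‖, ?_, fun a ha => ?_⟩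
  · rw [integral_smul, norm_smul, Real.norm_eq_abs, abs_of_pos hη]
    -- Below `τ / 2` the bias is linear in `q ≤ 3θ`, hence smaller than the contraction, which is of
    -- order `θ`. Above, only the general bias bound is available, but there the step gains order
    -- `ητ/√κ`.
    rcases le_or_gt ‖h‖ (τ / 2) with hh | hh
    · left
      have h1 := norm_add_clip_le_of_norm_le hμ hη hηℓ hμℓ hτ0 hs1 hs2 (by linarith)
      have h2 := norm_integral_clip_sub_le_of_norm_le hp hp2 hτ0 hgi hgh hi hq hh hg
      have h3 : η * ‖∫ z, (clip (g z) τ - clip h τ) ∂P‖ ≤ η * (2 * q * τ) := by gcongr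
      have h4 : η * (2 * q * τ) = 2 * q * (η * τ) := by ring
      have h5 : 2 * q * (η * τ) ≤ 2 * (3 * θ) * (r / 120) := by gcongr
      have h6 : 0 < θ * r := by positivity
      linarith
    · right
      set k := Real.sqrt (ℓ / μ) with hk
      have hk2 : k ^ 2 = ℓ / μ := Real.sq_sqrt (by positivity)
      have hk1 : 1 ≤ k := Real.one_le_sqrt.2 hκ1
      have hk0 : 0 < k := by linarith
      have h1 := norm_add_clip_le_of_le_norm hμ hη hηℓ hμℓ hτ0 hk0 hk2 hs2 hh.le
      -- By `hqκ`, `q ≤ (1/(200k))²`, so with this `l` both terms of the bias are at most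
      -- `τ/(200k)`.
      have h2 := norm_integral_clip_sub_le (h := h) (P := P) (g := g) hp hp2 hτ0 hi hq
        (l := 1 / 200 / k) (by positivity) (by rw [div_le_one hk0]; linarith)
      have h3 : q / (1 / 200 / k) ≤ 1 / 200 / k := by
        rw [← hk2] at hqκ
        rw [div_le_div_iff₀ (by positivity) hk0, div_mul_div_comm, le_div_iff₀ (by positivity)]
        nlinarith
      have h4 : η * ‖∫ z, (clip (g z) τ - clip h τ) ∂P‖ ≤
          η * ((1 / 200 / k + 1 / 200 / k) * τ) := by
        gcongr
        refine h2.trans ?_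
        gcongr
      have h5 : η * ((1 / 200 / k + 1 / 200 / k) * τ) = 1 / 100 * (η * τ) / k := by ring
      -- This follows from `θ k² ≤ 1/400` and `k ≤ k²`.
      have h6 : 400 * θ ≤ 1 / k := by
        rw [le_div_iff₀ hk0]
        rw [← hk2] at hθκ
        nlinarith
      have h7 : 156 / 100 * (θ * r) ≤ 48 / 100 * (η * τ) / k := by
        calc 156 / 100 * (θ * r) ≤ 48 / 100 * (399 / 400 * r / 120) * (400 * θ) := by
              nlinarith [mul_pos hθ0 hr]
          _ ≤ 48 / 100 * (η * τ) * (1 / k) := by gcongr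
          _ = _ := by ring
      have h8 : 49 / 100 * (η * τ) / k = 48 / 100 * (η * τ) / k + 1 / 100 * (η * τ) / k := by ring
      linarith
  · have hN : Measurable fun z => η • (clip (g z) τ - clip h τ) :=
      (((measurable_clip τ).comp hg).sub_const _).const_smul η
    have hC : ∀ z, ‖η • (clip (g z) τ - clip h τ)‖ ≤ η * (τ + τ) := by
      intro z
      rw [norm_smul, Real.norm_eq_abs, abs_of_pos hη]
      gcongr
      exact (norm_sub_le _ _).trans (add_le_add (norm_clip_le hτ0.le) (norm_clip_le hτ0.le))
    have key := integral_sq_hinge_add_le (P := P) (e + η • clip h τ) ha hN hC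
    have heq : ∀ z, e + η • clip h τ + η • (clip (g z) τ - clip h τ) = e + η • clip (g z) τ := by
      intro z
      rw [smul_sub]
      abel
    simp only [heq] at key
    refine ⟨key.1, key.2.trans ?_⟩
    gcongr
    have h1 : ∀ z, ‖η • (clip (g z) τ - clip h τ)‖ ^ 2 = η ^ 2 * ‖clip (g z) τ - clip h τ‖ ^ 2 := by
      intro z
      rw [norm_smul, Real.norm_eq_abs, mul_pow, sq_abs]
    simp only [h1]
    rw [integral_const_mul]
    have h2 := integral_sq_norm_clip_sub_le hp hp2 hτ0 hi hq
    calc η ^ 2 * ∫ z, ‖clip (g z) τ - clip h τ‖ ^ 2 ∂P ≤ η ^ 2 * (4 * q * τ ^ 2) := by gcongr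
      _ = 4 * q * (η * τ) ^ 2 := by ring
      _ ≤ 4 * q * (r / 120) ^ 2 := by gcongr
      _ ≤ q * r ^ 2 / 2 := by nlinarith [mul_nonneg hq0 (sq_nonneg r)]

set_option maxHeartbeats 1000000 in
/-- Conditional drift of both potentials in one clipped step. -/
theorem integral_potential_step_le {r' : ℝ} (hp : 1 < p) (hp2 : p ≤ 2) (hμ : 0 < μ) (hμℓ : μ ≤ ℓ)
    (hη : 0 < η) (hηℓ : η * ℓ ≤ 1 / 400) (hr : 0 < r)
    (hr' : r' = Real.exp (-(η * μ / 2)) * r)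
    (hτ : η * τ = Real.exp (-(η * μ)) * r / 120)
    (hg : Measurable g) (hgi : Integrable g P) (hgh : ∫ z, g z ∂P = h)
    (hi : Integrable (fun z => (‖g z - h‖ / τ) ^ p) P)
    (hq : ∫ z, (‖g z - h‖ / τ) ^ p ∂P ≤ q) (hq0 : 0 ≤ q) (hqθ : q ≤ 3 * (η * μ))
    (hqκ : ℓ / μ * q ≤ 1 / 40000)
    (hs1 : μ * ‖e‖ ^ 2 ≤ -⟪h, e⟫)
    (hs2 : ‖h‖ ^ 2 / (2 * ℓ) + μ / 2 * ‖e‖ ^ 2 ≤ -⟪h, e⟫) :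
    (Integrable (fun z => escape r' ‖e + η • clip (g z) τ‖) P ∧
      ∫ z, escape r' ‖e + η • clip (g z) τ‖ ∂P ≤ escape r ‖e‖ + q) ∧
    (Integrable (fun z => excess r' ‖e + η • clip (g z) τ‖) P ∧
      ∫ z, excess r' ‖e + η • clip (g z) τ‖ ∂P ≤
        excess r ‖e‖ + q * r ^ 2 * escape r ‖e‖) := by
  have hℓ := hμ.trans_le hμℓ
  obtain ⟨β, hβ, hint⟩ := exists_effective_radius hp hp2 hμ hμℓ hη hηℓ hr hτ hg hgi hgh hi hq hq0
    hqθ hqκ hs1 hs2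
  have hθ1 : η * μ ≤ 1 / 400 := by nlinarith
  have hθ0 : 0 < η * μ := by positivity
  set θ := η * μ
  have hr'1 : r' ≤ r := by
    rw [hr']
    exact mul_le_of_le_one_left hr.le (Real.exp_le_one_iff.2 (by linarith))
  have hr'2 : (1 - θ / 2) * r ≤ r' := by
    rw [hr']
    gcongr
    have := Real.add_one_le_exp (-(θ / 2))
    linarith
  have hr'0 : 0 < r' := by rw [hr']; positivity
  have hρ1 : η * τ ≤ r / 120 := by
    rw [hτ]
    have : Real.exp (-θ) ≤ 1 := Real.exp_le_one_iff.2 (by linarith)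
    nlinarith
  have hτ0 : 0 < τ := by
    have : 0 < η * τ := by rw [hτ]; positivity
    exact pos_of_mul_pos_right this hη.le
  have hstep : ∀ z, ‖e + η • clip (g z) τ‖ ≤ ‖e‖ + r / 120 := by
    intro z
    refine (norm_add_le _ _).trans ?_
    rw [norm_smul, Real.norm_eq_abs, abs_of_pos hη]
    gcongr
    refine le_trans ?_ hρ1
    gcongr
    exact norm_clip_le hτ0.le
  have hθr : 0 < θ * r := by positivity
  have hm : Measurable fun z => ‖e + η • clip (g z) τ‖ :=
    ((((measurable_clip τ).comp hg).const_smul η).const_add e).norm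
  have hiesc : Integrable (fun z => escape r' ‖e + η • clip (g z) τ‖) P :=
    Integrable.of_bound ((continuous_escape r').measurable.comp hm).aestronglyMeasurable 1
      (Filter.Eventually.of_forall fun z => by
        rw [Real.norm_eq_abs, abs_of_nonneg (escape_nonneg _ _)]
        exact escape_le_one _ _)
  refine ⟨⟨hiesc, ?_⟩, (hint (5 / 2 * r') (by positivity)).1, ?_⟩
  -- Beyond `9r/4` the potential is already `1`; from within `6r/5` a step of length `r/120` cannot
  -- reach `5r'/4`. Only the annulus in between needs the drift.
  · rcases le_or_gt (9 / 4 * r) ‖e‖ with hfar | hfar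
    · rw [escape_eq_one hr hfar]
      have : ∫ z, escape r' ‖e + η • clip (g z) τ‖ ∂P ≤ ∫ _, (1 : ℝ) ∂P :=
        integral_mono hiesc (integrable_const _) fun z => escape_le_one _ _
      simp only [integral_const, probReal_univ, smul_eq_mul, mul_one] at this
      linarith
    rcases le_or_gt ‖e‖ (6 / 5 * r) with hnear | hnear
    · have : ∀ z, escape r' ‖e + η • clip (g z) τ‖ = 0 := fun z =>
        escape_eq_zero hr'0 ((hstep z).trans (by nlinarith))
      simp only [this, integral_zero]
      linarith [escape_nonneg r ‖e‖]
    · obtain ⟨h1, h2⟩ := hint (5 / 4 * r') (by positivity)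
      -- In the annulus both alternatives for `β` lose at least `θ‖e‖/2`, which is all that the
      -- shrinking radius can take away.
      have hβr : β ≤ ‖e‖ / r * r' := by
        have h3 : ‖e‖ / r * ((1 - θ / 2) * r) ≤ ‖e‖ / r * r' := by gcongr
        have h4 : ‖e‖ / r * ((1 - θ / 2) * r) = ‖e‖ * (1 - θ / 2) := by field_simp
        rw [h4] at h3
        refine le_trans ?_ h3
        rcases hβ with hβ | hβ <;> nlinarith
      have h5 : max 0 (β - 5 / 4 * r') ≤ max 0 (‖e‖ / r - 5 / 4) * r' := by
        rw [max_mul_of_nonneg _ _ hr'0.le, zero_mul]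
        refine max_le_max le_rfl ?_
        linarith
      have hle : ∀ z, escape r' ‖e + η • clip (g z) τ‖ ≤
          max 0 (‖e + η • clip (g z) τ‖ - 5 / 4 * r') ^ 2 / r' ^ 2 := by
        intro z
        refine (min_le_left _ _).trans_eq ?_
        rw [← div_pow]
        congr 1
        rw [← max_div_div_right hr'0.le, zero_div, sub_div, mul_div_cancel_right₀ _ hr'0.ne']
      have h6 : ∫ z, escape r' ‖e + η • clip (g z) τ‖ ∂P ≤
          (max 0 (‖e‖ / r - 5 / 4)) ^ 2 + q := by
        calc ∫ z, escape r' ‖e + η • clip (g z) τ‖ ∂P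
            ≤ ∫ z, max 0 (‖e + η • clip (g z) τ‖ - 5 / 4 * r') ^ 2 / r' ^ 2 ∂P :=
              integral_mono hiesc (h1.div_const _) hle
          _ = (∫ z, max 0 (‖e + η • clip (g z) τ‖ - 5 / 4 * r') ^ 2 ∂P) / r' ^ 2 :=
              integral_div _ _
          _ ≤ ((max 0 (‖e‖ / r - 5 / 4) * r') ^ 2 + q * r' ^ 2) / r' ^ 2 := by
              have h7 : max 0 (β - 5 / 4 * r') ^ 2 ≤ (max 0 (‖e‖ / r - 5 / 4) * r') ^ 2 :=
                pow_le_pow_left₀ (le_max_left _ _) h5 2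
              have h8 : r ^ 2 / 2 ≤ r' ^ 2 := by nlinarith
              have h9 : q * r ^ 2 / 2 ≤ q * r' ^ 2 := by
                rw [mul_div_assoc]
                exact mul_le_mul_of_nonneg_left h8 hq0
              exact div_le_div_of_nonneg_right (by linarith) (sq_nonneg _)
          _ = _ := by
              have := hr'0.ne'
              field_simp
      rw [escape, min_def]
      split_ifs with hc
      · exact h6
      · have : ∫ z, escape r' ‖e + η • clip (g z) τ‖ ∂P ≤ ∫ _, (1 : ℝ) ∂P :=
          integral_mono hiesc (integrable_const _) fun z => escape_le_one _ _
        simp only [integral_const, probReal_univ, smul_eq_mul, mul_one] at this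
        linarith
  -- Within `12r/5` a step cannot cross `5r'/2`; beyond, `escape` equals `1`, so the variance can be
  -- charged to it.
  · rcases le_or_gt ‖e‖ (12 / 5 * r) with hnear | hnear
    · have : ∀ z, excess r' ‖e + η • clip (g z) τ‖ = 0 := fun z =>
        excess_eq_zero ((hstep z).trans (by nlinarith))
      simp only [this, integral_zero]
      have := excess_nonneg r ‖e‖
      have := escape_nonneg r ‖e‖
      positivity
    · rw [escape_eq_one hr (by linarith), mul_one]
      refine (hint (5 / 2 * r') (by positivity)).2.trans ?_
      have : β - 5 / 2 * r' ≤ ‖e‖ - 5 / 2 * r := by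
        rcases hβ with hβ | hβ <;> nlinarith
      have h1 : max 0 (β - 5 / 2 * r') ^ 2 ≤ excess r ‖e‖ := by
        unfold excess
        gcongr
      have h2 : 0 ≤ q * r ^ 2 := by positivity
      linarith

end OneStep

/-- The radius `R exp(-η μ k / 2)` within which the `k`-th inner iterate is tracked. -/
noncomputable def radius (μ R η : ℝ) (k : ℕ) : ℝ := Real.exp (-(η * μ * k / 2)) * R

theorem radius_pos {μ R η : ℝ} (hR : 0 < R) (k : ℕ) : 0 < radius μ R η k := by
  unfold radius; positivity

theorem radius_zero (μ R η : ℝ) : radius μ R η 0 = R := by simp [radius]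

theorem radius_succ (μ R η : ℝ) (k : ℕ) :
    radius μ R η (k + 1) = Real.exp (-(η * μ / 2)) * radius μ R η k := by
  rw [radius, radius, ← mul_assoc, ← Real.exp_add]
  congr 2
  push_cast
  ring

theorem radius_anti {μ R η : ℝ} (hμ : 0 ≤ μ) (hη : 0 ≤ η) (hR : 0 ≤ R) : Antitone (radius μ R η) := by
  intro i j hij
  unfold radius
  gcongr

/-- An inner step thus moves by at most `radius / 120`. The factor `exp(-ημ)` is harmless, since `ημ
≤ 1/400`. -/
theorem mul_clipLevel {μ R η : ℝ} (hη : 0 < η) (k : ℕ) :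
    η * clipLevel μ R η k = Real.exp (-(η * μ)) * radius μ R η k / 120 := by
  rw [clipLevel, radius, ← mul_assoc, ← Real.exp_add]
  have : -(η * μ * (1 + (k : ℝ) / 2)) = -(η * μ) + -(η * μ * k / 2) := by ring
  rw [this]
  field_simp

theorem clipLevel_pos {μ R η : ℝ} (hη : 0 < η) (hR : 0 < R) (k : ℕ) : 0 < clipLevel μ R η k := by
  unfold clipLevel; positivity

theorem rpow_noise_ratio {p ℓ μ σ ε : ℝ} (hp : 1 < p) (hℓ : 0 < ℓ) (hμ : 0 < μ) (hσ : 0 ≤ σ)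
    (hε : 0 < ε) :
    (ℓ ^ 2 * σ ^ 2 / (μ ^ 2 * ε ^ 2)) ^ (p / (2 * (p - 1))) =
      (ℓ * σ / (μ * ε)) ^ (p / (p - 1)) := by
  have h1 : ℓ ^ 2 * σ ^ 2 / (μ ^ 2 * ε ^ 2) = (ℓ * σ / (μ * ε)) ^ (2 : ℝ) := by
    rw [Real.rpow_two]; ring
  have hp' : p - 1 ≠ 0 := by linarith
  rw [h1, ← Real.rpow_mul (by positivity)]
  congr 1
  field_simp

/-- The constant in front of the inner loop length. -/
noncomputable def innerConst (p : ℝ) : ℝ := (10 ^ 8 : ℝ) ^ (p / (p - 1))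

theorem innerConst_ge {p : ℝ} (hp : 1 < p) : 10 ^ 8 ≤ innerConst p := by
  refine Real.self_le_rpow_of_one_le (by norm_num) ?_
  rw [le_div_iff₀ (by linarith)]
  linarith

theorem one_le_log {ℓ R ε : ℝ} (hℓ : 0 < ℓ) (hε : 0 < ε) (hR : 4 * ε / ℓ ≤ R) :
    1 ≤ Real.log (ℓ * R / ε) := by
  have h4 : 4 ≤ ℓ * R / ε := by
    rw [le_div_iff₀ hε]
    rw [div_le_iff₀ hℓ] at hR
    linarith
  have h5 : Real.log 4 ≤ Real.log (ℓ * R / ε) := Real.log_le_log (by norm_num) h4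
  have h6 : Real.log 4 = 2 * Real.log 2 := by
    rw [show (4 : ℝ) = 2 ^ 2 by norm_num, Real.log_pow]; norm_num
  linarith [Real.log_two_gt_d9]

/-! ### Consequences of the choice of `K`, `B` and the inner stepsize. -/

section Parameters

variable {p ℓ μ σ ε R : ℝ}

/-- The exponent `p/(p-1)` on the constant and on the logarithm is there so that both appear to the
first power in `K^((p-1)/p)`. -/
theorem le_innerLength (hp : 1 < p) (hℓ : 0 < ℓ) (hμ : 0 < μ) (hσ : 0 ≤ σ) (hε : 0 < ε)
    (hR : 4 * ε / ℓ ≤ R) {K : ℕ}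
    (hK : K = innerLength (innerConst p) (p / (p - 1)) p ε ℓ μ σ (ℓ / μ) R) :
    10 ^ 8 * Real.log (ℓ * R / ε) * (ℓ / μ) ≤ K ∧
    10 ^ 8 * Real.log (ℓ * R / ε) * (ℓ * σ / (μ * ε)) ≤ (K : ℝ) ^ ((p - 1) / p) := by
  have hL := one_le_log hℓ hε hR
  set L := Real.log (ℓ * R / ε)
  have hle := Nat.le_ceil (innerConst p * L ^ (p / (p - 1)) *
    (ℓ / μ + (ℓ ^ 2 * σ ^ 2 / (μ ^ 2 * ε ^ 2)) ^ (p / (2 * (p - 1)))))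
  rw [innerLength] at hK
  rw [← hK, rpow_noise_ratio hp hℓ hμ hσ hε] at hle
  have hexp : 1 ≤ p / (p - 1) := by
    rw [le_div_iff₀ (by linarith)]
    linarith
  have hLa : L ≤ L ^ (p / (p - 1)) := Real.self_le_rpow_of_one_le hL hexp
  have hc0 : 0 ≤ innerConst p := le_trans (by norm_num) (innerConst_ge hp)
  have hS : 0 ≤ (ℓ * σ / (μ * ε)) ^ (p / (p - 1)) := by positivity
  have hκ : 0 < ℓ / μ := by positivity
  constructor
  · refine le_trans ?_ hle
    have h1 : 10 ^ 8 * L ≤ innerConst p * L ^ (p / (p - 1)) :=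
      mul_le_mul (innerConst_ge hp) hLa (by linarith) hc0
    exact mul_le_mul h1 (by linarith) hκ.le (by positivity)
  · have hp0 : 0 ≤ (p - 1) / p := div_nonneg (by linarith) (by linarith)
    have h1 : (10 ^ 8 * L * (ℓ * σ / (μ * ε))) ^ (p / (p - 1)) ≤ K := by
      refine le_trans ?_ hle
      rw [Real.mul_rpow (by positivity) (by positivity), Real.mul_rpow (by norm_num) (by linarith)]
      exact mul_le_mul_of_nonneg_left (by linarith) (by positivity)
    have h2 := Real.rpow_le_rpow (by positivity) h1 hp0
    rw [← Real.rpow_mul (by positivity)] at h2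
    have h3 : p / (p - 1) * ((p - 1) / p) = 1 := by
      have : p - 1 ≠ 0 := by linarith
      have : p ≠ 0 := by linarith
      field_simp
    rwa [h3, Real.rpow_one] at h2

/-- The properties of the logarithmic factor in the noisy case. -/
theorem logFactor_spec (hp : 1 < p) (hℓ : 0 < ℓ) (hμ : 0 < μ) (hσ : 0 < σ)
    (hε : 0 < ε) (hR : 4 * ε / ℓ ≤ R) {K : ℕ} {B : ℝ}
    (hK : K = innerLength (innerConst p) (p / (p - 1)) p ε ℓ μ σ (ℓ / μ) R)
    (hB : IsLogFactor p μ σ R K B) :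
    0 < B ∧ 1 ≤ Real.log B ∧ 1000 * (ℓ * R / ε) ≤ Real.sqrt B ∧
      Real.sqrt B * Real.log B = μ * (K : ℝ) ^ ((p - 1) / p) * R / ((5400 : ℝ) ^ (1 / p) * σ) := by
  have hL := one_le_log hℓ hε hR
  have hK2 := (le_innerLength hp hℓ hμ hσ.le hε hR hK).2
  have hR0 : 0 < R := lt_of_lt_of_le (by positivity) hR
  have hz4 : 4 ≤ ℓ * R / ε := by
    rw [le_div_iff₀ hε]
    rw [div_le_iff₀ hℓ] at hR
    linarith
  set Z := ℓ * R / ε with hZ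
  set L := Real.log Z
  set Q := μ * (K : ℝ) ^ ((p - 1) / p) * R / ((5400 : ℝ) ^ (1 / p) * σ) with hQ
  have h54 : (5400 : ℝ) ^ (1 / p) ≤ 5400 := by
    conv_rhs => rw [← Real.rpow_one 5400]
    refine Real.rpow_le_rpow_of_exponent_le (by norm_num) ?_
    rw [div_le_one (by linarith)]
    exact hp.le
  have hQlow : 10 ^ 8 / 5400 * L * Z ≤ Q := by
    rw [hQ, le_div_iff₀ (by positivity)]
    have h1 : 10 ^ 8 / 5400 * L * Z * ((5400 : ℝ) ^ (1 / p) * σ) ≤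
        10 ^ 8 / 5400 * L * Z * (5400 * σ) := by gcongr
    have h2 : 10 ^ 8 / 5400 * L * Z * (5400 * σ) = μ * (10 ^ 8 * L * (ℓ * σ / (μ * ε))) * R := by
      rw [hZ]; field_simp
    rw [h2] at h1
    refine h1.trans ?_
    gcongr
  have hQ0 : 0 < Q := lt_of_lt_of_le (by positivity) hQlow
  have hbranch : μ ^ 2 * (K : ℝ) ^ (2 * (p - 1) / p) * R ^ 2 /
      ((5400 : ℝ) ^ (2 / p) * σ ^ 2 * Real.log B ^ 2) = (Q / Real.log B) ^ 2 := by
    have h1 : (K : ℝ) ^ (2 * (p - 1) / p) = ((K : ℝ) ^ ((p - 1) / p)) ^ 2 := by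
      rw [← Real.rpow_natCast, ← Real.rpow_mul (Nat.cast_nonneg _)]
      congr 1; push_cast; ring
    have h2 : (5400 : ℝ) ^ (2 / p) = ((5400 : ℝ) ^ (1 / p)) ^ 2 := by
      rw [← Real.rpow_natCast, ← Real.rpow_mul (by norm_num)]
      congr 1; push_cast; ring
    rw [h1, h2, hQ, div_pow, div_pow]
    rw [div_div]
    congr 1 <;> ring
  rw [IsLogFactor, hbranch] at hB
  have hB2 : 2 ≤ B := by rw [hB]; exact le_max_left _ _
  have hB0 : 0 < B := by linarith
  have hBQ : (Q / Real.log B) ^ 2 ≤ B := by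
    conv_rhs => rw [hB]
    exact le_max_right _ _
  have hx0 : 0 < Real.log B := Real.log_pos (by linarith)
  -- This holds whichever term attains the maximum in the fixed-point equation.
  have hsq : Q ≤ Real.sqrt B * Real.log B := by
    rw [← div_le_iff₀ hx0]
    exact Real.le_sqrt_of_sq_le hBQ
  -- Otherwise `ln B ≤ 14 + 2L ≤ 16L`, so `√B ln B ≤ 16000 L Z`, which is below `10⁸/5400 · L Z ≤
  -- Q`.
  have hbig : 1000 * Z ≤ Real.sqrt B := by
    by_contra hc
    have hc := (not_le.1 hc).le
    have hlog : Real.log B ≤ 16 * L := by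
      have h1 : Real.log (Real.sqrt B) ≤ Real.log (1000 * Z) :=
        Real.log_le_log (Real.sqrt_pos.2 hB0) hc
      rw [Real.log_sqrt hB0.le, Real.log_mul (by norm_num) (by positivity)] at h1
      have h2 : Real.log 1000 ≤ 7 := by
        have : Real.log 1000 ≤ Real.log (2 ^ 10) := Real.log_le_log (by norm_num) (by norm_num)
        rw [Real.log_pow] at this
        push_cast at this
        linarith [Real.log_two_lt_d9]
      have : Real.log Z = L := rfl
      linarith
    have h3 : Real.sqrt B * Real.log B ≤ 1000 * Z * (16 * L) :=
      mul_le_mul hc hlog hx0.le (by positivity)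
    have h4 : 0 < L * Z := by positivity
    nlinarith
  have hB4 : 4 ≤ B := by
    have h1 : (2 : ℝ) ≤ Real.sqrt B := by linarith
    have := Real.sq_sqrt hB0.le
    nlinarith
  have hx1 : 1 ≤ Real.log B := by
    have h5 : Real.log 4 ≤ Real.log B := Real.log_le_log (by norm_num) hB4
    have h6 : Real.log 4 = 2 * Real.log 2 := by
      rw [show (4 : ℝ) = 2 ^ 2 by norm_num, Real.log_pow]; norm_num
    linarith [Real.log_two_gt_d9]
  refine ⟨hB0, hx1, hbig, ?_⟩
  -- The bound `B ≥ 4` rules out the value `2` of the maximum.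
  have hBeq : B = (Q / Real.log B) ^ 2 := by
    rcases max_choice (2 : ℝ) ((Q / Real.log B) ^ 2) with h | h
    · rw [h] at hB; linarith
    · rwa [h] at hB
  have : Real.sqrt B = Q / Real.log B := by
    have h7 : Real.sqrt B = Real.sqrt ((Q / Real.log B) ^ 2) := by rw [← hBeq]
    rw [h7, Real.sqrt_sq (by positivity)]
  rw [this, div_mul_cancel₀ _ hx0.ne']

set_option maxHeartbeats 800000 in
/-- What the analysis uses of the inner parameters. -/
theorem inner_parameters (hp : 1 < p) (hp2 : p ≤ 2) (hμ : 0 < μ) (hμℓ : μ ≤ ℓ)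
    (hσ : 0 ≤ σ) (hε : 0 < ε) (hR : 4 * ε / ℓ ≤ R) {K : ℕ} {B η : ℝ}
    (hK : K = innerLength (innerConst p) (p / (p - 1)) p ε ℓ μ σ (ℓ / μ) R)
    (hB : IsLogFactor p μ σ R K B) (hη : η = innerStepsize ℓ μ σ K B) :
    0 < η ∧ η * ℓ ≤ 1 / 400 ∧ 0 < K ∧ 3 / (K : ℝ) ≤ 3 * (η * μ) ∧
      ℓ / μ * (3 / (K : ℝ)) ≤ 1 / 40000 ∧ radius μ R η K ≤ ε / (1000 * ℓ) ∧
      ∀ k < K, (σ / clipLevel μ R η k) ^ p ≤ 3 / K * (radius μ R η K / radius μ R η k) := by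
  have hℓ := hμ.trans_le hμℓ
  have hL := one_le_log hℓ hε hR
  have hK1 := (le_innerLength hp hℓ hμ hσ hε hR hK).1
  have hR0 : 0 < R := lt_of_lt_of_le (by positivity) hR
  have hLdef : Real.exp (Real.log (ℓ * R / ε)) = ℓ * R / ε := Real.exp_log (by positivity)
  set L := Real.log (ℓ * R / ε)
  have hκ1 : 1 ≤ ℓ / μ := (one_le_div hμ).2 hμℓ
  have hKκ : 10 ^ 8 * (ℓ / μ) ≤ K := by nlinarith
  have hK0 : (0 : ℝ) < K := by linarith
  -- the two conclusions in the case of the stepsize `1 / (400 ℓ)`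
  have hlong : η = 1 / (400 * ℓ) → 1 ≤ η * μ * K ∧ radius μ R η K ≤ ε / (1000 * ℓ) := by
    intro h
    have h1 : η * μ * (10 ^ 8 * L * (ℓ / μ)) ≤ η * μ * K := by
      have : 0 ≤ η * μ := by rw [h]; positivity
      gcongr
    have h2 : η * μ * (10 ^ 8 * L * (ℓ / μ)) = 10 ^ 8 / 400 * L := by
      rw [h]; field_simp
    rw [h2] at h1
    refine ⟨by linarith, ?_⟩
    have h3 : radius μ R η K ≤ Real.exp (-10 + -L) * R := by
      unfold radius
      gcongr
      linarith
    refine h3.trans ?_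
    have h4 : Real.exp (-10) ≤ 1 / 1000 := by
      rw [Real.exp_neg, ← one_div]
      refine one_div_le_one_div_of_le (by norm_num) ?_
      have : (2 : ℝ) ≤ Real.exp 1 := by have := Real.add_one_le_exp 1; linarith
      calc (1000 : ℝ) ≤ 2 ^ 10 := by norm_num
        _ ≤ Real.exp 1 ^ 10 := by gcongr
        _ = Real.exp 10 := by rw [← Real.exp_nat_mul]; norm_num
    rw [Real.exp_add, Real.exp_neg L, hLdef]
    calc Real.exp (-10) * (ℓ * R / ε)⁻¹ * R ≤ 1 / 1000 * (ℓ * R / ε)⁻¹ * R := by gcongr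
      _ = ε / (1000 * ℓ) := by field_simp
  have hκK : ℓ / μ * (3 / (K : ℝ)) ≤ 1 / 40000 := by
    rw [mul_div_assoc', div_le_div_iff₀ hK0 (by norm_num)]
    linarith
  have hmain : 0 < η ∧ η * ℓ ≤ 1 / 400 ∧ 1 ≤ η * μ * K ∧ radius μ R η K ≤ ε / (1000 * ℓ) ∧
      ∀ k < K, (σ / clipLevel μ R η k) ^ p ≤ 3 / K * (radius μ R η K / radius μ R η k) := by
    rcases hσ.eq_or_lt with h0 | hσ
    · have hη' : η = 1 / (400 * ℓ) := by rw [hη, innerStepsize, if_pos h0.symm]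
      refine ⟨by rw [hη']; positivity, ?_, (hlong hη').1, (hlong hη').2, fun k _ => ?_⟩
      · rw [hη']; apply le_of_eq; field_simp
      · rw [← h0, zero_div, Real.zero_rpow (by linarith)]
        have := radius_pos (μ := μ) (η := η) hR0 K
        have := radius_pos (μ := μ) (η := η) hR0 k
        positivity
    · obtain ⟨hB0, hx1, hbig, hQ⟩ := logFactor_spec hp hℓ hμ hσ hε hR hK hB
      set x := Real.log B with hx
      have hη' : η = min (1 / (400 * ℓ)) (x / (μ * K)) := by
        rw [hη, innerStepsize, if_neg hσ.ne']
      have hη0 : 0 < η := by rw [hη']; exact lt_min (by positivity) (by positivity)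
      have hηℓ : η * ℓ ≤ 1 / 400 := by
        have : η ≤ 1 / (400 * ℓ) := by rw [hη']; exact min_le_left _ _
        calc η * ℓ ≤ 1 / (400 * ℓ) * ℓ := by gcongr
          _ = _ := by field_simp
      have hηx : η ≤ x / (μ * K) := by rw [hη']; exact min_le_right _ _
      have hηx' : η * μ * K ≤ x := by
        rw [le_div_iff₀ (by positivity)] at hηx
        linarith
      have hsB : Real.exp (-(x / 2)) = 1 / Real.sqrt B := by
        rw [Real.exp_neg, Real.exp_half, hx, Real.exp_log hB0, one_div]
      have hsB0 : 0 < Real.sqrt B := Real.sqrt_pos.2 hB0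
      refine ⟨hη0, hηℓ, ?_, ?_, ?_⟩
      · rcases min_choice (1 / (400 * ℓ)) (x / (μ * K)) with h | h
        · exact (hlong (hη'.trans h)).1
        · rw [hη', h]
          refine hx1.trans_eq ?_
          field_simp
      · rcases min_choice (1 / (400 * ℓ)) (x / (μ * K)) with h | h
        · exact (hlong (hη'.trans h)).2
        · have h1 : η * μ * K = x := by rw [hη', h]; field_simp
          rw [radius, h1, hsB, div_mul_eq_mul_div, one_mul, div_le_div_iff₀ hsB0 (by positivity)]
          have h2 : 1000 * (ℓ * R / ε) * ε ≤ Real.sqrt B * ε := by gcongr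
          have h3 : 1000 * (ℓ * R / ε) * ε = R * (1000 * ℓ) := by field_simp
          linarith
      · intro k hk
        have hrk := radius_pos (μ := μ) (η := η) hR0 k
        have hrK := radius_pos (μ := μ) (η := η) hR0 K
        have hratio : radius μ R η K / radius μ R η k ≤ 1 :=
          (div_le_one hrk).2 (radius_anti hμ.le hη0.le hR0.le hk.le)
        have hτ := clipLevel_pos (μ := μ) hη0 hR0 k
        have hθ : η * μ ≤ 1 / 400 := by nlinarith
        have hKp : (K : ℝ) ^ (1 / p) * (K : ℝ) ^ ((p - 1) / p) = K := by
          rw [← Real.rpow_add hK0]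
          have : 1 / p + (p - 1) / p = 1 := by
            have : p ≠ 0 := by linarith
            field_simp; ring
          rw [this, Real.rpow_one]
        -- This is the purpose of `B`: from `ημK ≤ ln B` one gets `r_K ≥ R/√B`, and `√B ln B = Q`
        -- turns this into a lower bound for `r_K` in terms of the noise.
        have hrKlow : η * (σ * ((5400 : ℝ) ^ (1 / p) * (K : ℝ) ^ (1 / p))) ≤ radius μ R η K := by
          have h1 : R / Real.sqrt B ≤ radius μ R η K := by
            rw [radius, div_eq_mul_one_div, ← hsB, mul_comm]
            gcongr
          refine le_trans ?_ h1
          have hc := Real.rpow_pos_of_pos hK0 (1 / p)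
          have hd := Real.rpow_pos_of_pos hK0 ((p - 1) / p)
          have h54 : (0 : ℝ) < 5400 ^ (1 / p) := by positivity
          rw [eq_div_iff (by positivity)] at hQ
          rw [le_div_iff₀ hsB0]
          have h2 : x * (η * (σ * ((5400 : ℝ) ^ (1 / p) * (K : ℝ) ^ (1 / p))) * Real.sqrt B)
              ≤ x * R := by
            calc x * (η * (σ * ((5400 : ℝ) ^ (1 / p) * (K : ℝ) ^ (1 / p))) * Real.sqrt B)
                = η * (K : ℝ) ^ (1 / p) * (Real.sqrt B * x * ((5400 : ℝ) ^ (1 / p) * σ)) := by ring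
              _ = η * μ * ((K : ℝ) ^ (1 / p) * (K : ℝ) ^ ((p - 1) / p)) * R := by rw [hQ]; ring
              _ = η * μ * K * R := by rw [hKp]
              _ ≤ x * R := by gcongr
          exact le_of_mul_le_mul_left h2 (by linarith)
        have hστ : σ / clipLevel μ R η k ≤
            radius μ R η K / radius μ R η k * (121 / ((5400 : ℝ) ^ (1 / p) * (K : ℝ) ^ (1 / p))) := by
          have h54 : (0 : ℝ) < 5400 ^ (1 / p) * (K : ℝ) ^ (1 / p) := by positivity
          set c := (5400 : ℝ) ^ (1 / p) * (K : ℝ) ^ (1 / p)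
          rw [div_mul_div_comm, div_le_div_iff₀ hτ (by positivity)]
          -- Rounding: `120 exp(ημ) ≤ 121` because `ημ ≤ 1/400`.
          have h1 : radius μ R η k ≤ 121 * (η * clipLevel μ R η k) := by
            rw [mul_clipLevel hη0]
            have := Real.add_one_le_exp (-(η * μ))
            nlinarith
          have h2 : σ * (radius μ R η k * c) ≤ σ * (121 * (η * clipLevel μ R η k) * c) := by
            gcongr
          refine h2.trans ?_
          calc σ * (121 * (η * clipLevel μ R η k) * c)
              = η * (σ * c) * 121 * clipLevel μ R η k := by ring
            _ ≤ _ := by gcongr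
        have h3 : (σ / clipLevel μ R η k) ^ p ≤ (radius μ R η K / radius μ R η k *
            (121 / ((5400 : ℝ) ^ (1 / p) * (K : ℝ) ^ (1 / p)))) ^ p :=
          Real.rpow_le_rpow (by positivity) hστ (by linarith)
        refine h3.trans ?_
        have hroot : ∀ c : ℝ, 0 ≤ c → (c ^ (1 / p)) ^ p = c := by
          intro c hc
          rw [← Real.rpow_mul hc, one_div_mul_cancel (by linarith), Real.rpow_one]
        have hρ0 : 0 ≤ radius μ R η K / radius μ R η k := by positivity
        rw [Real.mul_rpow hρ0 (by positivity),
          Real.div_rpow (by norm_num : (0 : ℝ) ≤ 121) (by positivity), Real.mul_rpow (by positivity) (by positivity),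
          hroot _ (by norm_num), hroot _ hK0.le, mul_comm]
        -- The ratio is at most `1`, so its power `p` may be lowered to `1`; the remaining constant
        -- is `121²/5400 < 3`.
        have h4 : (radius μ R η K / radius μ R η k) ^ p ≤ radius μ R η K / radius μ R η k :=
          Real.rpow_le_self_of_le_one (by positivity) hratio hp.le
        have h5 : (121 : ℝ) ^ p ≤ 121 ^ 2 := by
          rw [← Real.rpow_natCast]
          exact Real.rpow_le_rpow_of_exponent_le (by norm_num) (by exact_mod_cast hp2)
        have h6 : (121 : ℝ) ^ p / (5400 * K) ≤ 3 / K := by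
          rw [div_le_div_iff₀ (by positivity) hK0]
          have h7 := mul_le_mul_of_nonneg_right h5 hK0.le
          linarith
        exact mul_le_mul h6 h4 (by positivity) (by positivity)
  obtain ⟨h1, h2, h3, h4, h5⟩ := hmain
  refine ⟨h1, h2, by exact_mod_cast hK0, ?_, hκK, h4, h5⟩
  rw [div_le_iff₀ hK0]
  linarith

end Parameters

section Moments

variable {α : Type*} [MeasurableSpace α] {P : Measure α}

theorem integrable_of_lintegral_ofReal_le {φ : α → ℝ} {C : ℝ} (hφ : AEStronglyMeasurable φ P)
    (h0 : ∀ z, 0 ≤ φ z) (hC : 0 ≤ C) (h : ∫⁻ z, ENNReal.ofReal (φ z) ∂P ≤ ENNReal.ofReal C) :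
    Integrable φ P ∧ ∫ z, φ z ∂P ≤ C := by
  have hi : Integrable φ P :=
    ⟨hφ, (hasFiniteIntegral_iff_ofReal (Filter.Eventually.of_forall h0)).2
      (h.trans_lt ENNReal.ofReal_lt_top)⟩
  refine ⟨hi, ?_⟩
  rw [← ofReal_integral_eq_lintegral_ofReal hi (Filter.Eventually.of_forall h0)] at h
  exact (ENNReal.ofReal_le_ofReal_iff hC).1 h

theorem lintegral_ofReal_le {φ : α → ℝ} {C : ℝ} (hi : Integrable φ P) (h0 : ∀ z, 0 ≤ φ z)
    (h : ∫ z, φ z ∂P ≤ C) : ∫⁻ z, ENNReal.ofReal (φ z) ∂P ≤ ENNReal.ofReal C := by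
  rw [← ofReal_integral_eq_lintegral_ofReal hi (Filter.Eventually.of_forall h0)]
  exact ENNReal.ofReal_le_ofReal h

end Moments

/-! ### Measurability and moments of the two oracle components. -/

section Oracle

variable {dx dy : ℕ} {Ξ : Type*} [MeasurableSpace Ξ] {P : Measure Ξ} {p σ : ℝ}
  {f : Joint dx dy → ℝ} {G : Joint dx dy → Ξ → Joint dx dy}

theorem measurable_fst_joint : Measurable fun z : Joint dx dy => z.fst :=
  (WithLp.fstL 2 ℝ (Vec dx) (Vec dy)).continuous.measurable

theorem measurable_snd_joint : Measurable fun z : Joint dx dy => z.snd :=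
  (WithLp.sndL 2 ℝ (Vec dx) (Vec dy)).continuous.measurable

theorem measurable_pair : Measurable fun q : Vec dx × Vec dy => pair q.1 q.2 :=
  continuous_pair.measurable

namespace IsPBCMOracle

theorem measurable_pair_left (hG : IsPBCMOracle p σ f P G) :
    Measurable fun q : (Vec dx × Vec dy) × Ξ => G (pair q.1.1 q.1.2) q.2 :=
  hG.measurable.comp ((measurable_pair.comp measurable_fst).prodMk measurable_snd)

theorem measurable_section (hG : IsPBCMOracle p σ f P G) (z : Joint dx dy) : Measurable (G z) :=
  hG.measurable.comp measurable_prodMk_left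

theorem integrable_fst (hG : IsPBCMOracle p σ f P G) (z : Joint dx dy) :
    Integrable (fun ξ => (G z ξ).fst) P :=
  (WithLp.fstL 2 ℝ (Vec dx) (Vec dy)).integrable_comp (hG.integrable z)

theorem integrable_snd (hG : IsPBCMOracle p σ f P G) (z : Joint dx dy) :
    Integrable (fun ξ => (G z ξ).snd) P :=
  (WithLp.sndL 2 ℝ (Vec dx) (Vec dy)).integrable_comp (hG.integrable z)

theorem integral_fst (hG : IsPBCMOracle p σ f P G) (z : Joint dx dy) :
    ∫ ξ, (G z ξ).fst ∂P = (∇ f z).fst := by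
  rw [← hG.unbiased z]
  exact (WithLp.fstL 2 ℝ (Vec dx) (Vec dy)).integral_comp_comm (hG.integrable z)

theorem integral_snd (hG : IsPBCMOracle p σ f P G) (z : Joint dx dy) :
    ∫ ξ, (G z ξ).snd ∂P = (∇ f z).snd := by
  rw [← hG.unbiased z]
  exact (WithLp.sndL 2 ℝ (Vec dx) (Vec dy)).integral_comp_comm (hG.integrable z)

theorem moment_fst (hG : IsPBCMOracle p σ f P G) (hp : 1 < p) (hσ : 0 ≤ σ) (z : Joint dx dy) :
    Integrable (fun ξ => ‖(G z ξ).fst - (∇ f z).fst‖ ^ p) P ∧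
      ∫ ξ, ‖(G z ξ).fst - (∇ f z).fst‖ ^ p ∂P ≤ σ ^ p := by
  refine integrable_of_lintegral_ofReal_le ?_ (fun _ => by positivity) (by positivity)
    ((lintegral_mono fun ξ => ENNReal.ofReal_le_ofReal ?_).trans (hG.moment z))
  · exact (((measurable_fst_joint.comp (hG.measurable_section z)).sub_const _).norm.pow_const
      p).aestronglyMeasurable
  · rw [← fst_sub]
    exact Real.rpow_le_rpow (norm_nonneg _) (norm_fst_le _) (by linarith)

theorem moment_snd (hG : IsPBCMOracle p σ f P G) (hp : 1 < p) (hσ : 0 ≤ σ) {τ : ℝ} (hτ : 0 < τ)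
    (z : Joint dx dy) :
    Integrable (fun ξ => (‖(G z ξ).snd - (∇ f z).snd‖ / τ) ^ p) P ∧
      ∫ ξ, (‖(G z ξ).snd - (∇ f z).snd‖ / τ) ^ p ∂P ≤ (σ / τ) ^ p := by
  have h : Integrable (fun ξ => ‖(G z ξ).snd - (∇ f z).snd‖ ^ p) P ∧
      ∫ ξ, ‖(G z ξ).snd - (∇ f z).snd‖ ^ p ∂P ≤ σ ^ p := by
    refine integrable_of_lintegral_ofReal_le ?_ (fun _ => by positivity) (by positivity)
      ((lintegral_mono fun ξ => ENNReal.ofReal_le_ofReal ?_).trans (hG.moment z))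
    · exact (((measurable_snd_joint.comp (hG.measurable_section z)).sub_const _).norm.pow_const
        p).aestronglyMeasurable
    · rw [← snd_sub]
      exact Real.rpow_le_rpow (norm_nonneg _) (norm_snd_le _) (by linarith)
  have heq : ∀ ξ, (‖(G z ξ).snd - (∇ f z).snd‖ / τ) ^ p =
      ‖(G z ξ).snd - (∇ f z).snd‖ ^ p / τ ^ p := fun ξ =>
    Real.div_rpow (norm_nonneg _) hτ.le p
  simp only [heq]
  rw [integral_div, Real.div_rpow hσ hτ.le]
  exact ⟨h.1.div_const _, by gcongr; exact h.2⟩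

end IsPBCMOracle

end Oracle

/-! ### Conditioning on the past samples. -/

section History

variable {Ω Ξ ι : Type*} [mΞ : MeasurableSpace Ξ] {ξ : ι → Ω → Ξ}

/-- The `σ`-algebra generated by the samples with index in `S`. -/
abbrev hist (ξ : ι → Ω → Ξ) (S : Set ι) : MeasurableSpace Ω := ⨆ i ∈ S, mΞ.comap (ξ i)

theorem hist_mono {S T : Set ι} (h : S ⊆ T) : hist ξ S ≤ hist ξ T :=
  biSup_mono fun _ hi => h hi

theorem measurable_hist {S : Set ι} {i : ι} (hi : i ∈ S) : Measurable[hist ξ S] (ξ i) :=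
  Measurable.mono (comap_measurable (ξ i)) (le_iSup₂ (f := fun i _ => mΞ.comap (ξ i)) i hi) le_rfl

variable [mΩ : MeasurableSpace Ω] {Pr : Measure Ω} {P : Measure Ξ}

theorem hist_le (hξ : ∀ i, Measurable (ξ i)) (S : Set ι) : hist ξ S ≤ mΩ :=
  iSup₂_le fun i _ => (hξ i).comap_le

/-- A sample with index outside `S` is independent of every variable measurable for `hist ξ S`, so
their joint law is a product and Tonelli applies. With values in `ENNReal` no integrability is
needed. -/
theorem lintegral_fresh_sample [IsProbabilityMeasure Pr] [IsProbabilityMeasure P]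
    (hlaw : ∀ i, MeasurePreserving (ξ i) Pr P) (hind : iIndepFun ξ Pr)
    {α : Type*} [MeasurableSpace α] {S : Set ι} {i : ι} (hi : i ∉ S) {X : Ω → α}
    (hX : Measurable[hist ξ S] X) {F : α × Ξ → ENNReal} (hF : Measurable F) :
    ∫⁻ ω, F (X ω, ξ i ω) ∂Pr = ∫⁻ ω, ∫⁻ z, F (X ω, z) ∂P ∂Pr := by
  have hξ : ∀ i, Measurable (ξ i) := fun i => (hlaw i).measurable
  have hX' : Measurable X := hX.mono (hist_le hξ S) le_rfl
  have hInd : IndepFun X (ξ i) Pr := by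
    rw [IndepFun_iff_Indep]
    have h := indep_iSup_of_disjoint (fun i => (hξ i).comap_le) hind.iIndep
      (Set.disjoint_singleton_right.2 hi)
    refine indep_of_indep_of_le_left (indep_of_indep_of_le_right h ?_) hX.comap_le
    simp
  have hmap := (indepFun_iff_map_prod_eq_prod_map_map hX'.aemeasurable (hξ i).aemeasurable).1 hInd
  rw [(hlaw i).map_eq] at hmap
  calc ∫⁻ ω, F (X ω, ξ i ω) ∂Pr = ∫⁻ q, F q ∂(Measure.map (fun ω => (X ω, ξ i ω)) Pr) :=
        (lintegral_map hF (hX'.prodMk (hξ i))).symm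
    _ = ∫⁻ x, ∫⁻ z, F (x, z) ∂P ∂(Measure.map X Pr) := by
        rw [hmap, lintegral_prod _ hF.aemeasurable]
    _ = ∫⁻ ω, ∫⁻ z, F (X ω, z) ∂P ∂Pr := lintegral_map hF.lintegral_prod_right' hX'

end History

/-! ### The run of the method: adaptedness and number of oracle calls. -/

section Run

/-- The samples drawn before inner step `k` and minibatch sample `n` of outer iteration `t`. -/
def before (t k n : ℕ) : Set ((ℕ × ℕ) ⊕ (ℕ × ℕ)) :=
  {i | Sum.elim (fun q => q.1 < t ∨ q.1 = t ∧ q.2 < k) (fun q => q.1 < t ∨ q.1 = t ∧ q.2 < n) i}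

theorem inl_mem_before {t k n s j : ℕ} :
    Sum.inl (s, j) ∈ before t k n ↔ s < t ∨ s = t ∧ j < k := Iff.rfl

theorem inr_mem_before {t k n s j : ℕ} :
    Sum.inr (s, j) ∈ before t k n ↔ s < t ∨ s = t ∧ j < n := Iff.rfl

theorem before_mono {t k k' n n' : ℕ} (hk : k ≤ k') (hn : n ≤ n') :
    before t k n ⊆ before t k' n' := by
  rintro (⟨s, j⟩ | ⟨s, j⟩) h
  · rw [inl_mem_before] at h ⊢; omega
  · rw [inr_mem_before] at h ⊢; omega

theorem before_subset_succ (t k n : ℕ) : before t k n ⊆ before (t + 1) 0 0 := by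
  rintro (⟨s, j⟩ | ⟨s, j⟩) h
  · rw [inl_mem_before] at h ⊢; omega
  · rw [inr_mem_before] at h ⊢; omega

variable {dx dy : ℕ} {Ω Ξ : Type*} {G : Joint dx dy → Ξ → Joint dx dy} {prm : Params dx dy} {ξ : (ℕ × ℕ) ⊕ (ℕ × ℕ) → Ω → Ξ}

/-- The two iterates of a state. -/
def State.pos (s : State dx dy) : Vec dx × Vec dy := (s.x, s.y)

/-- The state after `k` inner steps of outer iteration `t`. -/
noncomputable def innerState (G : Joint dx dy → Ξ → Joint dx dy) (prm : Params dx dy)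
    (ξ : (ℕ × ℕ) ⊕ (ℕ × ℕ) → Ω → Ξ) (t k : ℕ) (ω : Ω) : State dx dy :=
  innerLoop G (prm.etaY t) (prm.tau t) (fun k => ξ (Sum.inl (t, k)) ω) (randomRun G prm ξ t ω) k

theorem randomRun_succ (t : ℕ) (ω : Ω) :
    randomRun G prm ξ (t + 1) ω = normalizedStep G prm.etaX prm.M
      (fun i => ξ (Sum.inr (t, i)) ω) (innerState G prm ξ t prm.K ω) := rfl

theorem innerState_x (t k : ℕ) (ω : Ω) :
    (innerState G prm ξ t k ω).x = (randomRun G prm ξ t ω).x := by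
  induction k with
  | zero => rfl
  | succ k ih => exact ih

/-- The effect of an inner step on the iterates. -/
noncomputable def innerMap (G : Joint dx dy → Ξ → Joint dx dy) (η τ : ℝ)
    (q : (Vec dx × Vec dy) × Ξ) : Vec dx × Vec dy :=
  (q.1.1, q.1.2 + η • clip (G (pair q.1.1 q.1.2) q.2).snd τ)

theorem pos_innerState_succ (t k : ℕ) (ω : Ω) :
    (innerState G prm ξ t (k + 1) ω).pos = innerMap G (prm.etaY t) (prm.tau t k)
      ((innerState G prm ξ t k ω).pos, ξ (Sum.inl (t, k)) ω) := rfl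

/-- The sum of the first `n` minibatch gradients. -/
noncomputable def batchSum (G : Joint dx dy → Ξ → Joint dx dy) (prm : Params dx dy)
    (ξ : (ℕ × ℕ) ⊕ (ℕ × ℕ) → Ω → Ξ) (t n : ℕ) (ω : Ω) : Vec dx :=
  ∑ i ∈ Finset.range n, (G (pair (innerState G prm ξ t prm.K ω).x (innerState G prm ξ t prm.K ω).y)
    (ξ (Sum.inr (t, i)) ω)).fst

theorem batchSum_succ (t n : ℕ) (ω : Ω) :
    batchSum G prm ξ t (n + 1) ω = batchSum G prm ξ t n ω +
      (G (pair (innerState G prm ξ t prm.K ω).pos.1 (innerState G prm ξ t prm.K ω).pos.2)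
        (ξ (Sum.inr (t, n)) ω)).fst := Finset.sum_range_succ _ _

theorem calls_innerLoop (η : ℝ) (τ : ℕ → ℝ) (ζ : ℕ → Ξ) (s : State dx dy) (k : ℕ) :
    (innerLoop G η τ ζ s k).calls = s.calls + k := by
  induction k with
  | zero => rfl
  | succ k ih => rw [innerLoop, innerStep, ih]; ring

theorem calls_randomRun (t : ℕ) (ω : Ω) :
    (randomRun G prm ξ t ω).calls = t * (prm.K + prm.M) := by
  induction t with
  | zero => simp [randomRun, run]
  | succ t ih =>
    rw [randomRun_succ, normalizedStep, innerState, calls_innerLoop, ih]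
    ring

variable [mΞ : MeasurableSpace Ξ] {P : Measure Ξ} {p σ : ℝ} {f : Joint dx dy → ℝ}

theorem measurable_innerMap (hG : IsPBCMOracle p σ f P G) (η τ : ℝ) :
    Measurable (innerMap G η τ) := by
  refine (measurable_fst.comp measurable_fst).prodMk ?_
  refine (measurable_snd.comp measurable_fst).add (Measurable.const_smul ?_ η)
  exact (measurable_clip τ).comp (measurable_snd_joint.comp hG.measurable_pair_left)

theorem measurable_innerState_of (hG : IsPBCMOracle p σ f P G) {t : ℕ}
    (h : Measurable[hist ξ (before t 0 0)] fun ω => (randomRun G prm ξ t ω).pos) (k : ℕ) :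
    Measurable[hist ξ (before t k 0)] fun ω => (innerState G prm ξ t k ω).pos := by
  induction k with
  | zero => exact h
  | succ k ih =>
    simp only [pos_innerState_succ]
    exact (measurable_innerMap hG _ _).comp
      ((ih.mono (hist_mono (before_mono (Nat.le_succ k) le_rfl)) le_rfl).prodMk
        (measurable_hist (inl_mem_before.2 (Or.inr ⟨rfl, Nat.lt_succ_self k⟩))))

/-- The position stays paired with the partial sum because the next summand is evaluated at that
position. -/
theorem measurable_batchSum_of (hG : IsPBCMOracle p σ f P G) {t : ℕ}
    (h : Measurable[hist ξ (before t 0 0)] fun ω => (randomRun G prm ξ t ω).pos) (n : ℕ) :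
    Measurable[hist ξ (before t prm.K n)] fun ω =>
      ((innerState G prm ξ t prm.K ω).pos, batchSum G prm ξ t n ω) := by
  have hs := measurable_innerState_of hG h prm.K
  induction n with
  | zero =>
    have h0 : Measurable[hist ξ (before t prm.K 0)] fun ω : Ω => batchSum G prm ξ t 0 ω :=
      @measurable_const _ _ _ (_) (0 : Vec dx)
    exact hs.prodMk h0
  | succ n ih =>
    have ih' := ih.mono (hist_mono (before_mono (le_refl prm.K) (Nat.le_succ n))) le_rfl
    have h1 := measurable_fst.comp ih'
    have h2 := (measurable_fst_joint.comp hG.measurable_pair_left).comp (h1.prodMk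
      (measurable_hist (ξ := ξ) (inr_mem_before (k := prm.K).2
        (Or.inr ⟨rfl, Nat.lt_succ_self n⟩))))
    have h3 : Measurable[hist ξ (before t prm.K (n + 1))] fun ω => batchSum G prm ξ t (n + 1) ω := by
      simp only [batchSum_succ]
      exact (measurable_snd.comp ih').add h2
    exact h1.prodMk h3

theorem measurable_randomRun (hG : IsPBCMOracle p σ f P G) (t : ℕ) :
    Measurable[hist ξ (before t 0 0)] fun ω => (randomRun G prm ξ t ω).pos := by
  induction t with
  | zero => exact @measurable_const _ _ _ (_) (prm.x₀, prm.y₀)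
  | succ t ih =>
    have h := (measurable_batchSum_of hG ih prm.M).mono (hist_mono (before_subset_succ t _ _)) le_rfl
    have hstep : Measurable fun q : (Vec dx × Vec dy) × Vec dx =>
        ((q.1.1 - prm.etaX • (‖(prm.M : ℝ)⁻¹ • q.2‖⁻¹ • ((prm.M : ℝ)⁻¹ • q.2)), q.1.2) :
          Vec dx × Vec dy) := by
      refine Measurable.prodMk ?_ (measurable_snd.comp measurable_fst)
      fun_prop
    exact hstep.comp h

theorem measurable_innerState (hG : IsPBCMOracle p σ f P G) (t k : ℕ) :
    Measurable[hist ξ (before t k 0)] fun ω => (innerState G prm ξ t k ω).pos :=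
  measurable_innerState_of hG (measurable_randomRun hG t) k

theorem measurable_batchSum (hG : IsPBCMOracle p σ f P G) (t n : ℕ) :
    Measurable[hist ξ (before t prm.K n)] fun ω =>
      ((innerState G prm ξ t prm.K ω).pos, batchSum G prm ξ t n ω) :=
  measurable_batchSum_of hG (measurable_randomRun hG t) n

end Run

/-- The distance of `y` to the maximizer of `f(x, ·)`. -/
noncomputable def gap {dx dy : ℕ} (f : Joint dx dy → ℝ) (q : Vec dx × Vec dy) : ℝ :=
  ‖q.2 - argmax f q.1‖

/-- Standing assumptions on the inner loop, as supplied by `inner_parameters`. -/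
structure InnerRegime {dx dy : ℕ} (p ℓ μ σ R η : ℝ) (prm : Params dx dy) : Prop where
  etaY_eq : ∀ t, prm.etaY t = η
  tau_eq : ∀ t k, prm.tau t k = clipLevel μ R η k
  one_lt : 1 < p
  le_two : p ≤ 2
  mu_pos : 0 < μ
  mu_le : μ ≤ ℓ
  sigma_nonneg : 0 ≤ σ
  R_pos : 0 < R
  eta_pos : 0 < η
  eta_mul_le : η * ℓ ≤ 1 / 400
  K_pos : 0 < prm.K
  div_K_le : 3 / (prm.K : ℝ) ≤ 3 * (η * μ)
  kappa_div_K_le : ℓ / μ * (3 / (prm.K : ℝ)) ≤ 1 / 40000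
  noise_le : ∀ k < prm.K, (σ / clipLevel μ R η k) ^ p ≤
    3 / prm.K * (radius μ R η prm.K / radius μ R η k)

/-! ### Growth of the expected potentials along one inner loop. -/

section InnerLoop

variable {dx dy : ℕ} {Ω Ξ : Type*} [mΩ : MeasurableSpace Ω] [mΞ : MeasurableSpace Ξ]
  {Pr : Measure Ω} {P : Measure Ξ} {p ℓ μ σ R η : ℝ} {f : Joint dx dy → ℝ}
  {G : Joint dx dy → Ξ → Joint dx dy} {prm : Params dx dy} {ξ : (ℕ × ℕ) ⊕ (ℕ × ℕ) → Ω → Ξ}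

theorem gap_nonneg (q : Vec dx × Vec dy) : 0 ≤ gap f q := norm_nonneg _

theorem IsSmoothStronglyConcave.measurable_gap (hf : IsSmoothStronglyConcave ℓ μ f) (hℓ : 0 < ℓ)
    (hμ : 0 < μ) : Measurable (gap f) := by
  have h := (hf.continuous_argmax hℓ hμ).measurable
  unfold gap
  exact (measurable_snd.sub (h.comp measurable_fst)).norm

theorem measurable_gap_innerState (hf : IsSmoothStronglyConcave ℓ μ f)
    (hG : IsPBCMOracle p σ f P G) (hξ : ∀ i, Measurable (ξ i)) (hℓ : 0 < ℓ) (hμ : 0 < μ) (t k : ℕ) :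
    Measurable fun ω => gap f (innerState G prm ξ t k ω).pos :=
  (hf.measurable_gap hℓ hμ).comp ((measurable_innerState hG t k).mono (hist_le hξ _) le_rfl)

variable [IsProbabilityMeasure Pr] [IsProbabilityMeasure P]

/-- Drift of the two potentials for fixed iterates. -/
theorem lintegral_innerMap_le (hf : IsSmoothStronglyConcave ℓ μ f) (hG : IsPBCMOracle p σ f P G)
    (hI : InnerRegime p ℓ μ σ R η prm) {k : ℕ} (hk : k < prm.K) (q : Vec dx × Vec dy) :
    ∫⁻ z, ENNReal.ofReal (escape (radius μ R η (k + 1))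
        (gap f (innerMap G η (clipLevel μ R η k) (q, z)))) ∂P ≤
      ENNReal.ofReal (escape (radius μ R η k) (gap f q)
        + 3 / prm.K * (radius μ R η prm.K / radius μ R η k)) ∧
    ∫⁻ z, ENNReal.ofReal (excess (radius μ R η (k + 1))
        (gap f (innerMap G η (clipLevel μ R η k) (q, z)))) ∂P ≤
      ENNReal.ofReal (excess (radius μ R η k) (gap f q) +
        3 / prm.K * (radius μ R η prm.K * radius μ R η k) * escape (radius μ R η k) (gap f q)) := by
  have hℓ := hI.mu_pos.trans_le hI.mu_le
  have hr := radius_pos (μ := μ) (η := η) hI.R_pos k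
  have hrK := radius_pos (μ := μ) (η := η) hI.R_pos prm.K
  have hτ := clipLevel_pos (μ := μ) hI.eta_pos hI.R_pos k
  have hanti := radius_anti (μ := μ) (η := η) hI.mu_pos.le hI.eta_pos.le hI.R_pos.le
  have hK0 : (0 : ℝ) < prm.K := by exact_mod_cast hI.K_pos
  have hratio : radius μ R η prm.K / radius μ R η k ≤ 1 := (div_le_one hr).2 (hanti hk.le)
  obtain ⟨hmi, hm⟩ := hG.moment_snd hI.one_lt hI.sigma_nonneg hτ (pair q.1 q.2)
  have hqle := hI.noise_le k hk
  set v := 3 / (prm.K : ℝ) * (radius μ R η prm.K / radius μ R η k) with hv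
  have hv0 : 0 ≤ v := by positivity
  have hv3 : v ≤ 3 / (prm.K : ℝ) := mul_le_of_le_one_right (by positivity) hratio
  have key := integral_potential_step_le (P := P) (e := q.2 - argmax f q.1) hI.one_lt hI.le_two
    hI.mu_pos hI.mu_le hI.eta_pos hI.eta_mul_le hr (radius_succ μ R η k)
    (mul_clipLevel hI.eta_pos k)
    (measurable_snd_joint.comp (hG.measurable_section (pair q.1 q.2)))
    (hG.integrable_snd (pair q.1 q.2)) (hG.integral_snd (pair q.1 q.2)) hmi (hm.trans hqle) hv0
    (hv3.trans hI.div_K_le)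
    ((mul_le_mul_of_nonneg_left hv3 (div_nonneg hℓ.le hI.mu_pos.le)).trans hI.kappa_div_K_le)
    (hf.inner_gradient_ge_sq_dist hℓ hI.mu_pos q.1 q.2)
    (hf.inner_gradient_ge_sq_norm_gradient hℓ hI.mu_pos q.1 q.2)
  have heq : ∀ z, gap f (innerMap G η (clipLevel μ R η k) (q, z)) =
      ‖q.2 - argmax f q.1 + η • clip (G (pair q.1 q.2) z).snd (clipLevel μ R η k)‖ := by
    intro z
    rw [gap, innerMap]
    rw [sub_add_eq_add_sub]
  simp only [heq]
  obtain ⟨⟨h1, h2⟩, h3, h4⟩ := key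
  refine ⟨lintegral_ofReal_le h1 (fun z => escape_nonneg _ _) h2,
    lintegral_ofReal_le h3 (fun z => excess_nonneg _ _) (h4.trans ?_)⟩
  have : v * radius μ R η k ^ 2 = 3 / prm.K * (radius μ R η prm.K * radius μ R η k) := by
    rw [hv]; field_simp
  rw [gap, this]

/-- Expected value of the truncated potential. -/
noncomputable def escapeMean (Pr : Measure Ω) (f : Joint dx dy → ℝ)
    (G : Joint dx dy → Ξ → Joint dx dy) (prm : Params dx dy) (ξ : (ℕ × ℕ) ⊕ (ℕ × ℕ) → Ω → Ξ)
    (μ R η : ℝ) (t k : ℕ) : ENNReal :=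
  ∫⁻ ω, ENNReal.ofReal (escape (radius μ R η k) (gap f (innerState G prm ξ t k ω).pos)) ∂Pr

/-- Expected value of the squared excess distance. -/
noncomputable def excessMean (Pr : Measure Ω) (f : Joint dx dy → ℝ)
    (G : Joint dx dy → Ξ → Joint dx dy) (prm : Params dx dy) (ξ : (ℕ × ℕ) ⊕ (ℕ × ℕ) → Ω → Ξ)
    (μ R η : ℝ) (t k : ℕ) : ENNReal :=
  ∫⁻ ω, ENNReal.ofReal (excess (radius μ R η k) (gap f (innerState G prm ξ t k ω).pos)) ∂Pr

/-- Sample `(t, k)` is not in `before t k 0`, so the drift for fixed iterates can be integrated over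
the past. -/
theorem potentialMean_succ_le (hf : IsSmoothStronglyConcave ℓ μ f) (hG : IsPBCMOracle p σ f P G)
    (hI : InnerRegime p ℓ μ σ R η prm) (hlaw : ∀ i, MeasurePreserving (ξ i) Pr P)
    (hind : iIndepFun ξ Pr) (t : ℕ) {k : ℕ} (hk : k < prm.K) :
    escapeMean Pr f G prm ξ μ R η t (k + 1) ≤ escapeMean Pr f G prm ξ μ R η t k +
      ENNReal.ofReal (3 / prm.K * (radius μ R η prm.K / radius μ R η k)) ∧
    excessMean Pr f G prm ξ μ R η t (k + 1) ≤ excessMean Pr f G prm ξ μ R η t k +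
      ENNReal.ofReal (3 / prm.K * (radius μ R η prm.K * radius μ R η k)) *
        escapeMean Pr f G prm ξ μ R η t k := by
  have hℓ := hI.mu_pos.trans_le hI.mu_le
  have hrk := radius_pos (μ := μ) (η := η) hI.R_pos k
  have hrK := radius_pos (μ := μ) (η := η) hI.R_pos prm.K
  have hgap := measurable_gap_innerState (prm := prm) hf hG (fun i => (hlaw i).measurable) hℓ
    hI.mu_pos t k
  have hgm := hf.measurable_gap hℓ hI.mu_pos
  have hfresh : ∀ φ : ℝ → ℝ, Measurable φ →
      ∫⁻ ω, ENNReal.ofReal (φ (gap f (innerState G prm ξ t (k + 1) ω).pos)) ∂Pr =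
      ∫⁻ ω, ∫⁻ z, ENNReal.ofReal (φ (gap f (innerMap G η (clipLevel μ R η k)
        ((innerState G prm ξ t k ω).pos, z)))) ∂P ∂Pr := by
    intro φ hφ
    have h := lintegral_fresh_sample hlaw hind (S := before t k 0) (i := Sum.inl (t, k))
      (by rw [inl_mem_before]; omega) (measurable_innerState (prm := prm) hG t k)
      (F := fun q => ENNReal.ofReal (φ (gap f (innerMap G η (clipLevel μ R η k) q))))
      (ENNReal.measurable_ofReal.comp (hφ.comp (hgm.comp (measurable_innerMap hG _ _))))
    rw [← h]
    simp only [pos_innerState_succ, hI.etaY_eq, hI.tau_eq]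
  constructor
  · rw [escapeMean, hfresh _ (continuous_escape _).measurable]
    refine (lintegral_mono fun ω => (lintegral_innerMap_le hf hG hI hk _).1).trans_eq ?_
    simp_rw [ENNReal.ofReal_add (escape_nonneg _ _) (by positivity :
      0 ≤ 3 / (prm.K : ℝ) * (radius μ R η prm.K / radius μ R η k))]
    rw [lintegral_add_right _ measurable_const, lintegral_const, measure_univ, mul_one, escapeMean]
  · rw [excessMean, hfresh _ (continuous_excess _).measurable]
    refine (lintegral_mono fun ω => (lintegral_innerMap_le hf hG hI hk _).2).trans_eq ?_
    have hesc : Measurable fun ω => ENNReal.ofReal (escape (radius μ R η k)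
        (gap f (innerState G prm ξ t k ω).pos)) :=
      ENNReal.measurable_ofReal.comp ((continuous_escape _).measurable.comp hgap)
    simp_rw [ENNReal.ofReal_add (excess_nonneg _ _) (mul_nonneg (by positivity :
      0 ≤ 3 / (prm.K : ℝ) * (radius μ R η prm.K * radius μ R η k)) (escape_nonneg _ _)),
      ENNReal.ofReal_mul (by positivity :
      0 ≤ 3 / (prm.K : ℝ) * (radius μ R η prm.K * radius μ R η k))]
    rw [lintegral_add_right _ (hesc.const_mul _), lintegral_const_mul _ hesc, excessMean, escapeMean]

/-- The expected excess distance at the end of an inner loop. -/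
theorem excessMean_inner_le (hf : IsSmoothStronglyConcave ℓ μ f) (hG : IsPBCMOracle p σ f P G)
    (hI : InnerRegime p ℓ μ σ R η prm) (hlaw : ∀ i, MeasurePreserving (ξ i) Pr P)
    (hind : iIndepFun ξ Pr) (t : ℕ) :
    excessMean Pr f G prm ξ μ R η t prm.K ≤ excessMean Pr f G prm ξ μ R η t 0 +
      ENNReal.ofReal (3 * radius μ R η prm.K * R) * escapeMean Pr f G prm ξ μ R η t 0 +
      ENNReal.ofReal (9 * radius μ R η prm.K ^ 2) := by
  have hanti := radius_anti (μ := μ) (η := η) hI.mu_pos.le hI.eta_pos.le hI.R_pos.le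
  have hpos := fun k => radius_pos (μ := μ) (η := η) hI.R_pos k
  have hK0 : (0 : ℝ) < prm.K := by exact_mod_cast hI.K_pos
  set rK := radius μ R η prm.K with hrK
  have hrK0 : 0 < rK := hpos _
  -- As the radii decrease, every earlier increment is at most the bound with the current radius,
  -- which gives the factor `k`.
  have hesc : ∀ k ≤ prm.K, escapeMean Pr f G prm ξ μ R η t k ≤
      escapeMean Pr f G prm ξ μ R η t 0 +
        ENNReal.ofReal (3 / prm.K * k * (rK / radius μ R η k)) := by
    intro k hk
    induction k with
    | zero => simp
    | succ k ih =>
      have h0 := hpos k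
      have h1 := hpos (k + 1)
      have h2 : radius μ R η (k + 1) ≤ radius μ R η k := hanti (Nat.le_succ k)
      refine ((potentialMean_succ_le hf hG hI hlaw hind t (Nat.lt_of_succ_le hk)).1.trans
        (add_le_add_left (ih (Nat.le_of_succ_le hk)) _)).trans ?_
      rw [add_assoc, ← ENNReal.ofReal_add (by positivity) (by positivity)]
      gcongr
      have h3 : rK / radius μ R η k ≤ rK / radius μ R η (k + 1) := by gcongr
      have h4 : 3 / (prm.K : ℝ) * k * (rK / radius μ R η k) + 3 / prm.K * (rK / radius μ R η k) =
          3 / prm.K * (k + 1) * (rK / radius μ R η k) := by ring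
      rw [← hrK, h4]
      push_cast
      gcongr
  have hmain : ∀ k ≤ prm.K, excessMean Pr f G prm ξ μ R η t k ≤
      excessMean Pr f G prm ξ μ R η t 0 +
      ENNReal.ofReal (3 / prm.K * k * (rK * R)) * escapeMean Pr f G prm ξ μ R η t 0 +
      ENNReal.ofReal (9 / prm.K * k * rK ^ 2) := by
    intro k hk
    induction k with
    | zero => simp
    | succ k ih =>
      have h0 := hpos k
      have hR : radius μ R η k ≤ R := (hanti (Nat.zero_le k)).trans_eq (radius_zero _ _ _)
      have hkK : (k : ℝ) ≤ prm.K := by exact_mod_cast Nat.le_of_succ_le hk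
      have hR0 := hI.R_pos
      set e0 := escapeMean Pr f G prm ξ μ R η t 0
      have h1 : ENNReal.ofReal (3 / prm.K * (rK * radius μ R η k)) *
          escapeMean Pr f G prm ξ μ R η t k ≤
          ENNReal.ofReal (3 / prm.K * (rK * R)) * e0 + ENNReal.ofReal (9 / prm.K * rK ^ 2) := by
        refine (mul_le_mul_right (hesc k (Nat.le_of_succ_le hk)) _).trans ?_
        rw [mul_add, ← ENNReal.ofReal_mul (by positivity)]
        refine add_le_add (by gcongr) (ENNReal.ofReal_le_ofReal ?_)
        -- The intermediate radius cancels: noise of order `r_K r_k` meets an `escape` contribution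
        -- of order `r_K/r_k`, leaving `r_K²`.
        have h2 : 3 / (prm.K : ℝ) * (rK * radius μ R η k) *
            (3 / prm.K * k * (rK / radius μ R η k)) = 9 / prm.K * rK ^ 2 * (k / prm.K) := by
          field_simp; ring
        rw [h2]
        refine mul_le_of_le_one_right (by positivity) ?_
        rwa [div_le_one hK0]
      refine (potentialMean_succ_le hf hG hI hlaw hind t (Nat.lt_of_succ_le hk)).2.trans ?_
      refine (add_le_add (ih (Nat.le_of_succ_le hk)) h1).trans_eq ?_
      have h3 : (3 / prm.K * ((k + 1 : ℕ) : ℝ) * (rK * R)) =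
          3 / prm.K * k * (rK * R) + 3 / prm.K * (rK * R) := by push_cast; ring
      have h4 : (9 / prm.K * ((k + 1 : ℕ) : ℝ) * rK ^ 2) =
          9 / prm.K * k * rK ^ 2 + 9 / prm.K * rK ^ 2 := by push_cast; ring
      rw [h3, h4, ENNReal.ofReal_add (by positivity) (by positivity),
        ENNReal.ofReal_add (by positivity) (by positivity), add_mul]
      ring
  have h := hmain prm.K le_rfl
  have h5 : 3 / (prm.K : ℝ) * prm.K * (rK * R) = 3 * rK * R := by field_simp
  have h6 : 9 / (prm.K : ℝ) * prm.K * rK ^ 2 = 9 * rK ^ 2 := by field_simp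
  rwa [h5, h6] at h

end InnerLoop

/-- The decrease of the squared excess distance in one outer iteration. -/
noncomputable def decrease (R h : ℝ) : ℝ := min (h ^ 2) (R * h) / 2

theorem decrease_nonneg {R h : ℝ} (hR : 0 ≤ R) (hh : 0 ≤ h) : 0 ≤ decrease R h :=
  div_nonneg (le_min (sq_nonneg _) (mul_nonneg hR hh)) zero_le_two

theorem continuous_decrease (R : ℝ) : Continuous (decrease R) := by
  unfold decrease; fun_prop

/-- In the quadratic regime `h²/r + r ≥ 2h`; in the linear regime `R h/r ≥ h`. -/
theorem le_decrease {R h r : ℝ} (hr : 0 < r) (hrR : r ≤ R) (hh : 0 ≤ h) :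
    h ≤ 2 / r * decrease R h + r := by
  have h1 : 2 / r * decrease R h = min (h ^ 2) (R * h) / r := by
    unfold decrease; field_simp
  rw [h1, ← sub_le_iff_le_add, le_div_iff₀ hr]
  refine le_min ?_ ?_ <;> nlinarith [sq_nonneg (h - r)]

/-- The old loop is measured with the small radius `r`, the new one with `R`. This slack pays for
the shift `δ` of the maximizer, for the `escape` term and for `decrease`. -/
theorem excess_add_le {R r U D δ : ℝ} (hR : 0 < R) (hr : 0 < r) (hrR : r ≤ R / 100)
    (hδ : δ ≤ R / 100) (hD : D ≤ U + δ) :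
    excess R D + 3 * r * R * escape R D + decrease R (max 0 (U - 5 / 2 * r)) ≤ excess r U := by
  set h := max 0 (U - 5 / 2 * r) with hh
  have h0 : 0 ≤ h := le_max_left _ _
  have h1 : U ≤ h + 5 / 2 * r := by have := le_max_right 0 (U - 5 / 2 * r); linarith
  have hU : excess r U = h ^ 2 := rfl
  rw [hU]
  -- For `h ≤ R` the new loop starts within `5R/4`, where both potentials vanish. For `h > R`, the
  -- gap between `h²` and `(h - 2R)₊²` covers both `R h/2` and `3R²/100`.
  rcases le_or_gt h R with hc | hc
  · have h2 : D ≤ 5 / 4 * R := by linarith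
    rw [excess_eq_zero (by linarith), escape_eq_zero hR h2]
    have : decrease R h ≤ h ^ 2 / 2 := by
      unfold decrease
      gcongr
      exact min_le_left _ _
    nlinarith
  · have h2 : escape R D ≤ 1 := escape_le_one _ _
    have h3 : 3 * r * R * escape R D ≤ 3 * (R / 100) * R * 1 := by
      have := escape_nonneg R D
      gcongr
    have h4 : decrease R h ≤ R * h / 2 := by
      unfold decrease
      gcongr
      exact min_le_right _ _
    have h5 : excess R D ≤ max 0 (h - 2 * R) ^ 2 := by
      exact pow_le_pow_left₀ (le_max_left _ _) (max_le_max le_rfl (by linarith)) 2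
    rcases le_total (h - 2 * R) 0 with h6 | h6
    · rw [max_eq_left h6] at h5
      nlinarith
    · rw [max_eq_right h6] at h5
      nlinarith

/-! ### Tracking error over all outer iterations. -/

section Tracking

variable {dx dy : ℕ} {Ω Ξ : Type*} {p ℓ μ σ R η : ℝ} {f : Joint dx dy → ℝ}
  {G : Joint dx dy → Ξ → Joint dx dy} {prm : Params dx dy} {ξ : (ℕ × ℕ) ⊕ (ℕ × ℕ) → Ω → Ξ}

theorem norm_normalize_le {d : ℕ} (g : Vec d) : ‖‖g‖⁻¹ • g‖ ≤ 1 := by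
  rw [norm_smul, norm_inv, norm_norm]
  exact inv_mul_le_one

/-- The step in `x` leaves `y` fixed and moves the `κ`-Lipschitz maximizer. -/
theorem gap_randomRun_succ_le (hf : IsSmoothStronglyConcave ℓ μ f) (hℓ : 0 < ℓ) (hμ : 0 < μ)
    (hη : 0 ≤ prm.etaX) (t : ℕ) (ω : Ω) :
    gap f (randomRun G prm ξ (t + 1) ω).pos ≤
      gap f (innerState G prm ξ t prm.K ω).pos + ℓ / μ * prm.etaX := by
  set s := innerState G prm ξ t prm.K ω with hs
  set s' := randomRun G prm ξ (t + 1) ω with hs'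
  have hy : s'.y = s.y := rfl
  have hx : ‖s.x - s'.x‖ ≤ prm.etaX := by
    rw [hs', randomRun_succ, ← hs, normalizedStep]
    simp only [sub_sub_cancel, norm_smul _ (_ • _ : Vec dx), Real.norm_eq_abs, abs_of_nonneg hη]
    exact mul_le_of_le_one_right hη (norm_normalize_le _)
  have h1 := hf.norm_argmax_sub_le hℓ hμ s.x s'.x
  calc gap f s'.pos = ‖s.y - argmax f s.x + (argmax f s.x - argmax f s'.x)‖ := by
        rw [gap, State.pos, hy, sub_add_sub_cancel]
    _ ≤ ‖s.y - argmax f s.x‖ + ‖argmax f s.x - argmax f s'.x‖ := norm_add_le _ _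
    _ ≤ ‖s.y - argmax f s.x‖ + ℓ / μ * prm.etaX := by
        gcongr
        exact h1.trans (by gcongr)
    _ = _ := rfl

variable [mΩ : MeasurableSpace Ω] [mΞ : MeasurableSpace Ξ]
  {Pr : Measure Ω} [IsProbabilityMeasure Pr] {P : Measure Ξ} [IsProbabilityMeasure P]

/-- The tracking error, summed over `T` outer iterations. -/
theorem sum_lintegral_gap_le (hf : IsSmoothStronglyConcave ℓ μ f) (hG : IsPBCMOracle p σ f P G)
    (hI : InnerRegime p ℓ μ σ R η prm) (hlaw : ∀ i, MeasurePreserving (ξ i) Pr P)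
    (hind : iIndepFun ξ Pr) (hηX : 0 ≤ prm.etaX) (hδ : ℓ / μ * prm.etaX ≤ R / 100)
    (hrK : radius μ R η prm.K ≤ R / 100) (h0 : ‖prm.y₀ - argmax f prm.x₀‖ ≤ R) {T : ℕ}
    (hT : 1 ≤ T) :
    ∑ t ∈ Finset.range T,
      ∫⁻ ω, ENNReal.ofReal (gap f (innerState G prm ξ t prm.K ω).pos) ∂Pr ≤
      ENNReal.ofReal (40 * T * radius μ R η prm.K) := by
  have hℓ := hI.mu_pos.trans_le hI.mu_le
  have hR := hI.R_pos
  set r := radius μ R η prm.K with hr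
  have hr0 : 0 < r := radius_pos hI.R_pos _
  set U : ℕ → Ω → ℝ := fun t ω => gap f (innerState G prm ξ t prm.K ω).pos with hU
  have hmU : ∀ t, Measurable (U t) := fun t =>
    measurable_gap_innerState hf hG (fun i => (hlaw i).measurable) hℓ hI.mu_pos t prm.K
  have hmD : ∀ t, Measurable fun ω => gap f (innerState G prm ξ t 0 ω).pos := fun t =>
    measurable_gap_innerState hf hG (fun i => (hlaw i).measurable) hℓ hI.mu_pos t 0
  set ψ : ℕ → Ω → ℝ := fun t ω => decrease R (max 0 (U t ω - 5 / 2 * r)) with hψ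
  have hψ0 : ∀ t ω, 0 ≤ ψ t ω := fun t ω => decrease_nonneg hR.le (le_max_left _ _)
  have hmψ : ∀ t, Measurable (ψ t) := fun t =>
    (continuous_decrease R).measurable.comp (measurable_const.max ((hmU t).sub_const _))
  have hmψ' : ∀ t, Measurable fun ω => ENNReal.ofReal (ψ t ω) := fun t =>
    ENNReal.measurable_ofReal.comp (hmψ t)
  set H : ℕ → ENNReal := fun t => excessMean Pr f G prm ξ μ R η t prm.K with hH
  -- The first loop starts within `R`, where both potentials vanish.
  have hH0 : H 0 ≤ ENNReal.ofReal (9 * r ^ 2) := by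
    refine (excessMean_inner_le hf hG hI hlaw hind 0).trans ?_
    have h1 : excessMean Pr f G prm ξ μ R η 0 0 = 0 := by
      rw [excessMean]
      have : ∀ ω, excess (radius μ R η 0) (gap f (innerState G prm ξ 0 0 ω).pos) = 0 := by
        intro ω
        rw [radius_zero]
        exact excess_eq_zero (h0.trans (by linarith))
      simp [this]
    have h2 : escapeMean Pr f G prm ξ μ R η 0 0 = 0 := by
      rw [escapeMean]
      have : ∀ ω, escape (radius μ R η 0) (gap f (innerState G prm ξ 0 0 ω).pos) = 0 := by
        intro ω
        rw [radius_zero]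
        exact escape_eq_zero hR (h0.trans (by linarith))
      simp [this]
    rw [h1, h2]
    simp [hr]
  have hstep : ∀ t, H (t + 1) + ∫⁻ ω, ENNReal.ofReal (ψ t ω) ∂Pr ≤
      H t + ENNReal.ofReal (9 * r ^ 2) := by
    intro t
    have h1 := excessMean_inner_le hf hG hI hlaw hind (t + 1)
    rw [← hr] at h1
    have hm1 : Measurable fun ω => ENNReal.ofReal
        (excess R (gap f (innerState G prm ξ (t + 1) 0 ω).pos)) :=
      ENNReal.measurable_ofReal.comp ((continuous_excess _).measurable.comp (hmD _))
    have hm2 : Measurable fun ω => ENNReal.ofReal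
        (escape R (gap f (innerState G prm ξ (t + 1) 0 ω).pos)) :=
      ENNReal.measurable_ofReal.comp ((continuous_escape _).measurable.comp (hmD _))
    have h2 : excessMean Pr f G prm ξ μ R η (t + 1) 0 +
        ENNReal.ofReal (3 * r * R) * escapeMean Pr f G prm ξ μ R η (t + 1) 0 +
        ∫⁻ ω, ENNReal.ofReal (ψ t ω) ∂Pr ≤ H t := by
      rw [excessMean, escapeMean, radius_zero, ← lintegral_const_mul _ hm2, ← lintegral_add_left hm1,
        ← lintegral_add_right _ (hmψ' t)]
      refine lintegral_mono fun ω => ?_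
      rw [← ENNReal.ofReal_mul (by positivity), ← ENNReal.ofReal_add (excess_nonneg _ _)
        (mul_nonneg (by positivity) (escape_nonneg _ _)), ← ENNReal.ofReal_add
        (add_nonneg (excess_nonneg _ _) (mul_nonneg (by positivity) (escape_nonneg _ _)))
        (hψ0 t ω)]
      exact ENNReal.ofReal_le_ofReal (excess_add_le hR hr0 hrK hδ
        (gap_randomRun_succ_le hf hℓ hI.mu_pos hηX t ω))
    calc H (t + 1) + ∫⁻ ω, ENNReal.ofReal (ψ t ω) ∂Pr
        ≤ _ := add_le_add_left h1 _
      _ = excessMean Pr f G prm ξ μ R η (t + 1) 0 +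
        ENNReal.ofReal (3 * r * R) * escapeMean Pr f G prm ξ μ R η (t + 1) 0 +
        ∫⁻ ω, ENNReal.ofReal (ψ t ω) ∂Pr + ENNReal.ofReal (9 * r ^ 2) := by ring
      _ ≤ _ := add_le_add_left h2 _
  have hsum : ∀ n : ℕ, H n + ∑ t ∈ Finset.range n, ∫⁻ ω, ENNReal.ofReal (ψ t ω) ∂Pr ≤
      ENNReal.ofReal (9 * (n + 1) * r ^ 2) := by
    intro n
    induction n with
    | zero => simpa using hH0
    | succ n ih =>
      rw [Finset.sum_range_succ]
      calc H (n + 1) + (∑ t ∈ Finset.range n, ∫⁻ ω, ENNReal.ofReal (ψ t ω) ∂Pr +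
            ∫⁻ ω, ENNReal.ofReal (ψ n ω) ∂Pr)
          = (H (n + 1) + ∫⁻ ω, ENNReal.ofReal (ψ n ω) ∂Pr) +
            ∑ t ∈ Finset.range n, ∫⁻ ω, ENNReal.ofReal (ψ t ω) ∂Pr := by ring
        _ ≤ H n + ENNReal.ofReal (9 * r ^ 2) +
            ∑ t ∈ Finset.range n, ∫⁻ ω, ENNReal.ofReal (ψ t ω) ∂Pr := add_le_add_left (hstep n) _
        _ = (H n + ∑ t ∈ Finset.range n, ∫⁻ ω, ENNReal.ofReal (ψ t ω) ∂Pr) +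
            ENNReal.ofReal (9 * r ^ 2) := by ring
        _ ≤ ENNReal.ofReal (9 * (n + 1) * r ^ 2) + ENNReal.ofReal (9 * r ^ 2) :=
            add_le_add_left ih _
        _ = ENNReal.ofReal (9 * ((n + 1 : ℕ) + 1) * r ^ 2) := by
            rw [← ENNReal.ofReal_add (by positivity) (by positivity)]
            congr 1
            push_cast
            ring
  have hpt : ∀ t, ∫⁻ ω, ENNReal.ofReal (U t ω) ∂Pr ≤
      ENNReal.ofReal (2 / r) * ∫⁻ ω, ENNReal.ofReal (ψ t ω) ∂Pr + ENNReal.ofReal (7 / 2 * r) := by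
    intro t
    have h1 : ∀ ω, ENNReal.ofReal (U t ω) ≤ ENNReal.ofReal (2 / r) * ENNReal.ofReal (ψ t ω) +
        ENNReal.ofReal (7 / 2 * r) := by
      intro ω
      have := hψ0 t ω
      rw [← ENNReal.ofReal_mul (by positivity), ← ENNReal.ofReal_add (by positivity) (by positivity)]
      refine ENNReal.ofReal_le_ofReal ?_
      have h2 := le_decrease hr0 (by linarith : r ≤ R) (le_max_left 0 (U t ω - 5 / 2 * r))
      have h3 := le_max_right 0 (U t ω - 5 / 2 * r)
      have h4 : ψ t ω = decrease R (max 0 (U t ω - 5 / 2 * r)) := rfl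
      rw [h4]
      linarith
    refine (lintegral_mono h1).trans_eq ?_
    rw [lintegral_add_right _ measurable_const, lintegral_const_mul _ (hmψ' t), lintegral_const,
      measure_univ, mul_one]
  calc ∑ t ∈ Finset.range T, ∫⁻ ω, ENNReal.ofReal (U t ω) ∂Pr
      ≤ ∑ t ∈ Finset.range T, (ENNReal.ofReal (2 / r) * ∫⁻ ω, ENNReal.ofReal (ψ t ω) ∂Pr +
        ENNReal.ofReal (7 / 2 * r)) := Finset.sum_le_sum fun t _ => hpt t
    _ = ENNReal.ofReal (2 / r) * ∑ t ∈ Finset.range T, ∫⁻ ω, ENNReal.ofReal (ψ t ω) ∂Pr +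
        ENNReal.ofReal (T * (7 / 2 * r)) := by
        rw [Finset.sum_add_distrib, ← Finset.mul_sum, Finset.sum_const, Finset.card_range,
          nsmul_eq_mul, ENNReal.ofReal_mul (Nat.cast_nonneg T), ENNReal.ofReal_natCast]
    _ ≤ ENNReal.ofReal (2 / r) * ENNReal.ofReal (9 * (T + 1) * r ^ 2) +
        ENNReal.ofReal (T * (7 / 2 * r)) := by
        gcongr
        exact le_trans le_add_self (hsum T)
    -- Here `18(T + 1) + 7T/2 ≤ 40T` because `T ≥ 1`.
    _ ≤ ENNReal.ofReal (40 * T * r) := by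
        rw [← ENNReal.ofReal_mul (by positivity), ← ENNReal.ofReal_add (by positivity)
          (by positivity)]
        refine ENNReal.ofReal_le_ofReal ?_
        have h1 : 2 / r * (9 * ((T : ℝ) + 1) * r ^ 2) = 18 * (T + 1) * r := by field_simp; ring
        have h2 : (1 : ℝ) ≤ T := by exact_mod_cast hT
        rw [h1]
        nlinarith

end Tracking

/-! ### Minibatch averages with a finite `p`-th moment. -/

section Minibatch

/-- For `‖b‖ ≤ ‖a‖`, write `‖a + b‖^p` as a power `p/2 ≤ 1` of the squared norm and use Bernoulli's
inequality; otherwise all terms are controlled by `‖b‖^p`. The linear term is kept because it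
vanishes in the mean for centred `b`. -/
theorem norm_add_rpow_le {E : Type*} [NormedAddCommGroup E] [InnerProductSpace ℝ E] {p : ℝ}
    (hp : 1 < p) (hp2 : p ≤ 2) (a b : E) :
    ‖a + b‖ ^ p ≤ ‖a‖ ^ p + p * ‖a‖ ^ (p - 2) * ⟪a, b⟫ + 6 * ‖b‖ ^ p := by
  have hp0 : 0 < p := by linarith
  rcases eq_or_ne a 0 with rfl | ha
  · have : 0 ≤ ‖b‖ ^ p := by positivity
    simp only [zero_add, norm_zero, inner_zero_left, mul_zero, add_zero,
      Real.zero_rpow hp0.ne']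
    linarith
  have ha0 : 0 < ‖a‖ := norm_pos_iff.2 ha
  have hin := abs_le.1 (abs_real_inner_le_norm a b)
  have hsplit : ‖a‖ ^ (p - 2) * ‖a‖ ^ 2 = ‖a‖ ^ p := by
    rw [← Real.rpow_natCast, ← Real.rpow_add ha0]; norm_num
  have hsplit1 : ‖a‖ ^ (p - 2) * ‖a‖ = ‖a‖ ^ (p - 1) := by
    conv_lhs => rw [← Real.rpow_one ‖a‖, ← Real.rpow_mul ha0.le, one_mul, ← Real.rpow_add ha0]
    congr 1; ring
  rcases le_total ‖b‖ ‖a‖ with hab | hab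
  · set s := (2 * ⟪a, b⟫ + ‖b‖ ^ 2) / ‖a‖ ^ 2 with hs
    have hsq : ‖a + b‖ ^ 2 = ‖a‖ ^ 2 * (1 + s) := by
      rw [norm_add_sq_real, hs]; field_simp; ring
    have hs1 : -1 ≤ s := by
      have : 0 ≤ ‖a‖ ^ 2 * (1 + s) := by rw [← hsq]; positivity
      have := nonneg_of_mul_nonneg_right this (by positivity : 0 < ‖a‖ ^ 2)
      linarith
    have h1 : ‖a + b‖ ^ p = ‖a‖ ^ p * (1 + s) ^ (p / 2) := by
      have h2 : ∀ c : ℝ, 0 ≤ c → (c ^ 2) ^ (p / 2) = c ^ p := by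
        intro c hc
        rw [← Real.rpow_natCast, ← Real.rpow_mul hc]
        congr 1; push_cast; ring
      rw [← h2 _ (norm_nonneg _), hsq, Real.mul_rpow (by positivity) (by linarith),
        h2 _ (norm_nonneg _)]
    have h3 := rpow_one_add_le_one_add_mul_self hs1 (by positivity : 0 ≤ p / 2) (by linarith)
    have h4 : ‖a‖ ^ p * (1 + p / 2 * s) =
        ‖a‖ ^ p + p * ‖a‖ ^ (p - 2) * ⟪a, b⟫ + p / 2 * (‖a‖ ^ (p - 2) * ‖b‖ ^ 2) := by
      rw [← hsplit, hs]; field_simp; ring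
    have h5 : ‖a‖ ^ (p - 2) * ‖b‖ ^ 2 ≤ ‖b‖ ^ p := by
      rcases (norm_nonneg b).eq_or_lt with hb | hb
      · rw [← hb, Real.zero_rpow hp0.ne']; simp
      · have h6 : ‖b‖ ^ (p - 2) * ‖b‖ ^ 2 = ‖b‖ ^ p := by
          rw [← Real.rpow_natCast, ← Real.rpow_add hb]; norm_num
        rw [← h6]
        gcongr ?_ * _
        exact Real.rpow_le_rpow_of_nonpos hb hab (by linarith)
    have h7 : 0 ≤ ‖b‖ ^ p := by positivity
    have h8 : 0 ≤ ‖a‖ ^ (p - 2) * ‖b‖ ^ 2 := by positivity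
    calc ‖a + b‖ ^ p = ‖a‖ ^ p * (1 + s) ^ (p / 2) := h1
      _ ≤ ‖a‖ ^ p * (1 + p / 2 * s) := by gcongr
      _ ≤ _ := by rw [h4]; nlinarith
  -- The constant `6` is `4 + 2`: `2^p ≤ 4` for the power of the sum, and `2` for the linear term.
  · have hb0 : 0 < ‖b‖ := ha0.trans_le hab
    have h1 : ‖a + b‖ ^ p ≤ 4 * ‖b‖ ^ p := by
      calc ‖a + b‖ ^ p ≤ (2 * ‖b‖) ^ p := by
            refine Real.rpow_le_rpow (norm_nonneg _) ?_ hp0.le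
            linarith [norm_add_le a b]
        _ = 2 ^ p * ‖b‖ ^ p := Real.mul_rpow (by norm_num) hb0.le
        _ ≤ 4 * ‖b‖ ^ p := by
            gcongr
            calc (2 : ℝ) ^ p ≤ 2 ^ (2 : ℝ) :=
                  Real.rpow_le_rpow_of_exponent_le (by norm_num) hp2
              _ = 4 := by norm_num
    have h2 : ‖a‖ ^ (p - 1) * ‖b‖ ≤ ‖b‖ ^ p := by
      calc ‖a‖ ^ (p - 1) * ‖b‖ ≤ ‖b‖ ^ (p - 1) * ‖b‖ := by
            gcongr
        _ = ‖b‖ ^ p := by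
            rw [← Real.rpow_add_one hb0.ne']; congr 1; ring
    have h3 : -(2 * ‖b‖ ^ p) ≤ p * ‖a‖ ^ (p - 2) * ⟪a, b⟫ := by
      have h4 : 0 ≤ ‖a‖ ^ (p - 2) := by positivity
      have h5 : ‖a‖ ^ (p - 2) * -(‖a‖ * ‖b‖) ≤ ‖a‖ ^ (p - 2) * ⟪a, b⟫ := by
        gcongr; exact hin.1
      have h6 : ‖a‖ ^ (p - 2) * -(‖a‖ * ‖b‖) = -(‖a‖ ^ (p - 1) * ‖b‖) := by
        rw [← hsplit1]; ring
      have h7 : 0 ≤ ‖b‖ ^ p := by positivity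
      nlinarith
    have h8 : 0 ≤ ‖a‖ ^ p := by positivity
    linarith

variable {dx dy : ℕ} {Ω Ξ : Type*} [mΩ : MeasurableSpace Ω] [mΞ : MeasurableSpace Ξ]
  {Pr : Measure Ω} [IsProbabilityMeasure Pr] {P : Measure Ξ} [IsProbabilityMeasure P]
  {p σ : ℝ} {f : Joint dx dy → ℝ}
  {G : Joint dx dy → Ξ → Joint dx dy} {prm : Params dx dy} {ξ : (ℕ × ℕ) ⊕ (ℕ × ℕ) → Ω → Ξ}

theorem lintegral_norm_add_noise_rpow_le (hG : IsPBCMOracle p σ f P G) (hp : 1 < p) (hp2 : p ≤ 2)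
    (hσ : 0 ≤ σ) (z : Joint dx dy) (a : Vec dx) :
    ∫⁻ ζ, ENNReal.ofReal (‖a + ((G z ζ).fst - (∇ f z).fst)‖ ^ p) ∂P ≤
      ENNReal.ofReal (‖a‖ ^ p + 6 * σ ^ p) := by
  obtain ⟨hmi, hm⟩ := hG.moment_fst hp hσ z
  have hc : Integrable (fun ζ => (G z ζ).fst - (∇ f z).fst) P :=
    (hG.integrable_fst z).sub (integrable_const _)
  have hc0 : ∫ ζ, ((G z ζ).fst - (∇ f z).fst) ∂P = 0 := by
    rw [integral_sub (hG.integrable_fst z) (integrable_const _), hG.integral_fst]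
    simp
  have hin : Integrable (fun ζ => ⟪a, (G z ζ).fst - (∇ f z).fst⟫) P := hc.const_inner a
  have h1 : Integrable (fun ζ => ‖a‖ ^ p +
      p * ‖a‖ ^ (p - 2) * ⟪a, (G z ζ).fst - (∇ f z).fst⟫) P :=
    (integrable_const _).add (hin.const_mul _)
  refine (lintegral_mono fun ζ => ENNReal.ofReal_le_ofReal (norm_add_rpow_le hp hp2 a _)).trans ?_
  refine lintegral_ofReal_le (h1.add (hmi.const_mul 6)) (fun ζ => ?_) ?_
  · exact le_trans (by positivity) (norm_add_rpow_le hp hp2 a ((G z ζ).fst - (∇ f z).fst))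
  · rw [integral_add h1 (hmi.const_mul 6), integral_add (integrable_const _) (hin.const_mul _),
      integral_const_mul, integral_inner hc, hc0, integral_const_mul]
    simp only [integral_const, probReal_univ, smul_eq_mul, one_mul, inner_zero_right, mul_zero,
      add_zero]
    linarith

/-- Given the past, the next summand is centred, so the `p`-th moment grows by at most `6σ^p` per
sample. -/
theorem lintegral_batchSum_rpow_le (hf : Continuous fun z : Joint dx dy => (∇ f z).fst)
    (hG : IsPBCMOracle p σ f P G) (hp : 1 < p) (hp2 : p ≤ 2)
    (hσ : 0 ≤ σ) (hlaw : ∀ i, MeasurePreserving (ξ i) Pr P)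
    (hind : iIndepFun ξ Pr) (t n : ℕ) :
    ∫⁻ ω, ENNReal.ofReal (‖batchSum G prm ξ t n ω - (n : ℝ) •
      (∇ f (pair (innerState G prm ξ t prm.K ω).pos.1 (innerState G prm ξ t prm.K ω).pos.2)).fst‖
        ^ p) ∂Pr ≤ ENNReal.ofReal (n * (6 * σ ^ p)) := by
  have hgm : Measurable fun q : Vec dx × Vec dy => (∇ f (pair q.1 q.2)).fst :=
    (hf.comp continuous_pair).measurable
  induction n with
  | zero => simp [batchSum, Real.zero_rpow (by linarith : p ≠ 0)]
  | succ n ih =>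
    have hmS := measurable_batchSum (prm := prm) (ξ := ξ) hG t n
    have h := lintegral_fresh_sample hlaw hind (S := before t prm.K n) (i := Sum.inr (t, n))
      (by rw [inr_mem_before]; omega) hmS
      (F := fun q => ENNReal.ofReal (‖(q.1.2 - (n : ℝ) • (∇ f (pair q.1.1.1 q.1.1.2)).fst) +
        ((G (pair q.1.1.1 q.1.1.2) q.2).fst - (∇ f (pair q.1.1.1 q.1.1.2)).fst)‖ ^ p)) (by
        have h1 : Measurable fun q : ((Vec dx × Vec dy) × Vec dx) × Ξ =>
            (∇ f (pair q.1.1.1 q.1.1.2)).fst := hgm.comp (measurable_fst.comp measurable_fst)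
        have h2 : Measurable fun q : ((Vec dx × Vec dy) × Vec dx) × Ξ =>
            (G (pair q.1.1.1 q.1.1.2) q.2).fst :=
          (measurable_fst_joint.comp hG.measurable_pair_left).comp
            ((measurable_fst.comp measurable_fst).prodMk measurable_snd)
        fun_prop)
    have hb : ∀ q : (Vec dx × Vec dy) × Vec dx,
        ∫⁻ ζ, ENNReal.ofReal (‖(q.2 - (n : ℝ) • (∇ f (pair q.1.1 q.1.2)).fst) +
          ((G (pair q.1.1 q.1.2) ζ).fst - (∇ f (pair q.1.1 q.1.2)).fst)‖ ^ p) ∂P ≤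
        ENNReal.ofReal (‖q.2 - (n : ℝ) • (∇ f (pair q.1.1 q.1.2)).fst‖ ^ p) +
          ENNReal.ofReal (6 * σ ^ p) := by
      intro q
      rw [← ENNReal.ofReal_add (by positivity) (by positivity)]
      exact lintegral_norm_add_noise_rpow_le hG hp hp2 hσ _ _
    have heq : ∀ ω, batchSum G prm ξ t (n + 1) ω - ((n + 1 : ℕ) : ℝ) •
        (∇ f (pair (innerState G prm ξ t prm.K ω).pos.1
          (innerState G prm ξ t prm.K ω).pos.2)).fst =
        (batchSum G prm ξ t n ω - (n : ℝ) • (∇ f (pair (innerState G prm ξ t prm.K ω).pos.1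
          (innerState G prm ξ t prm.K ω).pos.2)).fst) +
        ((G (pair (innerState G prm ξ t prm.K ω).pos.1 (innerState G prm ξ t prm.K ω).pos.2)
          (ξ (Sum.inr (t, n)) ω)).fst - (∇ f (pair (innerState G prm ξ t prm.K ω).pos.1
          (innerState G prm ξ t prm.K ω).pos.2)).fst) := by
      intro ω
      rw [batchSum_succ]
      push_cast
      rw [add_smul, one_smul]
      abel
    simp_rw [heq]
    refine h.trans_le ((lintegral_mono fun ω =>
      hb ((innerState G prm ξ t prm.K ω).pos, batchSum G prm ξ t n ω)).trans ?_)
    rw [lintegral_add_right _ measurable_const, lintegral_const, measure_univ, mul_one]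
    refine (add_le_add_left ih _).trans_eq ?_
    rw [← ENNReal.ofReal_add (by positivity) (by positivity)]
    congr 1
    push_cast
    ring

/-- Passes from a `p`-th moment to a first moment pointwise, with a free level `l`. -/
theorem le_add_rpow_div {p s l : ℝ} (hp : 1 < p) (hs : 0 ≤ s) (hl : 0 < l) :
    s ≤ l + s ^ p / l ^ (p - 1) := by
  have h0 : 0 ≤ s ^ p / l ^ (p - 1) := by positivity
  rcases le_total s l with h | h
  · linarith
  · have hs0 : 0 < s := hl.trans_le h
    have : s ≤ s ^ p / l ^ (p - 1) := by
      rw [le_div_iff₀ (by positivity)]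
      calc s * l ^ (p - 1) ≤ s * s ^ (p - 1) := by
            gcongr
        _ = s ^ p := by rw [mul_comm, ← Real.rpow_add_one hs0.ne']; congr 1; ring
    linarith

/-- The constant in front of the batch size. -/
noncomputable def batchConst (p : ℝ) : ℝ := 20 * (120 : ℝ) ^ (1 / (p - 1))

/-- The expected error of the minibatch gradient. -/
theorem lintegral_minibatch_le (hf : Continuous fun z : Joint dx dy => (∇ f z).fst)
    (hG : IsPBCMOracle p σ f P G) (hp : 1 < p) (hp2 : p ≤ 2)
    (hσ : 0 ≤ σ) {ε : ℝ} (hε : 0 < ε) (hM : prm.M = batchSize (batchConst p) p ε σ)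
    (hlaw : ∀ i, MeasurePreserving (ξ i) Pr P) (hind : iIndepFun ξ Pr) (t : ℕ) :
    ∫⁻ ω, ENNReal.ofReal ‖minibatch G prm.M (fun i => ξ (Sum.inr (t, i)) ω)
        (innerState G prm ξ t prm.K ω) - (∇ f (pair (innerState G prm ξ t prm.K ω).x
          (innerState G prm ξ t prm.K ω).y)).fst‖ ∂Pr ≤ ENNReal.ofReal (ε / 10) := by
  have hM1 : (1 : ℝ) ≤ prm.M := by
    rw [hM, batchSize]; exact_mod_cast le_max_left _ _
  have hM0 : (0 : ℝ) < prm.M := by linarith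
  have hMle : batchConst p * (σ / ε) ^ (p / (p - 1)) ≤ prm.M := by
    rw [hM, batchSize]
    exact (Nat.le_ceil _).trans (by exact_mod_cast le_max_right _ _)
  have hp1 : 0 < p - 1 := by linarith
  -- The level will be `l = Mε/20`. With `120 = 6 · 20` in `batchConst`, the moment term contributes
  -- at most another `ε/20`.
  have hlarge : 6 * σ ^ p ≤ ε / 20 * ((prm.M : ℝ) * (ε / 20)) ^ (p - 1) := by
    have h1 : (batchConst p * (σ / ε) ^ (p / (p - 1)) * (ε / 20)) ^ (p - 1) ≤
        ((prm.M : ℝ) * (ε / 20)) ^ (p - 1) := by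
      refine Real.rpow_le_rpow ?_ (by gcongr) hp1.le
      unfold batchConst
      positivity
    have h2 : batchConst p * (σ / ε) ^ (p / (p - 1)) * (ε / 20) =
        120 ^ (1 / (p - 1)) * (σ / ε) ^ (p / (p - 1)) * ε := by
      unfold batchConst; ring
    have h3 : (120 ^ (1 / (p - 1)) * (σ / ε) ^ (p / (p - 1)) * ε) ^ (p - 1) =
        120 * (σ / ε) ^ p * ε ^ (p - 1) := by
      rw [Real.mul_rpow (by positivity) hε.le, Real.mul_rpow (by positivity) (by positivity),
        ← Real.rpow_mul (by norm_num), ← Real.rpow_mul (by positivity),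
        div_mul_cancel₀ _ hp1.ne', div_mul_cancel₀ _ hp1.ne', Real.rpow_one]
    have h4 : ε / 20 * (120 * (σ / ε) ^ p * ε ^ (p - 1)) = 6 * σ ^ p := by
      have h5 : ε * ε ^ (p - 1) = ε ^ p := by
        rw [mul_comm, ← Real.rpow_add_one hε.ne']; congr 1; ring
      have h6 : 0 < ε ^ p := by positivity
      rw [Real.div_rpow hσ hε.le]
      calc ε / 20 * (120 * (σ ^ p / ε ^ p) * ε ^ (p - 1))
          = 6 * (σ ^ p / ε ^ p) * (ε * ε ^ (p - 1)) := by ring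
        _ = 6 * σ ^ p := by rw [h5]; field_simp
    rw [h2, h3] at h1
    rw [← h4]
    gcongr
  have hpt : ∀ ω, ‖minibatch G prm.M (fun i => ξ (Sum.inr (t, i)) ω)
      (innerState G prm ξ t prm.K ω) - (∇ f (pair (innerState G prm ξ t prm.K ω).x
        (innerState G prm ξ t prm.K ω).y)).fst‖ ≤ ε / 20 +
      ‖batchSum G prm ξ t prm.M ω - (prm.M : ℝ) •
      (∇ f (pair (innerState G prm ξ t prm.K ω).pos.1
        (innerState G prm ξ t prm.K ω).pos.2)).fst‖ ^ p *
        (1 / (prm.M * ((prm.M : ℝ) * (ε / 20)) ^ (p - 1))) := by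
    intro ω
    set g := (∇ f (pair (innerState G prm ξ t prm.K ω).x (innerState G prm ξ t prm.K ω).y)).fst
      with hg
    have h1 : minibatch G prm.M (fun i => ξ (Sum.inr (t, i)) ω) (innerState G prm ξ t prm.K ω) - g =
        (prm.M : ℝ)⁻¹ • (batchSum G prm ξ t prm.M ω - (prm.M : ℝ) • g) := by
      rw [smul_sub, inv_smul_smul₀ hM0.ne']
      rfl
    have h2 : (∇ f (pair (innerState G prm ξ t prm.K ω).pos.1
        (innerState G prm ξ t prm.K ω).pos.2)).fst = g := rfl
    rw [h1, h2, norm_smul, norm_inv, Real.norm_eq_abs, abs_of_pos hM0]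
    set s := ‖batchSum G prm ξ t prm.M ω - (prm.M : ℝ) • g‖
    have h3 := le_add_rpow_div hp (norm_nonneg _ : 0 ≤ s)
      (by positivity : 0 < (prm.M : ℝ) * (ε / 20))
    calc (prm.M : ℝ)⁻¹ * s ≤ (prm.M : ℝ)⁻¹ * (prm.M * (ε / 20) +
          s ^ p / ((prm.M : ℝ) * (ε / 20)) ^ (p - 1)) := by gcongr
      _ = _ := by
        have : 0 < ((prm.M : ℝ) * (ε / 20)) ^ (p - 1) := by positivity
        field_simp
  have hc : 0 ≤ 1 / (prm.M * ((prm.M : ℝ) * (ε / 20)) ^ (p - 1)) := by positivity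
  refine (lintegral_mono fun ω => ENNReal.ofReal_le_ofReal (hpt ω)).trans ?_
  simp_rw [ENNReal.ofReal_add (by positivity : 0 ≤ ε / 20)
    (mul_nonneg (Real.rpow_nonneg (norm_nonneg _) p) hc),
    ENNReal.ofReal_mul (Real.rpow_nonneg (norm_nonneg _) p)]
  rw [lintegral_add_left measurable_const, lintegral_const, measure_univ, mul_one,
    lintegral_mul_const' _ _ ENNReal.ofReal_ne_top]
  refine (add_le_add_right (mul_le_mul_left
    (lintegral_batchSum_rpow_le hf hG hp hp2 hσ hlaw hind t prm.M) _) _).trans ?_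
  rw [← ENNReal.ofReal_mul (by positivity), ← ENNReal.ofReal_add (by positivity) (by positivity)]
  refine ENNReal.ofReal_le_ofReal ?_
  have : (prm.M : ℝ) * (6 * σ ^ p) * (1 / (prm.M * ((prm.M : ℝ) * (ε / 20)) ^ (p - 1))) ≤
      ε / 20 := by
    rw [mul_one_div, div_le_iff₀ (by positivity)]
    calc (prm.M : ℝ) * (6 * σ ^ p) ≤ prm.M * (ε / 20 * ((prm.M : ℝ) * (ε / 20)) ^ (p - 1)) := by
          gcongr
      _ = _ := by ring
  linarith

end Minibatch

/-! ### Normalized descent on `Φ` and the random output index. -/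

section Outer

variable {dx dy : ℕ} {Ω Ξ : Type*} {p ℓ μ σ R η : ℝ} {f : Joint dx dy → ℝ}
  {G : Joint dx dy → Ξ → Joint dx dy} {prm : Params dx dy} {ξ : (ℕ × ℕ) ⊕ (ℕ × ℕ) → Ω → Ξ}

theorem IsSmoothStronglyConcave.continuous_gradient_fst (hf : IsSmoothStronglyConcave ℓ μ f)
    (hℓ : 0 < ℓ) : Continuous fun z : Joint dx dy => (∇ f z).fst := by
  refine (LipschitzWith.of_dist_le_mul (K := ℓ.toNNReal) fun z w => ?_).continuous
  rw [dist_eq_norm, dist_eq_norm, Real.coe_toNNReal _ hℓ.le, ← fst_sub]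
  exact (norm_fst_le _).trans (hf.smooth z w)

/-- The error of the minibatch gradient in outer iteration `t`. -/
noncomputable def batchError (f : Joint dx dy → ℝ) (G : Joint dx dy → Ξ → Joint dx dy)
    (prm : Params dx dy) (ξ : (ℕ × ℕ) ⊕ (ℕ × ℕ) → Ω → Ξ) (t : ℕ) (ω : Ω) : ℝ :=
  ‖minibatch G prm.M (fun i => ξ (Sum.inr (t, i)) ω) (innerState G prm ξ t prm.K ω) -
    (∇ f (pair (innerState G prm ξ t prm.K ω).x (innerState G prm ξ t prm.K ω).y)).fst‖

/-- The gradient is taken at the new point, since the output ranges over `x_1, …, x_T`. Moving it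
there costs `2κℓη` by Lipschitz continuity, which raises `5/2` to `9/2`. -/
theorem outer_step_le (hf : IsSmoothStronglyConcave ℓ μ f) (hμ : 0 < μ) (hμℓ : μ ≤ ℓ)
    (hη : 0 ≤ prm.etaX) (t : ℕ) (ω : Ω) :
    primal f (randomRun G prm ξ (t + 1) ω).x +
        prm.etaX * ‖∇ (primal f) (randomRun G prm ξ (t + 1) ω).x‖ ≤
      primal f (randomRun G prm ξ t ω).x +
        prm.etaX * (2 * (batchError f G prm ξ t ω +
          ℓ * gap f (innerState G prm ξ t prm.K ω).pos) + 9 / 2 * (ℓ / μ * ℓ * prm.etaX)) := by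
  have hℓ := hμ.trans_le hμℓ
  have hx := innerState_x (G := G) (prm := prm) (ξ := ξ) t prm.K ω
  set s := innerState G prm ξ t prm.K ω with hs
  set g := minibatch G prm.M (fun i => ξ (Sum.inr (t, i)) ω) s with hg
  have hx' : (randomRun G prm ξ (t + 1) ω).x = s.x - prm.etaX • (‖g‖⁻¹ • g) := rfl
  rw [← hx, hx']
  have h1 := hf.primal_normalized_step_le hℓ hμ hμℓ hη s.x g
  have h2 := hf.norm_gradient_primal_sub_le hℓ hμ hμℓ (s.x - prm.etaX • (‖g‖⁻¹ • g)) s.x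
  have h3 : ‖s.x - prm.etaX • (‖g‖⁻¹ • g) - s.x‖ ≤ prm.etaX := by
    rw [sub_sub_cancel_left, norm_neg, norm_smul, Real.norm_eq_abs, abs_of_nonneg hη]
    exact mul_le_of_le_one_right hη (norm_normalize_le _)
  have h4 : ‖∇ (primal f) (s.x - prm.etaX • (‖g‖⁻¹ • g))‖ ≤
      ‖∇ (primal f) s.x‖ + 2 * (ℓ / μ) * ℓ * prm.etaX := by
    have h5 := norm_sub_norm_le (∇ (primal f) (s.x - prm.etaX • (‖g‖⁻¹ • g))) (∇ (primal f) s.x)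
    have h6 : 2 * (ℓ / μ) * ℓ * ‖s.x - prm.etaX • (‖g‖⁻¹ • g) - s.x‖ ≤
        2 * (ℓ / μ) * ℓ * prm.etaX := by gcongr
    linarith
  have h7 : ‖g - ∇ (primal f) s.x‖ ≤ batchError f G prm ξ t ω + ℓ * gap f s.pos := by
    rw [hf.gradient_primal hℓ hμ]
    refine (norm_sub_le_norm_sub_add_norm_sub _ (∇ f (pair s.x s.y)).fst _).trans ?_
    exact add_le_add le_rfl (hf.norm_fst_gradient_sub_le_right s.x s.y (argmax f s.x))
  have h8 := mul_le_mul_of_nonneg_left h4 hη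
  have h9 := mul_le_mul_of_nonneg_left h7 hη
  nlinarith

theorem sum_norm_gradient_le (hf : IsSmoothStronglyConcave ℓ μ f) (hμ : 0 < μ) (hμℓ : μ ≤ ℓ)
    (hη : 0 < prm.etaX) (T : ℕ) (ω : Ω) :
    ∑ t ∈ Finset.range T, ‖∇ (primal f) (randomRun G prm ξ (t + 1) ω).x‖ ≤
      primalGap f prm.x₀ / prm.etaX + 9 / 2 * (ℓ / μ * ℓ * prm.etaX) * T +
      ∑ t ∈ Finset.range T, 2 * (batchError f G prm ξ t ω +
          ℓ * gap f (innerState G prm ξ t prm.K ω).pos) := by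
  have h : ∀ n : ℕ, primal f (randomRun G prm ξ n ω).x +
      prm.etaX * ∑ t ∈ Finset.range n, ‖∇ (primal f) (randomRun G prm ξ (t + 1) ω).x‖ ≤
      primal f prm.x₀ + prm.etaX * (9 / 2 * (ℓ / μ * ℓ * prm.etaX) * n +
      ∑ t ∈ Finset.range n, 2 * (batchError f G prm ξ t ω +
          ℓ * gap f (innerState G prm ξ t prm.K ω).pos)) := by
    intro n
    induction n with
    | zero => simp [randomRun, run]
    | succ n ih =>
      rw [Finset.sum_range_succ, Finset.sum_range_succ]
      have := outer_step_le (G := G) (ξ := ξ) hf hμ hμℓ hη.le n ω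
      push_cast
      linarith
  have h1 := h T
  have h2 : ⨅ x : Vec dx, primal f x ≤ primal f (randomRun G prm ξ T ω).x :=
    ciInf_le hf.bddBelow _
  rw [add_assoc, ← sub_le_iff_le_add, le_div_iff₀ hη, primalGap]
  linarith

variable [mΞ : MeasurableSpace Ξ] {P : Measure Ξ}

theorem measurable_randomRun_x (hG : IsPBCMOracle p σ f P G) (t : ℕ) :
    Measurable[hist ξ Set.univ] fun ω => (randomRun G prm ξ t ω).x :=
  measurable_fst.comp ((measurable_randomRun hG t).mono (hist_mono (Set.subset_univ _)) le_rfl)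

theorem hist_le_comap (S : Set ((ℕ × ℕ) ⊕ (ℕ × ℕ))) :
    hist ξ S ≤ MeasurableSpace.comap (fun ω i => ξ i ω) MeasurableSpace.pi := by
  refine iSup₂_le fun i _ => ?_
  have h : Measurable[MeasurableSpace.comap (fun ω i => ξ i ω) MeasurableSpace.pi] (ξ i) :=
    (measurable_pi_apply i).comp (comap_measurable (fun ω i => ξ i ω))
  exact h.comap_le

variable [mΩ : MeasurableSpace Ω] {Pr : Measure Ω}

/-- The expectation over the uniform index is an average. -/
theorem lintegral_index [IsProbabilityMeasure Pr] {T : ℕ} {J : Ω → ℕ} (hT : 1 ≤ T)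
    (hS : IsSampling Pr P T ξ J) {F : ℕ → Ω → ENNReal}
    (hF : ∀ t, Measurable[hist ξ Set.univ] (F t)) :
    ∫⁻ ω, F (J ω) ω ∂Pr = (T : ENNReal)⁻¹ * ∑ t ∈ Finset.range T, ∫⁻ ω, F (t + 1) ω ∂Pr := by
  have hξ : ∀ i, Measurable (ξ i) := fun i => (hS.law i).measurable
  have hFm : ∀ t, Measurable (F t) := fun t => (hF t).mono (hist_le hξ _) le_rfl
  have hJ : ∀ t, MeasurableSet (J ⁻¹' {t}) := fun t =>
    hS.measurable_index (measurableSet_singleton t)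
  -- The `T` masses `1/T` exhaust the total mass, so `J` lies in `{1, …, T}` almost surely.
  have hprob : Pr (J ⁻¹' (Finset.Icc 1 T : Set ℕ)) = 1 := by
    have h1 : J ⁻¹' (Finset.Icc 1 T : Set ℕ) = ⋃ t ∈ Finset.Icc 1 T, J ⁻¹' {t} := by
      ext ω; simp
    rw [h1, measure_biUnion_finset (fun s _ t _ hst => by
      refine Set.disjoint_left.2 fun ω h2 h3 => hst ?_
      exact (Set.mem_singleton_iff.1 h2).symm.trans (Set.mem_singleton_iff.1 h3))
      (fun t _ => hJ t), Finset.sum_congr rfl hS.uniform_index]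
    simp only [Finset.sum_const, Nat.card_Icc, add_tsub_cancel_right, nsmul_eq_mul]
    exact ENNReal.mul_inv_cancel (by exact_mod_cast (by omega : T ≠ 0)) (ENNReal.natCast_ne_top T)
  have hae : ∀ᵐ ω ∂Pr, F (J ω) ω =
      ∑ t ∈ Finset.Icc 1 T, (J ⁻¹' {t}).indicator (fun _ => 1) ω * F t ω := by
    have h2 : ∀ᵐ ω ∂Pr, ω ∈ J ⁻¹' (Finset.Icc 1 T : Set ℕ) :=
      (prob_compl_eq_zero_iff (hS.measurable_index (Finset.measurableSet _))).2 hprob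
    filter_upwards [h2] with ω hω
    rw [Finset.sum_eq_single (J ω)]
    · simp
    · intro t _ ht
      rw [Set.indicator_of_notMem, zero_mul]
      exact fun h => ht (Set.mem_singleton_iff.1 h).symm
    · intro h
      exact absurd hω h
  have hind := hS.indep_index
  rw [IndepFun_iff_Indep] at hind
  have hm : ∀ t, Measurable fun ω => (J ⁻¹' {t}).indicator (fun _ => (1 : ENNReal)) ω * F t ω :=
    fun t => (measurable_const.indicator (hJ t)).mul (hFm t)
  rw [lintegral_congr_ae hae, lintegral_finsetSum _ fun t _ => hm t]
  have h3 : ∀ t ∈ Finset.Icc 1 T, ∫⁻ ω, (J ⁻¹' {t}).indicator (fun _ => 1) ω * F t ω ∂Pr =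
      (T : ENNReal)⁻¹ * ∫⁻ ω, F t ω ∂Pr := by
    intro t ht
    have h4 := lintegral_mul_eq_lintegral_mul_lintegral_of_independent_measurableSpace (μ := Pr)
      (f := (J ⁻¹' {t}).indicator fun _ => 1) (g := F t)
      hS.measurable_index.comap_le (measurable_pi_lambda _ hξ).comap_le hind
      (Measurable.indicator measurable_const ⟨{t}, measurableSet_singleton t, rfl⟩)
      ((hF t).mono (hist_le_comap _) le_rfl)
    rw [h4, lintegral_indicator_const (hJ t), one_mul, hS.uniform_index t ht]
  rw [Finset.sum_congr rfl h3, ← Finset.mul_sum]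
  congr 1
  rw [Finset.range_eq_Ico, Finset.sum_Ico_add' (fun t => ∫⁻ ω, F t ω ∂Pr) 0 T 1, zero_add]
  rfl

theorem measurable_output (hG : IsPBCMOracle p σ f P G) (hξ : ∀ i, Measurable (ξ i)) {J : Ω → ℕ}
    (hJ : Measurable J) : Measurable (output G prm ξ J) := by
  have h : Measurable fun q : ℕ × Ω => (randomRun G prm ξ q.1 q.2).x :=
    measurable_from_prod_countable_right fun t =>
      (measurable_randomRun_x hG t).mono (hist_le hξ _) le_rfl
  exact h.comp (hJ.prodMk measurable_id)

theorem measurable_batchError (hf : IsSmoothStronglyConcave ℓ μ f) (hℓ : 0 < ℓ)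
    (hG : IsPBCMOracle p σ f P G) (hξ : ∀ i, Measurable (ξ i)) (t : ℕ) :
    Measurable (batchError f G prm ξ t) := by
  have h1 := (measurable_batchSum (prm := prm) hG t prm.M).mono (hist_le hξ _) le_rfl
  have h2 : Measurable fun q : Vec dx × Vec dy => (∇ f (pair q.1 q.2)).fst :=
    ((hf.continuous_gradient_fst hℓ).comp continuous_pair).measurable
  have h3 : Measurable fun q : (Vec dx × Vec dy) × Vec dx =>
      (prm.M : ℝ)⁻¹ • q.2 - (∇ f (pair q.1.1 q.1.2)).fst := by
    refine Measurable.sub ?_ (h2.comp measurable_fst)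
    fun_prop
  exact (h3.comp h1).norm

end Outer

/-! ### Error budget and oracle complexity. -/

section Conclusion

/-- The expected gradient norms of the iterates, summed over the outer iterations. -/
theorem sum_lintegral_norm_gradient_le {dx dy : ℕ} {Ω Ξ : Type*} [MeasurableSpace Ω]
    [MeasurableSpace Ξ] {Pr : Measure Ω} [IsProbabilityMeasure Pr] {P : Measure Ξ}
    [IsProbabilityMeasure P] {p ℓ μ σ ε R η : ℝ} {f : Joint dx dy → ℝ}
    {G : Joint dx dy → Ξ → Joint dx dy} {prm : Params dx dy} {ξ : (ℕ × ℕ) ⊕ (ℕ × ℕ) → Ω → Ξ}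
    (hf : IsSmoothStronglyConcave ℓ μ f) (hG : IsPBCMOracle p σ f P G)
    (hI : InnerRegime p ℓ μ σ R η prm) (hlaw : ∀ i, MeasurePreserving (ξ i) Pr P)
    (hind : iIndepFun ξ Pr) (hε : 0 < ε) (hR : 4 * ε / ℓ ≤ R)
    (hηX : prm.etaX = 1 / 50 * (ε / (ℓ / μ * ℓ)))
    (hM : prm.M = batchSize (batchConst p) p ε σ)
    (hrK : radius μ R η prm.K ≤ ε / (1000 * ℓ)) (h0 : ‖prm.y₀ - argmax f prm.x₀‖ ≤ R) {T : ℕ}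
    (hT : 1 ≤ T) (hTge : 500 * (primalGap f prm.x₀ * (ℓ / μ) * ℓ / ε ^ 2) ≤ T) :
    ∑ t ∈ Finset.range T,
      ∫⁻ ω, ENNReal.ofReal ‖∇ (primal f) (randomRun G prm ξ (t + 1) ω).x‖ ∂Pr ≤
      ENNReal.ofReal (T * ε) := by
  have hμ := hI.mu_pos
  have hℓ := hμ.trans_le hI.mu_le
  have hξ : ∀ i, Measurable (ξ i) := fun i => (hlaw i).measurable
  have hη0 : 0 < prm.etaX := by rw [hηX]; positivity
  have hT0 : (1 : ℝ) ≤ T := by exact_mod_cast hT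
  have hεR : ε / ℓ ≤ R / 4 := by
    rw [mul_div_assoc] at hR; linarith
  have hεℓ : 0 < ε / ℓ := by positivity
  have hδ : ℓ / μ * prm.etaX ≤ R / 100 := by
    have : ℓ / μ * prm.etaX = 1 / 50 * (ε / ℓ) := by rw [hηX]; field_simp
    rw [this]; linarith
  have hrK' : radius μ R η prm.K ≤ R / 100 := by
    have : ε / (1000 * ℓ) = 1 / 1000 * (ε / ℓ) := by field_simp
    rw [this] at hrK
    linarith
  have hrK0 := radius_pos (μ := μ) (η := η) hI.R_pos prm.K
  have hgap := sum_lintegral_gap_le hf hG hI hlaw hind hη0.le hδ hrK' h0 hT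
  have hbatch : ∀ t, ∫⁻ ω, ENNReal.ofReal (batchError f G prm ξ t ω) ∂Pr ≤
      ENNReal.ofReal (ε / 10) := fun t =>
    lintegral_minibatch_le (hf.continuous_gradient_fst hℓ) hG hI.one_lt hI.le_two hI.sigma_nonneg hε
      hM hlaw hind t
  set Δ := primalGap f prm.x₀ with hΔ
  have hΔ0 : 0 ≤ Δ := sub_nonneg.2 (ciInf_le hf.bddBelow _)
  set c := Δ / prm.etaX + 9 / 2 * (ℓ / μ * ℓ * prm.etaX) * T with hc
  have hc0 : 0 ≤ c := by positivity
  -- Budget per iteration, in units of `ε`: `10/100` from the primal gap and `9/100` from smoothness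
  -- here, then `20/100` from the minibatches and `8/100` from tracking.
  have hcle : c ≤ 19 / 100 * (T * ε) := by
    have h1 : ℓ / μ * ℓ * prm.etaX = ε / 50 := by rw [hηX]; field_simp
    have h2 : Δ / prm.etaX = 50 * ε * (Δ * (ℓ / μ) * ℓ / ε ^ 2) := by rw [hηX]; field_simp
    rw [hc, h1, h2]
    have h3 : 50 * ε * (500 * (Δ * (ℓ / μ) * ℓ / ε ^ 2)) ≤ 50 * ε * T := by gcongr
    nlinarith
  have hb0 : ∀ t ω, 0 ≤ batchError f G prm ξ t ω := fun t ω => norm_nonneg _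
  have hg0 : ∀ t ω, 0 ≤ gap f (innerState G prm ξ t prm.K ω).pos := fun t ω => gap_nonneg _
  have hbm : ∀ t, Measurable fun ω => ENNReal.ofReal (batchError f G prm ξ t ω) := fun t =>
    ENNReal.measurable_ofReal.comp (measurable_batchError hf hℓ hG hξ t)
  have hgm : ∀ t, Measurable fun ω =>
      ENNReal.ofReal (gap f (innerState G prm ξ t prm.K ω).pos) := fun t =>
    ENNReal.measurable_ofReal.comp (measurable_gap_innerState hf hG hξ hℓ hμ t prm.K)
  have hnm : ∀ t, Measurable fun ω =>
      ENNReal.ofReal ‖∇ (primal f) (randomRun G prm ξ (t + 1) ω).x‖ := fun t =>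
    ENNReal.measurable_ofReal.comp ((hf.continuous_gradient_primal hℓ hμ).measurable.comp
      ((measurable_randomRun_x hG (t + 1)).mono (hist_le hξ _) le_rfl)).norm
  rw [← lintegral_finsetSum _ fun t _ => hnm t]
  have hpt : ∀ ω, ∑ t ∈ Finset.range T,
      ENNReal.ofReal ‖∇ (primal f) (randomRun G prm ξ (t + 1) ω).x‖ ≤
      ENNReal.ofReal c + ∑ t ∈ Finset.range T, (2 * ENNReal.ofReal (batchError f G prm ξ t ω) +
        ENNReal.ofReal (2 * ℓ) * ENNReal.ofReal (gap f (innerState G prm ξ t prm.K ω).pos)) := by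
    intro ω
    rw [← ENNReal.ofReal_sum_of_nonneg fun t _ => norm_nonneg _]
    refine (ENNReal.ofReal_le_ofReal (sum_norm_gradient_le hf hμ hI.mu_le hη0 T ω)).trans ?_
    refine ENNReal.ofReal_add_le.trans (add_le_add le_rfl ?_)
    rw [ENNReal.ofReal_sum_of_nonneg fun t _ => mul_nonneg zero_le_two
      (add_nonneg (hb0 t ω) (mul_nonneg hℓ.le (hg0 t ω)))]
    refine Finset.sum_le_sum fun t _ => le_of_eq ?_
    rw [mul_add, ← mul_assoc, ENNReal.ofReal_add (mul_nonneg zero_le_two (hb0 t ω))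
      (mul_nonneg (by positivity) (hg0 t ω)), ENNReal.ofReal_mul zero_le_two,
      ENNReal.ofReal_mul (by positivity), ENNReal.ofReal_ofNat]
  have hsm : ∀ t, Measurable fun ω => 2 * ENNReal.ofReal (batchError f G prm ξ t ω) +
      ENNReal.ofReal (2 * ℓ) * ENNReal.ofReal (gap f (innerState G prm ξ t prm.K ω).pos) :=
    fun t => ((hbm t).const_mul _).add ((hgm t).const_mul _)
  refine (lintegral_mono hpt).trans ?_
  rw [lintegral_add_left measurable_const, lintegral_const, measure_univ, mul_one,
    lintegral_finsetSum _ fun t _ => hsm t]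
  have hterm : ∀ t, ∫⁻ ω, (2 * ENNReal.ofReal (batchError f G prm ξ t ω) +
      ENNReal.ofReal (2 * ℓ) * ENNReal.ofReal (gap f (innerState G prm ξ t prm.K ω).pos)) ∂Pr ≤
      ENNReal.ofReal (ε / 5) + ENNReal.ofReal (2 * ℓ) *
        ∫⁻ ω, ENNReal.ofReal (gap f (innerState G prm ξ t prm.K ω).pos) ∂Pr := by
    intro t
    rw [lintegral_add_left ((hbm t).const_mul _), lintegral_const_mul _ (hbm t),
      lintegral_const_mul _ (hgm t)]
    refine add_le_add ?_ le_rfl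
    refine (mul_le_mul_right (hbatch t) 2).trans_eq ?_
    rw [← ENNReal.ofReal_ofNat, ← ENNReal.ofReal_mul (by norm_num)]
    congr 1
    ring
  refine (add_le_add le_rfl (Finset.sum_le_sum fun t _ => hterm t)).trans ?_
  rw [Finset.sum_add_distrib, ← Finset.mul_sum, Finset.sum_const, Finset.card_range, nsmul_eq_mul,
    ← ENNReal.ofReal_natCast, ← ENNReal.ofReal_mul (by positivity)]
  refine (add_le_add le_rfl (add_le_add le_rfl (mul_le_mul_right hgap _))).trans ?_
  rw [← ENNReal.ofReal_mul (by positivity), ← ENNReal.ofReal_add (by positivity) (by positivity),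
    ← ENNReal.ofReal_add hc0 (by positivity)]
  refine ENNReal.ofReal_le_ofReal ?_
  have h1 : 2 * ℓ * (40 * T * radius μ R η prm.K) ≤ 2 * ℓ * (40 * T * (ε / (1000 * ℓ))) := by
    gcongr
  have h2 : 2 * ℓ * (40 * T * (ε / (1000 * ℓ))) = 8 / 100 * (T * ε) := by field_simp; norm_num
  have h3 : 0 < (T : ℝ) * ε := by positivity
  linarith

theorem batchConst_pos (p : ℝ) : 0 < batchConst p := by
  unfold batchConst; positivity

theorem innerConst_pos (p : ℝ) : 0 < innerConst p := by
  unfold innerConst; positivity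

/-- The oracle complexity. -/
theorem mul_add_le_complexity {p ℓ μ σ ε R Δ : ℝ} (hp : 1 < p) (hμ : 0 < μ) (hμℓ : μ ≤ ℓ)
    (hσ : 0 ≤ σ) (hε : 0 < ε) (hR : 4 * ε / ℓ ≤ R) (hΔ : ε ^ 2 ≤ Δ * (ℓ / μ) * ℓ) :
    ((outerLength 500 ε ℓ (ℓ / μ) Δ * (innerLength (innerConst p) (p / (p - 1)) p ε ℓ μ σ (ℓ / μ) R
      + batchSize (batchConst p) p ε σ) : ℕ) : ℝ) ≤
    501 * (innerConst p + batchConst p + 2) * Real.log (ℓ * R / ε) ^ (p / (p - 1)) *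
      (Δ * (ℓ / μ) ^ ((2 * p - 1) / (p - 1)) * ℓ * σ ^ (p / (p - 1)) / ε ^ ((3 * p - 2) / (p - 1))
        + Δ * (ℓ / μ) ^ 2 * ℓ / ε ^ 2) := by
  have hℓ := hμ.trans_le hμℓ
  have hp1 : p - 1 ≠ 0 := by linarith
  have hκ1 : 1 ≤ ℓ / μ := (one_le_div hμ).2 hμℓ
  have hL := one_le_log hℓ hε hR
  set κ := ℓ / μ with hκ
  set L := Real.log (ℓ * R / ε)
  set s := p / (p - 1) with hs
  have hs0 : 0 ≤ s := div_nonneg (by linarith) (by linarith)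
  have hLs : 1 ≤ L ^ s := Real.one_le_rpow hL hs0
  have hκ0 : 0 < κ := by linarith
  set X := Δ * κ * ℓ / ε ^ 2 with hX
  -- The assumption `ε² ≤ Δκℓ` serves to absorb the rounding up of `T`; the roundings of `K` and `M`
  -- are absorbed by `L^s (κ + S) ≥ 1`.
  have hX1 : 1 ≤ X := by rwa [hX, le_div_iff₀ (by positivity), one_mul]
  set S := (κ * σ / ε) ^ s with hS
  have hS0 : 0 ≤ S := by positivity
  have hTle : (outerLength 500 ε ℓ κ Δ : ℝ) ≤ 501 * X := by
    rw [outerLength, Nat.cast_max]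
    refine max_le (by push_cast; linarith) ?_
    have := Nat.ceil_lt_add_one (by linarith : (0 : ℝ) ≤ 500 * X)
    linarith
  have hW : 1 ≤ L ^ s * (κ + S) := by nlinarith
  have hKle : (innerLength (innerConst p) s p ε ℓ μ σ κ R : ℝ) ≤
      (innerConst p + 1) * (L ^ s * (κ + S)) := by
    have h1 : (ℓ ^ 2 * σ ^ 2 / (μ ^ 2 * ε ^ 2)) ^ (p / (2 * (p - 1))) = S := by
      rw [rpow_noise_ratio hp hℓ hμ hσ hε, hS, hκ]
      congr 1
      field_simp
    rw [innerLength, h1]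
    have hc := innerConst_pos p
    have := Nat.ceil_lt_add_one (by positivity : (0 : ℝ) ≤ innerConst p * L ^ s * (κ + S))
    calc ((⌈innerConst p * L ^ s * (κ + S)⌉₊ : ℕ) : ℝ) ≤ innerConst p * L ^ s * (κ + S) + 1 := this.le
      _ ≤ innerConst p * L ^ s * (κ + S) + L ^ s * (κ + S) := by linarith
      _ = _ := by ring
  have hMle : (batchSize (batchConst p) p ε σ : ℝ) ≤ (batchConst p + 1) * (L ^ s * (κ + S)) := by
    have hc := batchConst_pos p
    have h1 : (σ / ε) ^ s ≤ S := by
      rw [hS, mul_div_assoc]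
      refine Real.rpow_le_rpow (by positivity) ?_ hs0
      exact le_mul_of_one_le_left (by positivity) hκ1
    have h2 : S ≤ L ^ s * (κ + S) := by nlinarith
    rw [batchSize, Nat.cast_max]
    refine max_le (by push_cast; nlinarith) ?_
    have := Nat.ceil_lt_add_one (by positivity : (0 : ℝ) ≤ batchConst p * (σ / ε) ^ s)
    refine this.le.trans ?_
    nlinarith
  have hfinal : X * (κ + S) = Δ * κ ^ ((2 * p - 1) / (p - 1)) * ℓ * σ ^ s /
      ε ^ ((3 * p - 2) / (p - 1)) + Δ * κ ^ 2 * ℓ / ε ^ 2 := by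
    have h1 : κ ^ ((2 * p - 1) / (p - 1)) = κ * κ ^ s := by
      rw [mul_comm κ, ← Real.rpow_add_one hκ0.ne']
      congr 1
      rw [hs]; field_simp; ring
    have h2 : ε ^ ((3 * p - 2) / (p - 1)) = ε ^ 2 * ε ^ s := by
      rw [← Real.rpow_natCast, ← Real.rpow_add hε]
      congr 1
      rw [hs]; push_cast; field_simp; ring
    have h3 : 0 < ε ^ s := by positivity
    rw [h1, h2, hS, Real.div_rpow (by positivity) hε.le, Real.mul_rpow hκ0.le hσ, hX]
    field_simp
    ring
  rw [← hfinal]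
  push_cast
  calc (outerLength 500 ε ℓ κ Δ : ℝ) * ((innerLength (innerConst p) s p ε ℓ μ σ κ R : ℝ) +
        (batchSize (batchConst p) p ε σ : ℝ))
      ≤ (501 * X) * ((innerConst p + 1) * (L ^ s * (κ + S)) +
        (batchConst p + 1) * (L ^ s * (κ + S))) := by gcongr
    _ = _ := by ring

end Conclusion

end Minimax

theorem mainTheorem3 (p : ℝ) (hp₁ : 1 < p) (hp₂ : p ≤ 2) :
    -- constants that depend on `p` alone
    ∃ cX CT CM CK a CS b : ℝ,
      0 < cX ∧ 0 < CT ∧ 0 < CM ∧ 0 < CK ∧ 0 ≤ a ∧ 0 < CS ∧ 0 ≤ b ∧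
      ∀ (dx dy : ℕ) (_ : NeZero dy)
        (Ξ : Type u) (_ : MeasurableSpace Ξ) (P : Measure Ξ) (_ : IsProbabilityMeasure P)
        (Ω : Type v) (_ : MeasurableSpace Ω) (Pr : Measure Ω) (_ : IsProbabilityMeasure Pr)
        (ℓ μ σ ε : ℝ) (f : Minimax.Joint dx dy → ℝ)
        (G : Minimax.Joint dx dy → Ξ → Minimax.Joint dx dy)
        (x₀ : Minimax.Vec dx) (y₀ yStar : Minimax.Vec dy) (R₀ κ Δ R B : ℝ)
        (prm : Minimax.Params dx dy)
        (ξ : (ℕ × ℕ) ⊕ (ℕ × ℕ) → Ω → Ξ) (J : Ω → ℕ),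
        0 < ℓ → 0 < μ → 0 ≤ σ → 0 < ε →
        Minimax.IsSmoothStronglyConcave ℓ μ f →
        Minimax.IsPBCMOracle p σ f P G →
        -- `yStar = y*(x₀)` and `R₀ ≥ ‖y₀ - y*(x₀)‖`
        IsMaxOn (fun y => f (Minimax.pair x₀ y)) Set.univ yStar →
        ‖y₀ - yStar‖ ≤ R₀ →
        κ = ℓ / μ →
        Δ = Minimax.primalGap f x₀ →
        R = R₀ + 4 * ε / ℓ →
        -- the parameters of the method
        prm.x₀ = x₀ → prm.y₀ = y₀ →
        prm.etaX = cX * (ε / (κ * ℓ)) →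
        prm.T = Minimax.outerLength CT ε ℓ κ Δ →
        prm.M = Minimax.batchSize CM p ε σ →
        prm.K = Minimax.innerLength CK a p ε ℓ μ σ κ R →
        Minimax.IsLogFactor p μ σ R prm.K B →
        (∀ t, prm.etaY t = Minimax.innerStepsize ℓ μ σ prm.K B) →
        (∀ t k, prm.tau t k = Minimax.clipLevel μ R (prm.etaY t) k) →
        Minimax.IsSampling Pr P prm.T ξ J →
        -- the conclusion
        Differentiable ℝ (Minimax.primal f) ∧
        Integrable (fun ω => ‖∇ (Minimax.primal f) (Minimax.output G prm ξ J ω)‖) Pr ∧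
        ∫ ω, ‖∇ (Minimax.primal f) (Minimax.output G prm ξ J ω)‖ ∂Pr ≤ ε ∧
        (ε ^ 2 ≤ Δ * κ * ℓ → ∀ ω,
          ((Minimax.randomRun G prm ξ prm.T ω).calls : ℝ) ≤
            CS * Real.log (ℓ * R / ε) ^ b *
              (Δ * κ ^ ((2 * p - 1) / (p - 1)) * ℓ * σ ^ (p / (p - 1))
                  / ε ^ ((3 * p - 2) / (p - 1))
                + Δ * κ ^ 2 * ℓ / ε ^ 2)) := by
  refine ⟨1 / 50, 500, Minimax.batchConst p, Minimax.innerConst p, p / (p - 1),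
    501 * (Minimax.innerConst p + Minimax.batchConst p + 2), p / (p - 1), by norm_num, by norm_num,
    Minimax.batchConst_pos p, Minimax.innerConst_pos p, div_nonneg (by linarith) (by linarith), ?_,
    div_nonneg (by linarith) (by linarith), ?_⟩
  · have := Minimax.batchConst_pos p
    have := Minimax.innerConst_pos p
    positivity
  intro dx dy _ Ξ _ P _ Ω _ Pr _ ℓ μ σ ε f G x₀ y₀ yStar R₀ κ Δ R B prm ξ J hℓ hμ hσ hε hf hG hStar
    hR₀ hκ hΔ hR hx₀ hy₀ hηX hT hM hK hB hηY hτ hS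
  subst hκ
  have hμℓ := hf.le_smoothness hℓ hμ
  have hR₀0 : 0 ≤ R₀ := (norm_nonneg _).trans hR₀
  have hRle : 4 * ε / ℓ ≤ R := by linarith
  have hR0 : 0 < R := lt_of_lt_of_le (by positivity) hRle
  have hT1 : 1 ≤ prm.T := by rw [hT]; exact le_max_left _ _
  have hξ : ∀ i, Measurable (ξ i) := fun i => (hS.law i).measurable
  obtain ⟨hη0, hηℓ, hK0, h3K, hκK, hrK, hnoise⟩ :=
    Minimax.inner_parameters hp₁ hp₂ hμ hμℓ hσ hε hRle hK hB rfl
  set η := Minimax.innerStepsize ℓ μ σ prm.K B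
  have hI : Minimax.InnerRegime p ℓ μ σ R η prm :=
    ⟨hηY, fun t k => by rw [hτ, hηY], hp₁, hp₂, hμ, hμℓ, hσ, hR0, hη0, hηℓ, hK0, h3K, hκK, hnoise⟩
  have h0 : ‖prm.y₀ - Minimax.argmax f prm.x₀‖ ≤ R := by
    rw [hx₀, hy₀, ← hf.eq_argmax hℓ hμ hStar]
    have : 0 ≤ 4 * ε / ℓ := by positivity
    linarith
  have hTge : 500 * (Minimax.primalGap f prm.x₀ * (ℓ / μ) * ℓ / ε ^ 2) ≤ prm.T := by
    rw [hx₀, ← hΔ, hT, Minimax.outerLength]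
    exact (Nat.le_ceil _).trans (by exact_mod_cast le_max_right _ _)
  have hsum := Minimax.sum_lintegral_norm_gradient_le hf hG hI hS.law hS.indep hε hRle hηX hM hrK h0
    hT1 hTge
  have hgc := hf.continuous_gradient_primal hℓ hμ
  have hlint : ∫⁻ ω, ENNReal.ofReal ‖∇ (Minimax.primal f) (Minimax.output G prm ξ J ω)‖ ∂Pr ≤
      ENNReal.ofReal ε := by
    refine (Minimax.lintegral_index hT1 hS (F := fun t ω =>
      ENNReal.ofReal ‖∇ (Minimax.primal f) (Minimax.randomRun G prm ξ t ω).x‖) fun t =>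
      (ENNReal.measurable_ofReal.comp (measurable_norm.comp hgc.measurable)).comp
        (Minimax.measurable_randomRun_x hG t)).trans_le ?_
    refine (mul_le_mul_right hsum _).trans_eq ?_
    rw [ENNReal.ofReal_mul (Nat.cast_nonneg _), ENNReal.ofReal_natCast, ← mul_assoc,
      ENNReal.inv_mul_cancel (by exact_mod_cast (by omega : prm.T ≠ 0))
      (ENNReal.natCast_ne_top _), one_mul]
  obtain ⟨hint, hle⟩ := Minimax.integrable_of_lintegral_ofReal_le
    (hgc.measurable.comp
      (Minimax.measurable_output hG hξ hS.measurable_index)).norm.aestronglyMeasurable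
    (fun _ => norm_nonneg _) hε.le hlint
  refine ⟨hf.differentiable_primal hℓ hμ, hint, hle, fun hbig ω => ?_⟩
  rw [Minimax.calls_randomRun, hT, hK, hM]
  exact Minimax.mul_add_le_complexity hp₁ hμ hμℓ hσ hε hRle hbig
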